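/- Let $X$ be a connected Riemann surface (for instance a compact one of genus $>1$) and let $\lambda\in\mathbb{C}^*$. Let $E$ be a holomorphic rank-2 bundle on $X$ with trivialised determinant, and let $\nabla_\lambda:E\to E\otimes K_X$ be an $SL_2(\mathbb{C})$ $\lambda$-connection, i.e. a $\mathbb{C}$-linear sheaf map with $\nabla_\lambda(fs)=\lambda\,df\otimes s+f\nabla_\lambda s$ that induces $\lambda d$ on $\det E\simeq\mathcal{O}_X$. Assume that $(E,\nabla_\lambda)$ is irreducible (no holomorphic line subbundle of $E$ is $\nabla_\lambda$-invariant), and let $L\subset E$ be any holomorphic line subbundle. For a local coordinate $z$ and a local frame $(e_1,e_2)$ of $E$ with $e_1$ generating $L$ in which $\nabla_\lambda=\lambda\partial_z+\begin{pmatrix}a&b\\c&-a\end{pmatrix}$, put $$g_\lambda=a-\frac{\lambda}{2}\frac{c'}{c},\qquad q=-\bigl(bc+g_\lambda^2+\lambda g_\lambda'\bigr),$$ and let $\mathcal{D}$ be the collection of all the local operators $\lambda^2\partial_z^2+q(z)$ so obtained. Then: 1. $\mathcal{D}$ is a $PSL_2(\mathbb{C})$-oper with apparent singularities: the potentials $q$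 are meromorphic; the operators are compatible, i.e. if $f$ is a local solution for the coordinate $z_\alpha$ and $N^2=dz_\beta/dz_\alpha$, then $Nf$ is a solution for the coordinate $z_\beta$ (solutions are sections of $K_X^{-1/2}$); and near every point of $X$ the ratios $f_1/f_2$ of linearly independent solutions define holomorphic maps to $\mathbb{P}^1$. 2. $\mathcal{D}$ is equivalent to the oper obtained by projectivising $(L\subset E,\nabla_\lambda)$. That is, the following two collections of local maps to $\mathbb{P}^1$ are branched projective structures, and so is their union: the holomorphic maps given by the ratios $f_1/f_2$ of linearly independent solutions of the operators in $\mathcal{D}$; and the maps describing the section $\mathbb{P}(L)$ of $\mathbb{P}(E)$ in the trivialisations of $\mathbb{P}(E)$ by local $\nabla_\lambda$-parallel frames. Here a branched projective structure is a collection of holomorphic, nowhere locally constant maps to $\mathbb{P}^1$ on the members of an open covering of $X$, whose values are related on overlaps by locally constant Möbius transformations. 3. If $\lambda=1$, then for every base point $x_0\in X$ the connection $(E,\nabla_1)$ has a monodromy representation $\rho:\pi_1(X,x_0)\to SL_2(\mathbb{C})$; for every such $\rho$ (it depends on a parallel frame at $x_0$) the composition of $\rho$ with the projection $SL_2(\mathbb{C})\to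 PSL_2(\mathbb{C})$ is a monodromy representation of $\mathcal{D}$, and every monodromy representation of $\mathcal{D}$ at $x_0$ (defined by analytic continuation of a developing map) is conjugate to it in $PSL_2(\mathbb{C})$. -/

import Mathlib

open Bundle Filter
open scoped Manifold ContDiff Topology LinearAlgebra.Projectivization MatrixGroups

noncomputable section

/-! ### Holomorphic rank two bundles, line subbundles, `SL₂` lambda-connections

Throughout, `X` is a Riemann surface (a complex analytic manifold modelled on `ℂ`) and `E` is a
holomorphic vector bundle on `X` of rank two (model fibre `ℂ²`). -/

section Bundles

variable {X : Type*} [TopologicalSpace X] [ChartedSpace ℂ X]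

/-- The function `f` is holomorphic at (i.e. in a neighbourhood of) the point `x`. -/
def HolAt {F : Type*} [NormedAddCommGroup F] [NormedSpace ℂ F] (f : X → F) (x : X) : Prop :=
  ContMDiffAt 𝓘(ℂ) 𝓘(ℂ, F) ω f x

variable {E : X → Type*} [∀ x, AddCommGroup (E x)] [∀ x, Module ℂ (E x)]
  [∀ x, TopologicalSpace (E x)] [TopologicalSpace (TotalSpace (Fin 2 → ℂ) E)]
  [FiberBundle (Fin 2 → ℂ) E]

/-- The section `s` of `E` is holomorphic at (i.e. in a neighbourhood of) the point `x`. -/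
def HolSectionAt (s : Π x, E x) (x : X) : Prop :=
  ContMDiffAt 𝓘(ℂ) (𝓘(ℂ).prod 𝓘(ℂ, Fin 2 → ℂ)) ω
    (fun y => (TotalSpace.mk y (s y) : TotalSpace (Fin 2 → ℂ) E)) x

variable (E) in
/-- A holomorphic line subbundle of `E`: a line in every fibre, locally spanned by a nowhere
vanishing holomorphic section of `E`. -/
structure LineSubbundle where
  fiber : Π x, Submodule ℂ (E x)
  exists_generator : ∀ x, ∃ s : Π y, E y,
    ∀ᶠ y in 𝓝 x, HolSectionAt s y ∧ s y ≠ 0 ∧ fiber y = ℂ ∙ s y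

variable (E) in
/-- An `SL₂(ℂ)` `lam`-connection on `E`. The field `vol` is a holomorphic trivialisation of the
determinant of `E`; the field `nabla` is a `ℂ`-linear sheaf map from `E` to `E ⊗ K_X`, whose values
at a point are written as linear maps from the tangent line to the fibre. Only the values of
`nabla` on germs of holomorphic sections are meaningful. -/
structure SLTwoLambdaConnection (lam : ℂ) where
  vol : Π x, (E x) [⋀^Fin 2]→ₗ[ℂ] ℂ
  vol_ne_zero : ∀ x, vol x ≠ 0
  vol_hol : ∀ (s t : Π x, E x) (x : X), HolSectionAt s x → HolSectionAt t x →
    HolAt (fun y => vol y ![s y, t y]) x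
  nabla : (Π x, E x) → Π x, TangentSpace 𝓘(ℂ) x →ₗ[ℂ] E x
  /-- `nabla` is local -/
  nabla_congr : ∀ (s t : Π x, E x) (x : X), HolSectionAt s x →
    (∀ᶠ y in 𝓝 x, s y = t y) → nabla s x = nabla t x
  nabla_add : ∀ (s t : Π x, E x) (x : X), HolSectionAt s x → HolSectionAt t x →
    nabla (fun y => s y + t y) x = nabla s x + nabla t x
  /-- the twisted Leibniz rule `∇(f s) = lam df ⊗ s + f ∇ s` -/
  nabla_leibniz : ∀ (f : X → ℂ) (s : Π x, E x) (x : X), HolAt f x → HolSectionAt s x →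
    ∀ v : TangentSpace 𝓘(ℂ) x,
      nabla (fun y => f y • s y) x v = (lam * mvfderiv 𝓘(ℂ) f x v) • s x + f x • nabla s x v
  /-- `nabla s` is holomorphic: with respect to a local coordinate `z` it is `t dz` for some
  holomorphic section `t` -/
  nabla_hol : ∀ (s : Π x, E x) (x : X), HolSectionAt s x →
    ∀ φ ∈ IsManifold.maximalAtlas 𝓘(ℂ) ω X, x ∈ φ.source →
      ∃ t : Π y, E y, HolSectionAt t x ∧
        ∀ᶠ y in 𝓝 x, ∀ v : TangentSpace 𝓘(ℂ) y, nabla s y v = mvfderiv 𝓘(ℂ) φ y v • t y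
  /-- `nabla` induces `lam d` on the (trivialised) determinant of `E` -/
  nabla_vol : ∀ (s t : Π x, E x) (x : X), HolSectionAt s x → HolSectionAt t x →
    ∀ v : TangentSpace 𝓘(ℂ) x,
      lam * mvfderiv 𝓘(ℂ) (fun y => vol y ![s y, t y]) x v =
        vol x ![nabla s x v, t x] + vol x ![s x, nabla t x v]

end Bundles

/-! ### Branched projective structures and their monodromy -/

section Projective

variable {X : Type*} [TopologicalSpace X] [ChartedSpace ℂ X]

/-- The complex projective line. -/
abbrev PLine : Type := ℙ ℂ (Fin 2 → ℂ)

/-- The vector `u` is nonzero and gives homogeneous coordinates of the point `p` of `ℙ¹`. -/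
def HomogeneousCoord (p : PLine) (u : Fin 2 → ℂ) : Prop :=
  ∃ h : u ≠ 0, p = Projectivization.mk ℂ u h

/-- The map `w` to `ℙ¹` is holomorphic at (i.e. in a neighbourhood of) `x`: it has holomorphic
homogeneous coordinates there. -/
def PHolAt (w : X → PLine) (x : X) : Prop :=
  ∃ u : X → Fin 2 → ℂ, HolAt u x ∧ ∀ᶠ y in 𝓝 x, HomogeneousCoord (w y) (u y)

/-- Branched projective structures: collections of pairs `(V, w)` where the `V` form an open
covering of `X`, each `w` is a holomorphic map from `V` to `ℙ¹` that is not constant near any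
point of `V`, and the values of any two of the maps are related by (locally constant) Möbius
transformations on the overlaps. The values of `w` off `V` are irrelevant. -/
structure IsBranchedProjectiveStructure (S : Set (Set X × (X → PLine))) : Prop where
  cover : ∀ x, ∃ p ∈ S, x ∈ p.1
  isOpen : ∀ p ∈ S, IsOpen p.1
  holomorphic : ∀ p ∈ S, ∀ x ∈ p.1, PHolAt p.2 x
  nonconstant : ∀ p ∈ S, ∀ x ∈ p.1, ¬ ∀ᶠ y in 𝓝 x, p.2 y = p.2 x
  moebius : ∀ p ∈ S, ∀ p' ∈ S, ∀ x ∈ p.1 ∩ p'.1, ∃ g : SL(2, ℂ), ∀ᶠ y in 𝓝 x, p'.2 y = g • p.2 y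

/-- Two branched projective structures are equivalent if their union is a branched projective
structure. -/
def BPSEquivalent (S T : Set (Set X × (X → PLine))) : Prop :=
  IsBranchedProjectiveStructure S ∧ IsBranchedProjectiveStructure T ∧
    IsBranchedProjectiveStructure (S ∪ T)

/-- `W` is an analytic continuation along the path `γ` of a germ of holomorphic map to `ℙ¹`:
for each `t`, the map `W t` is (a representative of) a germ at `γ t`. -/
def IsContinuationAlong {x y : X} (γ : Path x y) (W : unitInterval → X → PLine) : Prop :=
  ∀ t, PHolAt (W t) (γ t) ∧ ∀ᶠ t' in 𝓝 t, W t' =ᶠ[𝓝 (γ t')] W t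

/-- `σ` is the `PSL₂(ℂ)` monodromy representation of the branched projective structure `S`, with
base point `x₀`, defined by the developing map that extends some local map `w` of `S` at `x₀`.
In `FundamentalGroup X x₀` the product `γ * δ` is the class of `δ` followed by `γ`; hence the
continuation of `w` along `γ` is `(σ γ)⁻¹ • w`. -/
def IsMonodromyOfBPS (S : Set (Set X × (X → PLine))) (x₀ : X)
    (σ : FundamentalGroup X x₀ →* Matrix.ProjectiveSpecialLinearGroup (Fin 2) ℂ) : Prop :=
  ∃ p ∈ S, x₀ ∈ p.1 ∧ ∀ γ : Path x₀ x₀, ∃ W : unitInterval → X → PLine,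
    IsContinuationAlong γ W ∧ W 0 = p.2 ∧
    ∀ᶠ y in 𝓝 x₀, W 1 y =
      (σ (FundamentalGroup.fromPath (Path.Homotopic.Quotient.mk γ)))⁻¹ • p.2 y

end Projective

/-! ### Opers (with apparent singularities) -/

section Opers

variable {X : Type*} [TopologicalSpace X] [ChartedSpace ℂ X]

/-- `f` is a holomorphic solution near `z` of the Schrödinger equation
`lam² f'' + q f = 0`. -/
def IsSolutionAt (lam : ℂ) (q f : ℂ → ℂ) (z : ℂ) : Prop :=
  AnalyticAt ℂ f z ∧ ∀ᶠ u in 𝓝 z, lam ^ 2 * deriv (deriv f) u + q u * f u = 0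

/-- The local maps to `ℙ¹` defined by a collection of local Schrödinger operators
`lam² ∂_z² + q(z)`, each given by a coordinate chart and a potential: the holomorphic maps `w` on
open sets `V`, contained in the domain of one of the charts, which near each point of `V` that is
not a singularity of `q` are the ratio `[f₁ : f₂]` of two linearly independent solutions. -/
def developingMaps (lam : ℂ) (D : Set (OpenPartialHomeomorph X ℂ × (ℂ → ℂ))) :
    Set (Set X × (X → PLine)) :=
  {p | IsOpen p.1 ∧ (∀ x ∈ p.1, PHolAt p.2 x) ∧ ∃ d ∈ D, p.1 ⊆ d.1.source ∧
    ∀ x ∈ p.1, AnalyticAt ℂ d.2 (d.1 x) → ∃ f₁ f₂ : ℂ → ℂ,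
      IsSolutionAt lam d.2 f₁ (d.1 x) ∧ IsSolutionAt lam d.2 f₂ (d.1 x) ∧
      f₁ (d.1 x) * deriv f₂ (d.1 x) - f₂ (d.1 x) * deriv f₁ (d.1 x) ≠ 0 ∧
      ∀ᶠ y in 𝓝 x, HomogeneousCoord (p.2 y) ![f₁ (d.1 y), f₂ (d.1 y)]}

/-- `D` is a `PSL₂(ℂ)`-oper with apparent singularities: a collection of local Schrödinger operators
`lam² ∂_z² + q(z)` with meromorphic potentials, with respect to holomorphic coordinates `z` whose
domains cover `X`, such that

* the operators are compatible: solutions are sections of `K_X^{-1/2}`, i.e. if `f` is a solution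
  with respect to `z_α` then `N f`, with `N² = dz_β/dz_α`, is a solution with respect to `z_β`;
* the singularities are apparent: the ratios of solutions define holomorphic maps to `ℙ¹` near
  every point of `X`. -/
structure IsOper (lam : ℂ) (D : Set (OpenPartialHomeomorph X ℂ × (ℂ → ℂ))) : Prop where
  chart_mem : ∀ d ∈ D, d.1 ∈ IsManifold.maximalAtlas 𝓘(ℂ) ω X
  cover : ∀ x, ∃ d ∈ D, x ∈ d.1.source
  meromorphic : ∀ d ∈ D, MeromorphicOn d.2 d.1.target
  compatible : ∀ d ∈ D, ∀ d' ∈ D, ∀ x ∈ d.1.source ∩ d'.1.source, ∃ N : X → ℂ, HolAt N x ∧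
    ∀ᶠ y in 𝓝 x, N y ^ 2 = deriv (fun z => d'.1 (d.1.symm z)) (d.1 y) ∧
      (AnalyticAt ℂ d.2 (d.1 y) → AnalyticAt ℂ d'.2 (d'.1 y) → ∀ f : X → ℂ,
        IsSolutionAt lam d.2 (fun z => f (d.1.symm z)) (d.1 y) →
        IsSolutionAt lam d'.2 (fun z => N (d'.1.symm z) * f (d'.1.symm z)) (d'.1 y))
  apparent : ∀ x, ∃ p ∈ developingMaps lam D, x ∈ p.1

/-- The function `g = a - (lam / 2) c' / c`. -/
def gFun (lam : ℂ) (a c : ℂ → ℂ) (z : ℂ) : ℂ := a z - lam / 2 * (deriv c z / c z)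

/-- The potential `q = -(b c + g² + lam g')`. -/
def potential (lam : ℂ) (a b c : ℂ → ℂ) (z : ℂ) : ℂ :=
  -(b z * c z + gFun lam a c z ^ 2 + lam * deriv (gFun lam a c) z)

end Opers

/-! ### The constructions from a triple `(E, L, ∇)` -/

namespace SLTwoLambdaConnection

variable {X : Type*} [TopologicalSpace X] [ChartedSpace ℂ X]
  {E : X → Type*} [∀ x, AddCommGroup (E x)] [∀ x, Module ℂ (E x)]
  [∀ x, TopologicalSpace (E x)] [TopologicalSpace (TotalSpace (Fin 2 → ℂ) E)]
  [FiberBundle (Fin 2 → ℂ) E] {lam : ℂ}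

/-- The line subbundle `M` is invariant under the `lam`-connection. -/
def IsInvariant (C : SLTwoLambdaConnection E lam) (M : LineSubbundle E) : Prop :=
  ∀ (s : Π x, E x) (x : X), HolSectionAt s x → (∀ᶠ y in 𝓝 x, s y ∈ M.fiber y) →
    ∀ v : TangentSpace 𝓘(ℂ) x, C.nabla s x v ∈ M.fiber x

/-- A `lam`-connection on a rank two bundle is irreducible if it has no invariant line
subbundle. -/
def IsIrreducible (C : SLTwoLambdaConnection E lam) : Prop :=
  ∀ M : LineSubbundle E, ¬ C.IsInvariant M

/-- In the coordinate `z` given by the chart `φ`, and in some frame `(e₁, e₂)` of `E` over the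
domain of `φ` that is adapted to `L` (`e₁` generates `L`), the `lam`-connection is
`lam ∂_z + !![a, b; c, -a]`. -/
def IsLocalForm (C : SLTwoLambdaConnection E lam) (L : LineSubbundle E)
    (φ : OpenPartialHomeomorph X ℂ) (a b c : ℂ → ℂ) : Prop :=
  AnalyticOnNhd ℂ a φ.target ∧ AnalyticOnNhd ℂ b φ.target ∧ AnalyticOnNhd ℂ c φ.target ∧
  ∃ e₁ e₂ : Π x, E x, ∀ x ∈ φ.source,
    HolSectionAt e₁ x ∧ HolSectionAt e₂ x ∧ LinearIndependent ℂ ![e₁ x, e₂ x] ∧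
    L.fiber x = ℂ ∙ e₁ x ∧
    ∀ v : TangentSpace 𝓘(ℂ) x,
      C.nabla e₁ x v = mvfderiv 𝓘(ℂ) φ x v • (a (φ x) • e₁ x + c (φ x) • e₂ x) ∧
      C.nabla e₂ x v = mvfderiv 𝓘(ℂ) φ x v • (b (φ x) • e₁ x - a (φ x) • e₂ x)

/-- The collection of all local operators `lam² ∂_z² + q(z)` with `q = -(b c + g² + lam g')`, for
all local coordinates `z` and all frames adapted to `L`. -/
def inducedOper (C : SLTwoLambdaConnection E lam) (L : LineSubbundle E) :
    Set (OpenPartialHomeomorph X ℂ × (ℂ → ℂ)) :=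
  {d | d.1 ∈ IsManifold.maximalAtlas 𝓘(ℂ) ω X ∧
    ∃ a b c : ℂ → ℂ, C.IsLocalForm L d.1 a b c ∧ d.2 = potential lam a b c}

/-- `(s 0, s 1)` is a parallel holomorphic frame of `E` near `x`. -/
def IsParallelFrameAt (C : SLTwoLambdaConnection E lam) (s : Fin 2 → Π x, E x) (x : X) : Prop :=
  ∀ᶠ y in 𝓝 x, LinearIndependent ℂ (fun i => s i y) ∧
    ∀ i, HolSectionAt (s i) y ∧ C.nabla (s i) y = 0

/-- The local maps to `ℙ¹` obtained by projectivising `(L ⊂ E, ∇)`: a parallel frame `(s 0, s 1)`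
over an open set `V` identifies the restriction to `V` of the flat bundle `ℙ(E)` with `V × ℙ¹`,
and the section of `ℙ(E)` given by `L` with a map from `V` to `ℙ¹`. -/
def projectivisation (C : SLTwoLambdaConnection E lam) (L : LineSubbundle E) :
    Set (Set X × (X → PLine)) :=
  {p | IsOpen p.1 ∧ ∃ s : Fin 2 → Π x, E x, ∀ x ∈ p.1, C.IsParallelFrameAt s x ∧
    ∃ u : Fin 2 → ℂ, HomogeneousCoord (p.2 x) u ∧ L.fiber x = ℂ ∙ (u 0 • s 0 x + u 1 • s 1 x)}

/-- `ρ` is the `SL₂(ℂ)` monodromy representation of `(E, ∇)`, with base point `x₀`, with respect to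
some parallel frame `s` at `x₀`: the continuation of `s` along a loop `γ` as a parallel frame is
the frame `s ρ(γ)` (the product of the row `s` and the matrix `ρ(γ)`). -/
def IsMonodromy (C : SLTwoLambdaConnection E lam) (x₀ : X)
    (ρ : FundamentalGroup X x₀ →* SL(2, ℂ)) : Prop :=
  ∃ s : Fin 2 → Π x, E x, ∀ γ : Path x₀ x₀, ∃ F : unitInterval → Fin 2 → Π x, E x,
    (∀ t, C.IsParallelFrameAt (F t) (γ t) ∧
      ∀ᶠ t' in 𝓝 t, ∀ i, ∀ᶠ y in 𝓝 (γ t'), F t' i y = F t i y) ∧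
    F 0 = s ∧
    ∀ i, ∀ᶠ y in 𝓝 x₀, F 1 i y =
      ∑ j, (ρ (FundamentalGroup.fromPath (Path.Homotopic.Quotient.mk γ))).1 j i • s j y

end SLTwoLambdaConnection

/-- The projection from `SL₂(ℂ)` to `PSL₂(ℂ)`. -/
def projPSL : SL(2, ℂ) →* Matrix.ProjectiveSpecialLinearGroup (Fin 2) ℂ :=
  QuotientGroup.mk' _

end

set_option linter.unusedSectionVars false

/-! In an adapted frame, a section t = u₁e₁ + u₂e₂ is parallel exactly when λu₁' + a u₁ + b u₂ = 0
and λu₂' + c u₁ − a u₂ = 0. Where c ≠ 0, choose r with r² = c. Eliminating u₁ shows that f = u₂/r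
solves λ²f'' + q f = 0. Conversely, every solution f gives a parallel section with u₁ = (g f −
λf')/r and u₂ = r f (`isSolutionAt_of_system`, `system_of_isSolutionAt`).

Geometrically, u₂ is the area of (e₁, t) divided by that of (e₁, e₂). The areas of e₁ against the
two members of a parallel frame are, up to sign and order, the homogeneous coordinates of the line L
in that frame. So ratios of independent solutions are exactly the positions of L in parallel frames
(`IsAdaptedFrame.exists_position_eq`, `IsAdaptedFrame.exists_solutions`).

The first two claims follow from this. The position of L is holomorphic even at zeros of c, where q
has a double pole, so the singularities are apparent. Parallel frames differ by constant matrices,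
which act as Möbius maps. A change of coordinate and adapted frame keeps the parallel section and
replaces f by a constant multiple of N f (`isSolutionAt_coordinate_change`). Irreducibility enters
through c, the second fundamental form of L. On a connected surface, c cannot vanish on an open set
unless L is invariant (`IsIrreducible.not_eventually_isTangentAt`). Hence identities proved where c
≠ 0 extend across its zeros, and the position of L is nowhere locally constant.

For monodromy, transporting a parallel frame s to s ρ(γ) continues the position of L to its image
under ρ(γ)⁻¹. Continuation is unique, and a nonconstant germ has trivial stabiliser in PSL₂
(`psl_eq_one_of_eventually_smul_eq`), so any other monodromy representation is conjugate. The
representation ρ exists because parallel frames of area one have locally constant SL₂ transition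
matrices, and such a cocycle defines a covering space (`exists_monodromy_of_cocycle`). -/

noncomputable section

/-! ### Holomorphic functions on a Riemann surface, read in charts. -/

section HolomorphicFunctions

variable {X : Type*} [TopologicalSpace X] [ChartedSpace ℂ X]
  {F : Type*} [NormedAddCommGroup F] [NormedSpace ℂ F]

theorem HolAt.continuousAt {f : X → F} {x : X} (hf : HolAt f x) : ContinuousAt f x :=
  ContMDiffAt.continuousAt hf

theorem HolAt.mdifferentiableAt {f : X → F} {x : X} (hf : HolAt f x) :
    MDifferentiableAt 𝓘(ℂ) 𝓘(ℂ, F) f x :=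
  ContMDiffAt.mdifferentiableAt hf (by simp)

theorem HolAt.add {f g : X → F} {x : X} (hf : HolAt f x) (hg : HolAt g x) :
    HolAt (fun y => f y + g y) x :=
  ContMDiffAt.add hf hg

theorem HolAt.neg {f : X → F} {x : X} (hf : HolAt f x) : HolAt (fun y => -f y) x :=
  ContMDiffAt.neg hf

theorem HolAt.smul {f : X → ℂ} {g : X → F} {x : X} (hf : HolAt f x) (hg : HolAt g x) :
    HolAt (fun y => f y • g y) x :=
  ContMDiffAt.smul hf hg

theorem HolAt.mul {f g : X → ℂ} {x : X} (hf : HolAt f x) (hg : HolAt g x) :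
    HolAt (fun y => f y * g y) x :=
  HolAt.smul hf hg

theorem HolAt.const (c : F) (x : X) : HolAt (fun _ => c) x :=
  contMDiffAt_const

theorem HolAt.comp_analyticAt {G : Type*} [NormedAddCommGroup G] [NormedSpace ℂ G]
    [CompleteSpace G] {f : X → F} {g : F → G} {x : X} (hg : AnalyticAt ℂ g (f x)) (hf : HolAt f x) :
    HolAt (fun y => g (f y)) x :=
  ContMDiffAt.comp x (hg.contDiffAt (n := ω)).contMDiffAt hf

theorem HolAt.inv {f : X → ℂ} {x : X} (hf : HolAt f x) (h : f x ≠ 0) :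
    HolAt (fun y => (f y)⁻¹) x :=
  HolAt.comp_analyticAt (g := fun z => z⁻¹) (analyticAt_inv h) hf

theorem HolAt.div {f g : X → ℂ} {x : X} (hf : HolAt f x) (hg : HolAt g x) (h : g x ≠ 0) :
    HolAt (fun y => f y / g y) x := by
  simpa only [div_eq_mul_inv] using hf.mul (hg.inv h)

theorem HolAt.pi {f : X → Fin 2 → ℂ} {x : X} (hf : ∀ i, HolAt (fun y => f y i) x) :
    HolAt f x :=
  contMDiffAt_pi_space.2 hf

theorem HolAt.apply {f : X → Fin 2 → ℂ} {x : X} (hf : HolAt f x) (i : Fin 2) :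
    HolAt (fun y => f y i) x :=
  contMDiffAt_pi_space.1 hf i

theorem HolAt.eventually [IsManifold 𝓘(ℂ) ω X] {f : X → F} {x : X} (hf : HolAt f x) :
    ∀ᶠ y in 𝓝 x, HolAt f y :=
  (contMDiffAt_iff_contMDiffAt_nhds (by simp)).1 hf

variable {φ : OpenPartialHomeomorph X ℂ}

theorem HolAt.comp_chart (hφ : φ ∈ IsManifold.maximalAtlas 𝓘(ℂ) ω X) {x : X}
    (hx : x ∈ φ.source) [CompleteSpace F] {g : ℂ → F} (hg : AnalyticAt ℂ g (φ x)) :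
    HolAt (fun y => g (φ y)) x :=
  HolAt.comp_analyticAt hg (contMDiffAt_of_mem_maximalAtlas hφ hx)

theorem HolAt.chart (hφ : φ ∈ IsManifold.maximalAtlas 𝓘(ℂ) ω X) {x : X}
    (hx : x ∈ φ.source) : HolAt φ x :=
  contMDiffAt_of_mem_maximalAtlas hφ hx

theorem HolAt.analyticAt (hφ : φ ∈ IsManifold.maximalAtlas 𝓘(ℂ) ω X) {x : X}
    (hx : x ∈ φ.source) {f : X → F} (hf : HolAt f x) :
    AnalyticAt ℂ (fun z => f (φ.symm z)) (φ x) := by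
  have h1 : ContMDiffAt 𝓘(ℂ) 𝓘(ℂ) ω φ.symm (φ x) :=
    contMDiffAt_symm_of_mem_maximalAtlas hφ (φ.map_source hx)
  have h2 : ContMDiffAt 𝓘(ℂ) 𝓘(ℂ, F) ω f (φ.symm (φ x)) := by
    rw [φ.left_inv hx]; exact hf
  exact (ContMDiffAt.comp (φ x) h2 h1).contDiffAt.analyticAt

theorem eventually_chart_left_inv {X : Type*} [TopologicalSpace X] {φ : OpenPartialHomeomorph X ℂ}
    {x : X} (hx : x ∈ φ.source) :
    ∀ᶠ y in 𝓝 x, φ.symm (φ y) = y := by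
  filter_upwards [φ.open_source.mem_nhds hx] with y hy using φ.left_inv hy

theorem mvfderiv_comp_chart (hφ : φ ∈ IsManifold.maximalAtlas 𝓘(ℂ) ω X) {x : X}
    (hx : x ∈ φ.source) {g : ℂ → ℂ} (hg : AnalyticAt ℂ g (φ x)) (v : TangentSpace 𝓘(ℂ) x) :
    mvfderiv 𝓘(ℂ) (fun y => g (φ y)) x v = deriv g (φ x) * mvfderiv 𝓘(ℂ) φ x v := by
  have h := mvfderiv_comp_apply (I := 𝓘(ℂ)) (I' := 𝓘(ℂ)) (f := φ) (g := g) x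
    hg.differentiableAt.mdifferentiableAt (HolAt.chart hφ hx).mdifferentiableAt v
  have e : (fun y => g (φ y)) = g ∘ φ := rfl
  rw [e, h]
  have : ∀ w : ℂ, mvfderiv 𝓘(ℂ) g (φ x) w = deriv g (φ x) * w := by
    intro w
    simp only [mvfderiv, mfderiv_eq_fderiv]
    have := (fderiv ℂ g (φ x)).map_smul w 1
    simp only [smul_eq_mul, mul_one, fderiv_apply_one_eq_deriv] at this
    rw [mul_comm]
    exact this
  exact this _

theorem mvfderiv_congr {f g : X → ℂ} {x : X} (h : f =ᶠ[𝓝 x] g) (v : TangentSpace 𝓘(ℂ) x) :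
    mvfderiv 𝓘(ℂ) f x v = mvfderiv 𝓘(ℂ) g x v := by
  have := h.mfderiv_eq (I := 𝓘(ℂ)) (I' := 𝓘(ℂ))
  have e := congrArg (fun L => L v) this
  exact e

theorem mvfderiv_eq_deriv_mul (hφ : φ ∈ IsManifold.maximalAtlas 𝓘(ℂ) ω X) {x : X}
    (hx : x ∈ φ.source) {f : X → ℂ} (hf : HolAt f x) (v : TangentSpace 𝓘(ℂ) x) :
    mvfderiv 𝓘(ℂ) f x v = deriv (fun z => f (φ.symm z)) (φ x) * mvfderiv 𝓘(ℂ) φ x v := by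
  rw [← mvfderiv_comp_chart hφ hx (hf.analyticAt hφ hx)]
  apply mvfderiv_congr
  filter_upwards [eventually_chart_left_inv hx] with y hy
  rw [hy]

/-- A tangent vector dual to dz. Evaluating on it turns identities between one-forms into scalar
identities in the coordinate. -/
theorem exists_mvfderiv_chart_eq_one (hφ : φ ∈ IsManifold.maximalAtlas 𝓘(ℂ) ω X) {x : X}
    (hx : x ∈ φ.source) : ∃ v : TangentSpace 𝓘(ℂ) x, mvfderiv 𝓘(ℂ) φ x v = 1 := by
  have h1 : ContMDiffAt 𝓘(ℂ) 𝓘(ℂ) ω φ.symm (φ x) :=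
    contMDiffAt_symm_of_mem_maximalAtlas hφ (φ.map_source hx)
  have h := mvfderiv_comp_apply_of_eq (I := 𝓘(ℂ)) (I' := 𝓘(ℂ)) (f := φ.symm) (g := φ) (y := x)
    (φ x) (HolAt.chart hφ hx).mdifferentiableAt (h1.mdifferentiableAt (by simp)) (φ.left_inv hx)
    (1 : ℂ)
  have h2 : mvfderiv 𝓘(ℂ) (φ ∘ φ.symm) (φ x) (1 : ℂ) = 1 := by
    refine (mvfderiv_congr (g := fun z : ℂ => z) ?_ (1 : ℂ)).trans ?_
    · filter_upwards [φ.open_target.mem_nhds (φ.map_source hx)] with z hz using φ.right_inv hz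
    · have : fderiv ℂ (fun z : ℂ => z) (φ x) (1 : ℂ) = 1 := by simp
      simp only [mvfderiv, mfderiv_eq_fderiv]
      exact this
  exact ⟨_, h.symm.trans h2⟩

theorem eventually_of_eventually_symm {X : Type*} [TopologicalSpace X]
    {φ : OpenPartialHomeomorph X ℂ} {x : X} (hx : x ∈ φ.source) {P : X → Prop}
    (h : ∀ᶠ z in 𝓝 (φ x), P (φ.symm z)) : ∀ᶠ y in 𝓝 x, P y := by
  filter_upwards [(φ.continuousAt hx).eventually h, eventually_chart_left_inv hx] with y hy hy'
  rwa [hy'] at hy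

theorem eventually_symm_of_eventually {X : Type*} [TopologicalSpace X]
    {φ : OpenPartialHomeomorph X ℂ} {x : X} (hx : x ∈ φ.source) {P : X → Prop}
    (h : ∀ᶠ y in 𝓝 x, P y) : ∀ᶠ z in 𝓝 (φ x), P (φ.symm z) := by
  have := φ.symm.continuousAt (φ.map_source hx)
  rw [ContinuousAt, φ.left_inv hx] at this
  exact this.eventually h

variable [IsManifold 𝓘(ℂ) ω X]

/-- Every point has arbitrarily small neighbourhoods in which the identity theorem holds. -/
theorem exists_open_identity_theorem {x : X} {P : X → Prop} (hP : ∀ᶠ y in 𝓝 x, P y) :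
    ∃ U : Set X, IsOpen U ∧ x ∈ U ∧ (∀ y ∈ U, P y) ∧ ∀ h : X → ℂ, (∀ y ∈ U, HolAt h y) →
      ∀ y₀ ∈ U, (∀ᶠ y in 𝓝 y₀, h y = 0) → ∀ y ∈ U, h y = 0 := by
  set φ := chartAt ℂ x
  have hx : x ∈ φ.source := mem_chart_source ℂ x
  have hφ : φ ∈ IsManifold.maximalAtlas 𝓘(ℂ) ω X := IsManifold.chart_mem_maximalAtlas x
  obtain ⟨r, hr, hball⟩ := Metric.eventually_nhds_iff_ball.1
    ((eventually_symm_of_eventually hx hP).and (φ.open_target.mem_nhds (φ.map_source hx)))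
  have key : ∀ y ∈ φ.source ∩ φ ⁻¹' Metric.ball (φ x) r, φ.symm (φ y) = y :=
    fun y hy => φ.left_inv hy.1
  refine ⟨φ.source ∩ φ ⁻¹' Metric.ball (φ x) r, φ.isOpen_inter_preimage Metric.isOpen_ball,
    ⟨hx, Metric.mem_ball_self hr⟩, fun y hy => ?_, fun h hh y₀ hy₀ h0 y hy => ?_⟩
  · have := (hball _ hy.2).1
    rwa [key y hy] at this
  -- The neighbourhood is the preimage of a coordinate ball, which is preconnected, so the
  -- one-variable identity theorem applies to h in the coordinate.
  · have han : AnalyticOnNhd ℂ (fun z => h (φ.symm z)) (Metric.ball (φ x) r) := by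
      intro z hz
      have hzt := (hball z hz).2
      have := (hh (φ.symm z) ⟨φ.map_target hzt, by simpa [φ.right_inv hzt] using hz⟩).analyticAt hφ
        (φ.map_target hzt)
      rwa [φ.right_inv hzt] at this
    have := han.eqOn_zero_of_preconnected_of_eventuallyEq_zero
      (convex_ball (φ x) r).isPreconnected hy₀.2 (eventually_symm_of_eventually hy₀.1 h0) hy.2
    simpa [key y hy] using this

theorem HolAt.eventually_eq_of_mvfderiv_eq_zero {f : X → ℂ} {x : X}
    (h : ∀ᶠ y in 𝓝 x, HolAt f y ∧ ∀ v, mvfderiv 𝓘(ℂ) f y v = 0) : ∀ᶠ y in 𝓝 x, f y = f x := by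
  set φ := chartAt ℂ x
  have hx : x ∈ φ.source := mem_chart_source ℂ x
  have hφ : φ ∈ IsManifold.maximalAtlas 𝓘(ℂ) ω X := IsManifold.chart_mem_maximalAtlas x
  obtain ⟨r, hr, hball⟩ := Metric.eventually_nhds_iff_ball.1
    ((eventually_symm_of_eventually hx h).and (φ.open_target.mem_nhds (φ.map_source hx)))
  have han : ∀ z ∈ Metric.ball (φ x) r, AnalyticAt ℂ (fun z => f (φ.symm z)) z ∧
      deriv (fun z => f (φ.symm z)) z = 0 := by
    intro z hz
    obtain ⟨⟨h1, h2⟩, hzt⟩ := hball z hz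
    have h3 := h1.analyticAt hφ (φ.map_target hzt)
    obtain ⟨v, hv⟩ := exists_mvfderiv_chart_eq_one hφ (φ.map_target hzt)
    have h4 := mvfderiv_eq_deriv_mul hφ (φ.map_target hzt) h1 v
    rw [h2 v, hv, mul_one] at h4
    rw [φ.right_inv hzt] at h3 h4
    exact ⟨h3, h4.symm⟩
  refine eventually_of_eventually_symm hx ?_
  filter_upwards [Metric.ball_mem_nhds (φ x) hr] with z hz
  have := Metric.isOpen_ball.is_const_of_deriv_eq_zero (convex_ball (φ x) r).isPreconnected
    (fun z hz => (han z hz).1.differentiableAt.differentiableWithinAt)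
    (fun z hz => (han z hz).2) hz (Metric.mem_ball_self hr)
  simpa [φ.left_inv hx] using this

end HolomorphicFunctions

/-! ### Area forms on a plane. -/

section AreaForm

variable {W : Type*} [AddCommGroup W] [Module ℂ W] (vol : W [⋀^Fin 2]→ₗ[ℂ] ℂ)

theorem area_self (a : W) : vol ![a, a] = 0 :=
  vol.map_eq_zero_of_eq _ (i := 0) (j := 1) rfl (by decide)

theorem area_add_left (a b c : W) : vol ![a + b, c] = vol ![a, c] + vol ![b, c] :=
  vol.map_vecCons_add _ _ _

theorem area_smul_left (r : ℂ) (a c : W) : vol ![r • a, c] = r * vol ![a, c] :=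
  vol.map_vecCons_smul _ _ _

theorem area_swap (a b : W) : vol ![a, b] = -vol ![b, a] := by
  have h := area_self vol (a + b)
  have h' : ∀ c d e : W, vol ![c, d + e] = vol ![c, d] + vol ![c, e] := by
    intro c d e
    have u : ∀ w, Function.update ![c, 0] 1 w = ![c, w] := fun w => by
      ext i; fin_cases i <;> simp
    have := vol.map_update_add ![c, 0] 1 d e
    rwa [u, u, u] at this
  rw [area_add_left, h', h', area_self, area_self] at h
  linear_combination h

theorem area_add_right (a b c : W) : vol ![a, b + c] = vol ![a, b] + vol ![a, c] := by
  rw [area_swap, area_add_left, area_swap vol b, area_swap vol c]; ring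

theorem area_smul_right (r : ℂ) (a c : W) : vol ![a, r • c] = r * vol ![a, c] := by
  rw [area_swap, area_smul_left, area_swap vol c]; ring

variable {vol}

theorem linearIndependent_of_area_ne_zero {a b : W} (h : vol ![a, b] ≠ 0) :
    LinearIndependent ℂ ![a, b] := by
  by_contra hl
  exact h (vol.map_linearDependent _ hl)

theorem area_ne_zero (hW : Module.finrank ℂ W = 2) (hvol : vol ≠ 0) {a b : W}
    (h : LinearIndependent ℂ ![a, b]) : vol ![a, b] ≠ 0 := by
  intro h0
  have hc : Fintype.card (Fin 2) = Module.finrank ℂ W := by simp [hW]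
  let B := basisOfLinearIndependentOfCardEqFinrank h hc
  apply hvol
  refine B.ext_alternating ?_
  intro v hv
  have h1 : ∀ i, B i = ![a, b] i := fun i => by simp [B]
  have h01 := hv.ne (show (0 : Fin 2) ≠ 1 by decide)
  have h2 : (fun i => B (v i)) = ![![a, b] (v 0), ![a, b] (v 1)] := by
    ext i; fin_cases i <;> simp [h1]
  rw [h2]
  generalize v 0 = i at *
  generalize v 1 = j at *
  have h0' : vol ![b, a] = 0 := by rw [area_swap, h0, neg_zero]
  fin_cases i <;> fin_cases j <;> simp_all

/-- Cramer's rule: pairing with `b` and with `a` isolates the two coefficients. Coefficients of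
holomorphic sections thus become quotients of holomorphic areas. -/
theorem eq_area_combination (hW : Module.finrank ℂ W = 2) {a b : W} (h : vol ![a, b] ≠ 0)
    (s : W) : s = (vol ![s, b] / vol ![a, b]) • a + (vol ![a, s] / vol ![a, b]) • b := by
  have hl := linearIndependent_of_area_ne_zero h
  have hc : Fintype.card (Fin 2) = Module.finrank ℂ W := by simp [hW]
  have : FiniteDimensional ℂ W := Module.finite_of_finrank_pos (by omega)
  have hspan := hl.span_eq_top_of_card_eq_finrank' hc
  have hs : s ∈ Submodule.span ℂ (Set.range ![a, b]) := by rw [hspan]; trivial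
  rw [Matrix.range_cons, Matrix.range_cons, Matrix.range_empty, Set.union_empty,
    Set.singleton_union, Submodule.mem_span_pair] at hs
  obtain ⟨x, y, rfl⟩ := hs
  rw [area_add_left, area_smul_left, area_smul_left, area_self, area_add_right, area_smul_right,
    area_smul_right, area_self]
  simp [h]

end AreaForm

/-! ### Holomorphic linear differential equations by power series. -/

section LinearODE

variable {𝔸 : Type*} [NormedRing 𝔸] [NormedAlgebra ℂ 𝔸]

/-- The Taylor coefficients of the solution `U` of `U' = A U`, `U 0 = 1`, in terms of those
of `A`. -/
def odeCoeff (A : ℕ → 𝔸) : ℕ → 𝔸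
  | 0 => 1
  | n + 1 => ((n : ℂ) + 1)⁻¹ • ∑ k : Fin (n + 1), A (n - k) * odeCoeff A k

theorem succ_smul_odeCoeff_succ (A : ℕ → 𝔸) (n : ℕ) :
    ((n : ℂ) + 1) • odeCoeff A (n + 1) =
      ∑ k ∈ Finset.range (n + 1), A (n - k) * odeCoeff A k := by
  rw [odeCoeff, smul_smul, mul_inv_cancel₀ (Nat.cast_add_one_ne_zero n), one_smul,
    Finset.sum_range]

/-- The bound `K * K ^ n` is shaped for the induction: each of the n + 1 terms of the recursion is
at most K^(n+1), and their number cancels the factor 1/(n+1). -/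
theorem norm_odeCoeff_le [NormOneClass 𝔸] {A : ℕ → 𝔸} {K : ℝ}
    (hA : ∀ n, ‖A n‖ ≤ K * K ^ n) (n : ℕ) : ‖odeCoeff A n‖ ≤ K ^ n := by
  have hK : 0 ≤ K := by simpa using (norm_nonneg _).trans (hA 0)
  induction n using Nat.strong_induction_on with
  | _ n ih =>
    cases n with
    | zero => simp [odeCoeff]
    | succ n =>
      have hn : (0 : ℝ) < (n : ℝ) + 1 := by positivity
      have h1 : ‖((n : ℂ) + 1)‖ = (n : ℝ) + 1 := by
        rw [← Nat.cast_add_one, Complex.norm_natCast]; push_cast; rfl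
      have h2 := congrArg norm (succ_smul_odeCoeff_succ A n)
      rw [norm_smul, h1] at h2
      have h3 : ‖∑ k ∈ Finset.range (n + 1), A (n - k) * odeCoeff A k‖ ≤
          ∑ k ∈ Finset.range (n + 1), K ^ (n + 1) := by
        refine norm_sum_le_of_le _ fun k hk => ?_
        have hk' : k < n + 1 := Finset.mem_range.1 hk
        calc ‖A (n - k) * odeCoeff A k‖ ≤ ‖A (n - k)‖ * ‖odeCoeff A k‖ := norm_mul_le _ _
          _ ≤ (K * K ^ (n - k)) * K ^ k := by
              gcongr
              · exact hA _
              · exact ih k hk'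
          _ = K ^ (n + 1) := by
              rw [mul_assoc, ← pow_add, Nat.sub_add_cancel (by omega), pow_succ']
      rw [Finset.sum_const, Finset.card_range, nsmul_eq_mul, ← h2] at h3
      push_cast at h3
      exact le_of_mul_le_mul_left h3 hn

theorem norm_pow_smul_le_of_geometric {u : ℕ → 𝔸} {K C : ℝ} (hK : 0 < K)
    (hu : ∀ n, ‖u n‖ ≤ C * K ^ n) {z : ℂ} (hz : ‖z‖ ≤ (2 * K)⁻¹) (n : ℕ) :
    ‖z ^ n • u n‖ ≤ C * (1 / 2) ^ n := by
  calc ‖z ^ n • u n‖ = ‖z‖ ^ n * ‖u n‖ := by rw [norm_smul, norm_pow]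
    _ ≤ (2 * K)⁻¹ ^ n * (C * K ^ n) := by gcongr; exact hu n
    _ = C * ((2 * K)⁻¹ * K) ^ n := by rw [mul_pow]; ring
    _ = C * (1 / 2) ^ n := by congr 2; field_simp

theorem summable_norm_pow_smul_of_geometric {u : ℕ → 𝔸} {K C : ℝ} (hK : 0 < K)
    (hu : ∀ n, ‖u n‖ ≤ C * K ^ n) {z : ℂ} (hz : ‖z‖ ≤ (2 * K)⁻¹) :
    Summable fun n : ℕ => ‖z ^ n • u n‖ :=
  Summable.of_nonneg_of_le (fun _ => norm_nonneg _)
    (norm_pow_smul_le_of_geometric hK hu hz)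
    ((summable_geometric_of_lt_one (by norm_num) (by norm_num)).mul_left C)

/-- On the disc of radius 1/(2K) all series are dominated by geometric ones of ratio 1/2. The series
may therefore be differentiated termwise, and the recursion identifies the derivative with a Cauchy
product. -/
theorem hasDerivAt_tsum_odeCoeff [NormOneClass 𝔸] [CompleteSpace 𝔸] {A : ℕ → 𝔸} {K : ℝ}
    (hK : 0 < K) (hA : ∀ n, ‖A n‖ ≤ K * K ^ n) {w : ℂ} (hw : ‖w‖ < (2 * K)⁻¹) :
    HasDerivAt (fun z : ℂ => ∑' n : ℕ, z ^ n • odeCoeff A n)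
      ((∑' n : ℕ, w ^ n • A n) * ∑' n : ℕ, w ^ n • odeCoeff A n) w := by
  have hu := norm_odeCoeff_le hA
  have hu' : ∀ n, ‖odeCoeff A n‖ ≤ 1 * K ^ n := by simpa using hu
  have hρ : 0 < (2 * K)⁻¹ := by positivity
  have hbound : ∀ n : ℕ, ∀ y ∈ Metric.ball (0 : ℂ) (2 * K)⁻¹,
      ‖((n : ℂ) * y ^ (n - 1)) • odeCoeff A n‖ ≤ 2 * K * ((n : ℝ) * (1 / 2) ^ n) := by
    intro n y hy
    have hy' : ‖y‖ ≤ (2 * K)⁻¹ := (mem_ball_zero_iff.1 hy).le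
    cases n with
    | zero => simp
    | succ n =>
      rw [norm_smul, norm_mul, norm_pow, Complex.norm_natCast, Nat.add_sub_cancel]
      calc ((n + 1 : ℕ) : ℝ) * ‖y‖ ^ n * ‖odeCoeff A (n + 1)‖
          ≤ ((n + 1 : ℕ) : ℝ) * (2 * K)⁻¹ ^ n * K ^ (n + 1) := by gcongr; exact hu _
        _ = ((n + 1 : ℕ) : ℝ) * ((2 * K)⁻¹ * K) ^ n * K := by rw [mul_pow]; ring
        _ = ((n + 1 : ℕ) : ℝ) * (1 / 2) ^ n * K := by congr 3; field_simp
        _ = 2 * K * (((n + 1 : ℕ) : ℝ) * (1 / 2) ^ (n + 1)) := by ring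
  have hsum : Summable fun n : ℕ => 2 * K * ((n : ℝ) * (1 / 2) ^ n) := by
    have := summable_pow_mul_geometric_of_norm_lt_one 1 (r := (1 / 2 : ℝ)) (by norm_num)
    simpa using this.mul_left (2 * K)
  have hw' : w ∈ Metric.ball (0 : ℂ) (2 * K)⁻¹ := mem_ball_zero_iff.2 hw
  have h1 := hasDerivAt_tsum_of_isPreconnected hsum Metric.isOpen_ball
    (convex_ball (0 : ℂ) (2 * K)⁻¹).isPreconnected
    (g := fun (n : ℕ) (z : ℂ) => z ^ n • odeCoeff A n)
    (fun n y _ => (hasDerivAt_pow n y).smul_const (odeCoeff A n)) hbound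
    (Metric.mem_ball_self hρ)
    (summable_norm_pow_smul_of_geometric hK hu' (by simpa using hK.le)).of_norm hw'
  refine HasDerivAt.congr_deriv h1 (Eq.symm ?_)
  have hsd : Summable fun n : ℕ => ((n : ℂ) * w ^ (n - 1)) • odeCoeff A n :=
    Summable.of_norm_bounded hsum fun n => hbound n w hw'
  rw [hsd.tsum_eq_zero_add, tsum_mul_tsum_eq_tsum_sum_range_of_summable_norm
    (summable_norm_pow_smul_of_geometric hK hA hw.le)
    (summable_norm_pow_smul_of_geometric hK hu' hw.le)]
  simp only [Nat.cast_zero, zero_mul, zero_smul, zero_add, Nat.add_sub_cancel]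
  congr 1
  ext n
  push_cast
  -- The recursion runs over A (n − k) · U k while the Cauchy product runs over A k · U (n − k).
  -- Reflecting the index matches them without commuting the factors.
  rw [mul_comm, mul_smul, succ_smul_odeCoeff_succ, Finset.smul_sum, ← Finset.sum_range_reflect]
  refine Finset.sum_congr rfl fun k hk => ?_
  have hk' : k < n + 1 := Finset.mem_range.1 hk
  have e1 : n + 1 - 1 - k = n - k := by omega
  have e2 : n - (n - k) = k := by omega
  rw [e1, e2, smul_mul_smul_comm, ← pow_add, Nat.sub_add_cancel (by omega)]

/-- A holomorphic linear differential equation `U' = A U` has a holomorphic local solution with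
initial value `1`. -/
theorem exists_fundamental_solution [NormOneClass 𝔸] [CompleteSpace 𝔸] {A : ℂ → 𝔸} {z₀ : ℂ}
    (hA : AnalyticAt ℂ A z₀) :
    ∃ U : ℂ → 𝔸, AnalyticAt ℂ U z₀ ∧ U z₀ = 1 ∧ ∀ᶠ z in 𝓝 z₀, HasDerivAt U (A z * U z) z := by
  obtain ⟨p, hp⟩ := hA
  obtain ⟨r, hr0, hr⟩ := ENNReal.lt_iff_exists_nnreal_btwn.1 hp.radius_pos
  obtain ⟨C, hC, hpC⟩ := p.norm_mul_pow_le_of_lt_radius hr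
  have hr0 : (0 : ℝ) < r := by exact_mod_cast hr0
  obtain ⟨K, hK, hcoeff⟩ : ∃ K : ℝ, 0 < K ∧ ∀ n, ‖p.coeff n‖ ≤ K * K ^ n := by
    -- The Cauchy estimate C r⁻ⁿ is absorbed into K · Kⁿ by letting K dominate both C and r⁻¹.
    refine ⟨max C (r : ℝ)⁻¹, lt_max_of_lt_left hC, fun n => ?_⟩
    have h1 : ‖p.coeff n‖ * (r : ℝ) ^ n ≤ C := by
      rw [← FormalMultilinearSeries.norm_apply_eq_norm_coef]; exact hpC n
    calc ‖p.coeff n‖ ≤ C * ((r : ℝ)⁻¹) ^ n := by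
          rw [inv_pow, ← div_eq_mul_inv, le_div_iff₀ (by positivity)]; exact h1
      _ ≤ _ := by
          gcongr
          · exact le_max_left _ _
          · exact le_max_right _ _
  have hderiv : ∀ᶠ z in 𝓝 z₀, HasDerivAt (fun z : ℂ => ∑' n : ℕ, (z - z₀) ^ n • odeCoeff p.coeff n)
      (A z * ∑' n : ℕ, (z - z₀) ^ n • odeCoeff p.coeff n) z := by
    filter_upwards [hasFPowerSeriesAt_iff'.1 hp,
      Metric.ball_mem_nhds z₀ (show 0 < (2 * K)⁻¹ by positivity)] with z hz hzρ
    rw [mem_ball_iff_norm] at hzρ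
    rw [← hz.tsum_eq]
    exact (hasDerivAt_tsum_odeCoeff hK hcoeff hzρ).comp_sub_const z z₀
  refine ⟨_, ?_, ?_, hderiv⟩
  · rw [Complex.analyticAt_iff_eventually_differentiableAt]
    exact hderiv.mono fun z hz => hz.differentiableAt
  · rw [tsum_eq_single 0]
    · simp [odeCoeff]
    · intro n hn; simp [hn]

theorem exists_solution_pair {a b c d : ℂ → ℂ} {z₀ : ℂ} (ha : AnalyticAt ℂ a z₀)
    (hb : AnalyticAt ℂ b z₀) (hc : AnalyticAt ℂ c z₀) (hd : AnalyticAt ℂ d z₀) (p q : ℂ) :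
    ∃ u v : ℂ → ℂ, AnalyticAt ℂ u z₀ ∧ AnalyticAt ℂ v z₀ ∧ u z₀ = p ∧ v z₀ = q ∧
      ∀ᶠ z in 𝓝 z₀, deriv u z = a z * u z + b z * v z ∧ deriv v z = c z * u z + d z * v z := by
  -- The matrix units of the endomorphism algebra of ℂ × ℂ. The system becomes U' = A U in this
  -- Banach algebra, and the fundamental solution is applied to the initial vector.
  let e : Fin 2 → Fin 2 → (ℂ × ℂ) →L[ℂ] (ℂ × ℂ) := ![![
    (ContinuousLinearMap.inl ℂ ℂ ℂ).comp (ContinuousLinearMap.fst ℂ ℂ ℂ),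
    (ContinuousLinearMap.inl ℂ ℂ ℂ).comp (ContinuousLinearMap.snd ℂ ℂ ℂ)], ![
    (ContinuousLinearMap.inr ℂ ℂ ℂ).comp (ContinuousLinearMap.fst ℂ ℂ ℂ),
    (ContinuousLinearMap.inr ℂ ℂ ℂ).comp (ContinuousLinearMap.snd ℂ ℂ ℂ)]]
  obtain ⟨U, hU, hU0, hU'⟩ := exists_fundamental_solution
    (A := fun z => a z • e 0 0 + b z • e 0 1 + c z • e 1 0 + d z • e 1 1) (z₀ := z₀) (by fun_prop)
  have hd1 : ∀ᶠ z in 𝓝 z₀, HasDerivAt (fun z => U z (p, q))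
      ((a z • e 0 0 + b z • e 0 1 + c z • e 1 0 + d z • e 1 1) (U z (p, q))) z := by
    filter_upwards [hU'] with z hz
    simpa using hz.clm_apply (hasDerivAt_const z (p, q))
  have han : AnalyticAt ℂ (fun z => U z (p, q)) z₀ :=
    (ContinuousLinearMap.apply ℂ (ℂ × ℂ) (p, q)).analyticAt _ |>.fun_comp hU
  refine ⟨fun z => (U z (p, q)).1, fun z => (U z (p, q)).2, ?_, ?_, ?_, ?_, ?_⟩
  · exact (ContinuousLinearMap.fst ℂ ℂ ℂ).analyticAt _ |>.fun_comp han
  · exact (ContinuousLinearMap.snd ℂ ℂ ℂ).analyticAt _ |>.fun_comp han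
  · simp [hU0]
  · simp [hU0]
  · filter_upwards [hd1] with z hz
    have h1 := (hasFDerivAt_fst.comp_hasDerivAt z hz).deriv
    have h2 := (hasFDerivAt_snd.comp_hasDerivAt z hz).deriv
    exact ⟨by simpa [e, Function.comp_def] using h1, by simpa [e, Function.comp_def] using h2⟩

end LinearODE

/-! ### Square roots, and the poles of the potential. -/

section LocalFunctions

/-- Dividing by `f z₀` moves the value at z₀ to 1, where the principal branch of the power is
analytic. A constant root of `f z₀` is then put back. -/
theorem AnalyticAt.exists_sqrt {f : ℂ → ℂ} {z₀ : ℂ} (hf : AnalyticAt ℂ f z₀) (h0 : f z₀ ≠ 0) :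
    ∃ r : ℂ → ℂ, AnalyticAt ℂ r z₀ ∧ r z₀ ≠ 0 ∧ ∀ᶠ z in 𝓝 z₀, r z ^ 2 = f z := by
  have h1 : AnalyticAt ℂ (fun z => f z / f z₀) z₀ := hf.div analyticAt_const h0
  have h2 : f z₀ / f z₀ = 1 := div_self h0
  refine ⟨fun z => f z₀ ^ (1 / 2 : ℂ) * (f z / f z₀) ^ (1 / 2 : ℂ), ?_, ?_, .of_forall fun z => ?_⟩
  · exact analyticAt_const.mul (h1.cpow analyticAt_const (by simp [h2]))
  · simp [Complex.cpow_eq_zero_iff, h0]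
  · have h3 : ∀ w : ℂ, (w ^ (1 / 2 : ℂ)) ^ 2 = w := fun w => by
      rw [one_div]; exact_mod_cast Complex.cpow_nat_inv_pow w two_ne_zero
    simp only [mul_pow, h3]
    field_simp

theorem AnalyticAt.potential {lam : ℂ} {a b c : ℂ → ℂ} {z : ℂ} (ha : AnalyticAt ℂ a z)
    (hb : AnalyticAt ℂ b z) (hc : AnalyticAt ℂ c z) (h0 : c z ≠ 0) :
    AnalyticAt ℂ (gFun lam a c) z ∧ AnalyticAt ℂ (potential lam a b c) z := by
  have hg : AnalyticAt ℂ (gFun lam a c) z := ha.sub (analyticAt_const.mul (hc.deriv.div hc h0))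
  exact ⟨hg, (((hb.mul hc).add (hg.pow 2)).add (analyticAt_const.mul hg.deriv)).neg⟩

theorem MeromorphicAt.potential {lam : ℂ} {a b c : ℂ → ℂ} {z : ℂ} (ha : AnalyticAt ℂ a z)
    (hb : AnalyticAt ℂ b z) (hc : AnalyticAt ℂ c z) :
    MeromorphicAt (potential lam a b c) z := by
  have hg : MeromorphicAt (gFun lam a c) z :=
    ha.meromorphicAt.sub ((MeromorphicAt.const _ z).mul
      (hc.deriv.meromorphicAt.div hc.meromorphicAt))
  exact (((hb.meromorphicAt.mul hc.meromorphicAt).add (hg.pow 2)).add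
    ((MeromorphicAt.const _ z).mul hg.deriv)).neg

/-- The potential has a double pole at every zero of `c`. -/
theorem ne_zero_of_analyticAt_potential {lam : ℂ} (hlam : lam ≠ 0) {a b c : ℂ → ℂ} {z₀ : ℂ}
    (ha : AnalyticAt ℂ a z₀) (hb : AnalyticAt ℂ b z₀) (hc : AnalyticAt ℂ c z₀)
    (hc0 : ¬ ∀ᶠ z in 𝓝 z₀, c z = 0) (hq : AnalyticAt ℂ (potential lam a b c) z₀) :
    c z₀ ≠ 0 := by
  intro hz
  obtain ⟨n, u, hu, hu0, hcu⟩ := (hc.exists_eventuallyEq_pow_smul_nonzero_iff).2 hc0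
  have hn : n ≠ 0 := by
    rintro rfl
    have := hcu.self_of_nhds
    simp [hz] at this
    exact hu0 this.symm
  set h : ℂ → ℂ := fun z => a z - lam / 2 * (deriv u z / u z)
  have hh : AnalyticAt ℂ h z₀ := ha.sub (analyticAt_const.mul (hu.deriv.div hu hu0))
  -- With c = (z − z₀)ⁿ u, the logarithmic derivative c'/c is n/(z − z₀) + u'/u, so g is the
  -- analytic h plus a simple pole of residue −λn/2.
  have hg : ∀ᶠ z in 𝓝[≠] z₀, gFun lam a c z = h z - lam * n / 2 * (z - z₀)⁻¹ := by
    filter_upwards [eventually_nhdsWithin_of_eventually_nhds hcu.eventually_nhds,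
      eventually_nhdsWithin_of_eventually_nhds (hu.continuousAt.eventually_ne hu0),
      eventually_nhdsWithin_of_eventually_nhds hu.eventually_analyticAt,
      self_mem_nhdsWithin] with z h1 h2 h3 h4
    have h4 : z - z₀ ≠ 0 := sub_ne_zero.2 h4
    have e1 : deriv c z = (n * (z - z₀) ^ (n - 1)) * u z + (z - z₀) ^ n * deriv u z := by
      rw [EventuallyEq.deriv_eq h1]
      have := (((hasDerivAt_id z).sub_const z₀).pow n).mul h3.differentiableAt.hasDerivAt
      refine (Eq.trans ?_ this.deriv).trans ?_
      · congr 1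
      · simp
    obtain ⟨m, rfl⟩ := Nat.exists_eq_succ_of_ne_zero hn
    simp only [gFun, h, e1, h1.self_of_nhds, smul_eq_mul, Nat.succ_eq_add_one, Nat.add_sub_cancel]
    field_simp
    ring
  have hq' : ∀ᶠ z in 𝓝[≠] z₀, (z - z₀) ^ 2 * (potential lam a b c z + b z * c z) =
      -(((z - z₀) * h z - lam * n / 2) ^ 2 + lam * ((z - z₀) ^ 2 * deriv h z + lam * n / 2)) := by
    filter_upwards [eventually_nhdsNE_eventually_nhds_iff.2 hg, self_mem_nhdsWithin,
      eventually_nhdsWithin_of_eventually_nhds hh.eventually_analyticAt] with z h1 h2 h3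
    have h2 : z - z₀ ≠ 0 := sub_ne_zero.2 h2
    have e1 : deriv (gFun lam a c) z = deriv h z + lam * n / 2 * ((z - z₀) ^ 2)⁻¹ := by
      rw [EventuallyEq.deriv_eq h1]
      have := h3.differentiableAt.hasDerivAt.fun_sub
        ((((hasDerivAt_id z).sub_const z₀).fun_inv h2).const_mul (lam * n / 2))
      refine this.deriv.trans ?_
      simp
      ring
    rw [potential, e1, h1.self_of_nhds]
    field_simp
    ring
  have hcont1 : Tendsto (fun z => (z - z₀) ^ 2 * (potential lam a b c z + b z * c z)) (𝓝[≠] z₀)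
      (𝓝 ((z₀ - z₀) ^ 2 * (potential lam a b c z₀ + b z₀ * c z₀))) := by
    have : AnalyticAt ℂ (fun z => (z - z₀) ^ 2 * (potential lam a b c z + b z * c z)) z₀ := by
      fun_prop
    exact this.continuousAt.tendsto.mono_left nhdsWithin_le_nhds
  have hcont2 : Tendsto (fun z => -(((z - z₀) * h z - lam * n / 2) ^ 2 +
      lam * ((z - z₀) ^ 2 * deriv h z + lam * n / 2))) (𝓝[≠] z₀)
      (𝓝 (-(((z₀ - z₀) * h z₀ - lam * n / 2) ^ 2 +
      lam * ((z₀ - z₀) ^ 2 * deriv h z₀ + lam * n / 2)))) := by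
    have hh' := hh.deriv
    have : AnalyticAt ℂ (fun z => -(((z - z₀) * h z - lam * n / 2) ^ 2 +
      lam * ((z - z₀) ^ 2 * deriv h z + lam * n / 2))) z₀ := by
      fun_prop
    exact this.continuousAt.tendsto.mono_left nhdsWithin_le_nhds
  have := tendsto_nhds_unique (hcont1.congr' hq') hcont2
  simp only [sub_self] at this
  -- Were q analytic, the left side would tend to 0, while the right side tends to −λ²n(n+2)/4, the
  -- coefficient of the double pole.
  have h5 : lam ^ 2 * (n * (n + 2)) = 0 := by linear_combination (4 : ℂ) * this
  have h6 : (n : ℂ) * (n + 2) ≠ 0 := by exact_mod_cast mul_ne_zero hn (by omega)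
  exact mul_ne_zero (pow_ne_zero 2 hlam) h6 h5

end LocalFunctions

/-! ### Holomorphic sections of the bundle. -/

section Sections

variable {X : Type*} [TopologicalSpace X] [ChartedSpace ℂ X]
  {E : X → Type*} [∀ x, AddCommGroup (E x)] [∀ x, Module ℂ (E x)]
  [∀ x, TopologicalSpace (E x)] [TopologicalSpace (TotalSpace (Fin 2 → ℂ) E)]
  [FiberBundle (Fin 2 → ℂ) E]

theorem HolSectionAt.congr {s t : Π x, E x} {x : X} (hs : HolSectionAt s x)
    (h : ∀ᶠ y in 𝓝 x, t y = s y) : HolSectionAt t x :=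
  ContMDiffAt.congr_of_eventuallyEq hs (h.mono fun y hy => by simp only [hy])

variable [VectorBundle ℂ (Fin 2 → ℂ) E]

variable (E) in
theorem finrank_fiber (x : X) : Module.finrank ℂ (E x) = 2 := by
  have e := (trivializationAt (Fin 2 → ℂ) E x).linearEquivAt (R := ℂ) x
    (FiberBundle.mem_baseSet_trivializationAt' x)
  rw [e.finrank_eq]; simp

variable [ContMDiffVectorBundle ω (Fin 2 → ℂ) E 𝓘(ℂ)]

theorem HolSectionAt.add {s t : Π x, E x} {x : X} (hs : HolSectionAt s x)
    (ht : HolSectionAt t x) : HolSectionAt (fun y => s y + t y) x :=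
  ContMDiffAt.add_section hs ht

theorem HolSectionAt.smul {f : X → ℂ} {s : Π x, E x} {x : X} (hf : HolAt f x)
    (hs : HolSectionAt s x) : HolSectionAt (fun y => f y • s y) x :=
  ContMDiffAt.smul_section hf hs

theorem HolSectionAt.combination {f g : X → ℂ} {s t : Π x, E x} {x : X} (hf : HolAt f x)
    (hg : HolAt g x) (hs : HolSectionAt s x) (ht : HolSectionAt t x) :
    HolSectionAt (fun y => f y • s y + g y • t y) x :=
  (hs.smul hf).add (ht.smul hg)

variable (E) in
theorem exists_holSection_frame (x : X) : ∃ b₁ b₂ : Π y, E y,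
    HolSectionAt b₁ x ∧ HolSectionAt b₂ x ∧ LinearIndependent ℂ ![b₁ x, b₂ x] := by
  let e := trivializationAt (Fin 2 → ℂ) E x
  have hx : x ∈ e.baseSet := FiberBundle.mem_baseSet_trivializationAt' x
  let b := Pi.basisFun ℂ (Fin 2)
  refine ⟨e.localFrame b 0, e.localFrame b 1,
    contMDiffAt_localFrame_of_mem (n := ω) (I := 𝓘(ℂ)) e b 0 hx,
    contMDiffAt_localFrame_of_mem (n := ω) (I := 𝓘(ℂ)) e b 1 hx, ?_⟩
  have := (e.isLocalFrameOn_localFrame_baseSet 𝓘(ℂ) ω b).linearIndependent hx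
  have hvec : (fun i => e.localFrame b i x) = ![e.localFrame b 0 x, e.localFrame b 1 x] := by
    ext i; fin_cases i <;> rfl
  rwa [hvec] at this

variable [IsManifold 𝓘(ℂ) ω X]

theorem HolSectionAt.eventually {s : Π x, E x} {x : X} (hs : HolSectionAt s x) :
    ∀ᶠ y in 𝓝 x, HolSectionAt s y := by
  have : IsManifold (𝓘(ℂ).prod 𝓘(ℂ, Fin 2 → ℂ)) ω (TotalSpace (Fin 2 → ℂ) E) :=
    Bundle.TotalSpace.isManifold _ _
  exact (contMDiffAt_iff_contMDiffAt_nhds (by simp)).1 hs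

end Sections

/-! ### Parallel sections and adapted frames. -/

namespace SLTwoLambdaConnection

variable {X : Type*} [TopologicalSpace X] [ChartedSpace ℂ X]
  {E : X → Type*} [∀ x, AddCommGroup (E x)] [∀ x, Module ℂ (E x)]
  [∀ x, TopologicalSpace (E x)] [TopologicalSpace (TotalSpace (Fin 2 → ℂ) E)]
  [FiberBundle (Fin 2 → ℂ) E] {lam : ℂ} (C : SLTwoLambdaConnection E lam)

section Parallel

/-- The section `s` is holomorphic and parallel near `x`. -/
def IsParallelAt (s : Π x, E x) (x : X) : Prop :=
  ∀ᶠ y in 𝓝 x, HolSectionAt s y ∧ C.nabla s y = 0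

variable {C}

theorem IsParallelAt.holSectionAt {s : Π x, E x} {x : X} (hs : C.IsParallelAt s x) :
    HolSectionAt s x := hs.self_of_nhds.1

theorem IsParallelAt.eventually {s : Π x, E x} {x : X} (hs : C.IsParallelAt s x) :
    ∀ᶠ y in 𝓝 x, C.IsParallelAt s y := hs.eventually_nhds

theorem IsParallelAt.congr {s t : Π x, E x} {x : X} (hs : C.IsParallelAt s x)
    (h : ∀ᶠ y in 𝓝 x, t y = s y) : C.IsParallelAt t x := by
  filter_upwards [hs, h.eventually_nhds] with y hy h
  refine ⟨hy.1.congr h, ?_⟩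
  rw [← C.nabla_congr s t y hy.1 (h.mono fun _ => Eq.symm), hy.2]

theorem IsParallelFrameAt.isParallelAt {s : Fin 2 → Π x, E x} {x : X}
    (hs : C.IsParallelFrameAt s x) (i : Fin 2) : C.IsParallelAt (s i) x :=
  hs.mono fun _ h => h.2 i

theorem IsParallelFrameAt.eventually {s : Fin 2 → Π x, E x} {x : X}
    (hs : C.IsParallelFrameAt s x) : ∀ᶠ y in 𝓝 x, C.IsParallelFrameAt s y := hs.eventually_nhds

variable [IsManifold 𝓘(ℂ) ω X]

/-- The connection induces λd on the determinant, so the area of two parallel sections has zero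
derivative once λ ≠ 0. -/
theorem IsParallelAt.eventually_area_eq (hlam : lam ≠ 0) {s t : Π x, E x} {x : X}
    (hs : C.IsParallelAt s x) (ht : C.IsParallelAt t x) :
    ∀ᶠ y in 𝓝 x, C.vol y ![s y, t y] = C.vol x ![s x, t x] := by
  refine HolAt.eventually_eq_of_mvfderiv_eq_zero (f := fun y => C.vol y ![s y, t y]) ?_
  filter_upwards [hs, ht] with y hs ht
  refine ⟨C.vol_hol s t y hs.1 ht.1, fun v => ?_⟩
  have := C.nabla_vol s t y hs.1 ht.1 v
  rw [hs.2, ht.2, area_swap _ (s y)] at this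
  have h0 : ∀ w : E y, C.vol y ![0, w] = 0 := fun w => by
    simpa using area_smul_left (C.vol y) 0 0 w
  simp only [LinearMap.zero_apply, h0, neg_zero, add_zero, mul_eq_zero, hlam, false_or] at this
  exact this

variable [VectorBundle ℂ (Fin 2 → ℂ) E] [ContMDiffVectorBundle ω (Fin 2 → ℂ) E 𝓘(ℂ)]

theorem nabla_combination {f g : X → ℂ} {s t : Π x, E x} {x : X} (hf : HolAt f x)
    (hg : HolAt g x) (hs : HolSectionAt s x) (ht : HolSectionAt t x) (v : TangentSpace 𝓘(ℂ) x) :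
    C.nabla (fun y => f y • s y + g y • t y) x v =
      (lam * mvfderiv 𝓘(ℂ) f x v) • s x + f x • C.nabla s x v +
      ((lam * mvfderiv 𝓘(ℂ) g x v) • t x + g x • C.nabla t x v) := by
  rw [C.nabla_add _ _ _ (hs.smul hf) (ht.smul hg), LinearMap.add_apply,
    C.nabla_leibniz f s x hf hs, C.nabla_leibniz g t x hg ht]

theorem IsParallelAt.combination {s t : Π x, E x} {x : X} (hs : C.IsParallelAt s x)
    (ht : C.IsParallelAt t x) (p q : ℂ) : C.IsParallelAt (fun y => p • s y + q • t y) x := by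
  filter_upwards [hs, ht] with y hs ht
  refine ⟨.combination (.const p y) (.const q y) hs.1 ht.1, ?_⟩
  refine LinearMap.ext fun v => ?_
  rw [nabla_combination (.const p y) (.const q y) hs.1 ht.1, hs.2, ht.2, mvfderiv_const,
    mvfderiv_const]
  simp

theorem isParallelFrameAt_of_isParallelAt {s : Fin 2 → Π x, E x} {x : X}
    (h0 : C.IsParallelAt (s 0) x) (h1 : C.IsParallelAt (s 1) x)
    (h : C.vol x ![s 0 x, s 1 x] ≠ 0) : C.IsParallelFrameAt s x := by
  have hc := (C.vol_hol _ _ x h0.holSectionAt h1.holSectionAt).continuousAt.eventually_ne h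
  filter_upwards [h0, h1, hc] with y h0 h1 hc
  refine ⟨?_, fun i => ?_⟩
  · convert linearIndependent_of_area_ne_zero hc using 1
    ext i; fin_cases i <;> rfl
  · fin_cases i
    exacts [h0, h1]

theorem IsParallelFrameAt.area_ne_zero {s : Fin 2 → Π x, E x} {x : X}
    (hs : C.IsParallelFrameAt s x) : C.vol x ![s 0 x, s 1 x] ≠ 0 := by
  refine _root_.area_ne_zero (finrank_fiber E x) (C.vol_ne_zero x) ?_
  convert hs.self_of_nhds.1 using 1
  ext i; fin_cases i <;> rfl

end Parallel

section Frames

/-- The local frame `(e₁, e₂)` is adapted to `L`, and the connection is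
`lam ∂_z + !![a, b; c, -a]` with respect to it and to the coordinate given by the chart `φ`. -/
structure IsAdaptedFrame (L : LineSubbundle E) (φ : OpenPartialHomeomorph X ℂ) (a b c : ℂ → ℂ)
    (e₁ e₂ : Π x, E x) : Prop where
  chart_mem : φ ∈ IsManifold.maximalAtlas 𝓘(ℂ) ω X
  analytic_a : AnalyticOnNhd ℂ a φ.target
  analytic_b : AnalyticOnNhd ℂ b φ.target
  analytic_c : AnalyticOnNhd ℂ c φ.target
  frame : ∀ x ∈ φ.source,
    HolSectionAt e₁ x ∧ HolSectionAt e₂ x ∧ LinearIndependent ℂ ![e₁ x, e₂ x] ∧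
    L.fiber x = ℂ ∙ e₁ x ∧
    ∀ v : TangentSpace 𝓘(ℂ) x,
      C.nabla e₁ x v = mvfderiv 𝓘(ℂ) φ x v • (a (φ x) • e₁ x + c (φ x) • e₂ x) ∧
      C.nabla e₂ x v = mvfderiv 𝓘(ℂ) φ x v • (b (φ x) • e₁ x - a (φ x) • e₂ x)

variable {C} {L : LineSubbundle E} {φ : OpenPartialHomeomorph X ℂ} {a b c : ℂ → ℂ}
  {e₁ e₂ : Π x, E x}

theorem mem_inducedOper {d : OpenPartialHomeomorph X ℂ × (ℂ → ℂ)} :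
    d ∈ C.inducedOper L ↔ ∃ a b c e₁ e₂, C.IsAdaptedFrame L d.1 a b c e₁ e₂ ∧
      d.2 = potential lam a b c := by
  constructor
  · rintro ⟨h1, a, b, c, ⟨ha, hb, hc, e₁, e₂, he⟩, hq⟩
    exact ⟨a, b, c, e₁, e₂, ⟨h1, ha, hb, hc, he⟩, hq⟩
  · rintro ⟨a, b, c, e₁, e₂, ⟨h1, ha, hb, hc, he⟩, hq⟩
    exact ⟨h1, a, b, c, ⟨ha, hb, hc, e₁, e₂, he⟩, hq⟩

namespace IsAdaptedFrame

theorem hol₁ (h : C.IsAdaptedFrame L φ a b c e₁ e₂) {x : X} (hx : x ∈ φ.source) :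
    HolSectionAt e₁ x := (h.frame x hx).1

theorem hol₂ (h : C.IsAdaptedFrame L φ a b c e₁ e₂) {x : X} (hx : x ∈ φ.source) :
    HolSectionAt e₂ x := (h.frame x hx).2.1

theorem fiber_eq (h : C.IsAdaptedFrame L φ a b c e₁ e₂) {x : X} (hx : x ∈ φ.source) :
    L.fiber x = ℂ ∙ e₁ x := (h.frame x hx).2.2.2.1

theorem hol_c (h : C.IsAdaptedFrame L φ a b c e₁ e₂) {x : X} (hx : x ∈ φ.source) :
    HolAt (fun y => c (φ y)) x :=
  .comp_chart h.chart_mem hx (h.analytic_c _ (φ.map_source hx))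

variable [IsManifold 𝓘(ℂ) ω X] [VectorBundle ℂ (Fin 2 → ℂ) E]

theorem area_ne_zero (h : C.IsAdaptedFrame L φ a b c e₁ e₂) {x : X} (hx : x ∈ φ.source) :
    C.vol x ![e₁ x, e₂ x] ≠ 0 :=
  _root_.area_ne_zero (finrank_fiber E x) (C.vol_ne_zero x) (h.frame x hx).2.2.1

/-- The connection matrix has trace zero, so the induced λd kills the area of the frame. -/
theorem eventually_area_eq (h : C.IsAdaptedFrame L φ a b c e₁ e₂) (hlam : lam ≠ 0) {x : X}
    (hx : x ∈ φ.source) : ∀ᶠ y in 𝓝 x, C.vol y ![e₁ y, e₂ y] = C.vol x ![e₁ x, e₂ x] := by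
  refine HolAt.eventually_eq_of_mvfderiv_eq_zero (f := fun y => C.vol y ![e₁ y, e₂ y]) ?_
  filter_upwards [φ.open_source.mem_nhds hx] with y hy
  refine ⟨C.vol_hol _ _ y (h.hol₁ hy) (h.hol₂ hy), fun v => ?_⟩
  have := C.nabla_vol _ _ y (h.hol₁ hy) (h.hol₂ hy) v
  obtain ⟨-, -, -, -, h5⟩ := h.frame y hy
  rw [(h5 v).1, (h5 v).2, sub_eq_add_neg, ← neg_smul, area_smul_left, area_smul_right,
    area_add_left, area_add_right, area_smul_left, area_smul_left, area_smul_right,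
    area_smul_right, area_self, area_self] at this
  have h0 : lam * mvfderiv 𝓘(ℂ) (fun y => C.vol y ![e₁ y, e₂ y]) y v = 0 := by
    rw [this]; ring
  exact (mul_eq_zero.1 h0).resolve_left hlam

theorem eq_combination (h : C.IsAdaptedFrame L φ a b c e₁ e₂) {x : X} (hx : x ∈ φ.source)
    (s : E x) : s = (C.vol x ![s, e₂ x] / C.vol x ![e₁ x, e₂ x]) • e₁ x +
      (C.vol x ![e₁ x, s] / C.vol x ![e₁ x, e₂ x]) • e₂ x :=
  eq_area_combination (finrank_fiber E x) (h.area_ne_zero hx) s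

theorem hol_coeff₁ (h : C.IsAdaptedFrame L φ a b c e₁ e₂) {x : X} (hx : x ∈ φ.source)
    {s : Π x, E x} (hs : HolSectionAt s x) :
    HolAt (fun y => C.vol y ![s y, e₂ y] / C.vol y ![e₁ y, e₂ y]) x :=
  (C.vol_hol _ _ x hs (h.hol₂ hx)).div (C.vol_hol _ _ x (h.hol₁ hx) (h.hol₂ hx))
    (h.area_ne_zero hx)

theorem hol_coeff₂ (h : C.IsAdaptedFrame L φ a b c e₁ e₂) {x : X} (hx : x ∈ φ.source)
    {s : Π x, E x} (hs : HolSectionAt s x) :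
    HolAt (fun y => C.vol y ![e₁ y, s y] / C.vol y ![e₁ y, e₂ y]) x :=
  (C.vol_hol _ _ x (h.hol₁ hx) hs).div (C.vol_hol _ _ x (h.hol₁ hx) (h.hol₂ hx))
    (h.area_ne_zero hx)

variable [ContMDiffVectorBundle ω (Fin 2 → ℂ) E 𝓘(ℂ)]

theorem nabla_eq (h : C.IsAdaptedFrame L φ a b c e₁ e₂) {x : X} (hx : x ∈ φ.source)
    {f g : X → ℂ} (hf : HolAt f x) (hg : HolAt g x) (v : TangentSpace 𝓘(ℂ) x) :
    C.nabla (fun y => f y • e₁ y + g y • e₂ y) x v =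
      (mvfderiv 𝓘(ℂ) φ x v * (lam * deriv (fun z => f (φ.symm z)) (φ x) + a (φ x) * f x
        + b (φ x) * g x)) • e₁ x +
      (mvfderiv 𝓘(ℂ) φ x v * (lam * deriv (fun z => g (φ.symm z)) (φ x) + c (φ x) * f x
        - a (φ x) * g x)) • e₂ x := by
  rw [nabla_combination hf hg (h.hol₁ hx) (h.hol₂ hx), mvfderiv_eq_deriv_mul h.chart_mem hx hf,
    mvfderiv_eq_deriv_mul h.chart_mem hx hg]
  obtain ⟨-, -, -, -, h5⟩ := h.frame x hx
  rw [(h5 v).1, (h5 v).2]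
  module

/-- This translates parallelism into the linear system for the coefficients. One tangent vector dual
to dz suffices to read off both equations. -/
theorem nabla_eq_zero_iff (h : C.IsAdaptedFrame L φ a b c e₁ e₂) {x : X} (hx : x ∈ φ.source)
    {f g : X → ℂ} (hf : HolAt f x) (hg : HolAt g x) :
    C.nabla (fun y => f y • e₁ y + g y • e₂ y) x = 0 ↔
      lam * deriv (fun z => f (φ.symm z)) (φ x) + a (φ x) * f x + b (φ x) * g x = 0 ∧
      lam * deriv (fun z => g (φ.symm z)) (φ x) + c (φ x) * f x - a (φ x) * g x = 0 := by
  constructor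
  · intro h0
    obtain ⟨v, hv⟩ := exists_mvfderiv_chart_eq_one h.chart_mem hx
    have h1 := h.nabla_eq hx hf hg v
    rw [h0, hv, one_mul, one_mul, LinearMap.zero_apply] at h1
    exact LinearIndependent.pair_iff.1 (h.frame x hx).2.2.1 _ _ h1.symm
  · rintro ⟨h1, h2⟩
    refine LinearMap.ext fun v => ?_
    rw [h.nabla_eq hx hf hg v, h1, h2]
    simp

end IsAdaptedFrame

end Frames

end SLTwoLambdaConnection

/-! ### Existence of adapted and parallel frames. -/

namespace SLTwoLambdaConnection

variable {X : Type*} [TopologicalSpace X] [ChartedSpace ℂ X] [IsManifold 𝓘(ℂ) ω X]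
  {E : X → Type*} [∀ x, AddCommGroup (E x)] [∀ x, Module ℂ (E x)]
  [∀ x, TopologicalSpace (E x)] [TopologicalSpace (TotalSpace (Fin 2 → ℂ) E)]
  [FiberBundle (Fin 2 → ℂ) E] [VectorBundle ℂ (Fin 2 → ℂ) E]
  [ContMDiffVectorBundle ω (Fin 2 → ℂ) E 𝓘(ℂ)] {lam : ℂ} (C : SLTwoLambdaConnection E lam)

section Existence

/-- A nowhere vanishing section can be completed to a local frame of area one. -/
theorem exists_area_eq_one {e : Π x, E x} {x : X} (he : HolSectionAt e x) (h0 : e x ≠ 0) :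
    ∃ t : Π x, E x, HolSectionAt t x ∧ ∀ᶠ y in 𝓝 x, C.vol y ![e y, t y] = 1 := by
  obtain ⟨b, hb, hbe⟩ : ∃ b : Π x, E x, HolSectionAt b x ∧ C.vol x ![e x, b x] ≠ 0 := by
    -- If `e x` had zero area with both members of a frame, Cramer's rule would give `e x = 0`.
    obtain ⟨b₁, b₂, h1, h2, hl⟩ := exists_holSection_frame E x
    by_contra! hcon
    have hne := area_ne_zero (finrank_fiber E x) (C.vol_ne_zero x) hl
    have := eq_area_combination (finrank_fiber E x) hne (e x)
    rw [hcon b₂ h2, area_swap _ (b₁ x) (e x), hcon b₁ h1] at this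
    simp at this
    exact h0 this
  have hA := C.vol_hol e b x he hb
  refine ⟨fun y => (C.vol y ![e y, b y])⁻¹ • b y, hb.smul (hA.inv hbe), ?_⟩
  filter_upwards [hA.continuousAt.eventually_ne hbe] with y hy
  rw [area_smul_right, inv_mul_cancel₀ hy]

/-- A generator of L is completed to a frame of area one, and the connection coefficients are read
off by Cramer's rule. Constant area is what forces the matrix to be traceless. The extra predicate
`P` lets the chart domain be shrunk at will. -/
theorem exists_isAdaptedFrame (L : LineSubbundle E) {x : X} {P : X → Prop} (hP : ∀ᶠ y in 𝓝 x, P y) :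
    ∃ φ a b c e₁ e₂, C.IsAdaptedFrame L φ a b c e₁ e₂ ∧ x ∈ φ.source ∧ ∀ y ∈ φ.source, P y := by
  obtain ⟨e, he⟩ := L.exists_generator x
  obtain ⟨t, ht, hA⟩ := C.exists_area_eq_one he.self_of_nhds.1 he.self_of_nhds.2.1
  let ψ := chartAt ℂ x
  have hx : x ∈ ψ.source := mem_chart_source ℂ x
  have hψ : ψ ∈ IsManifold.maximalAtlas 𝓘(ℂ) ω X := IsManifold.chart_mem_maximalAtlas x
  obtain ⟨n₁, hn₁, hn₁'⟩ := C.nabla_hol e x he.self_of_nhds.1 ψ hψ hx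
  obtain ⟨n₂, hn₂, hn₂'⟩ := C.nabla_hol t x ht ψ hψ hx
  have hall : ∀ᶠ y in 𝓝 x, P y ∧ (HolSectionAt e y ∧ e y ≠ 0 ∧ L.fiber y = ℂ ∙ e y) ∧
      HolSectionAt t y ∧ (∀ᶠ y' in 𝓝 y, C.vol y' ![e y', t y'] = 1) ∧ HolSectionAt n₁ y ∧
      HolSectionAt n₂ y ∧ (∀ v : TangentSpace 𝓘(ℂ) y, C.nabla e y v = mvfderiv 𝓘(ℂ) ψ y v • n₁ y) ∧
      (∀ v : TangentSpace 𝓘(ℂ) y, C.nabla t y v = mvfderiv 𝓘(ℂ) ψ y v • n₂ y) := by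
    filter_upwards [hP, he, ht.eventually, hA.eventually_nhds, hn₁.eventually, hn₂.eventually,
      hn₁', hn₂'] with y h1 h2 h3 h4 h5 h6 h7 h8 using ⟨h1, h2, h3, h4, h5, h6, h7, h8⟩
  obtain ⟨U, hU, hUo, hxU⟩ := eventually_nhds_iff.1 hall
  let φ := ψ.restr U
  have hφ : φ ∈ IsManifold.maximalAtlas 𝓘(ℂ) ω X := restr_mem_maximalAtlas _ hψ hUo
  have hsource : φ.source = ψ.source ∩ U := ψ.restr_source' U hUo
  have hmem : ∀ y ∈ φ.source, y ∈ U := fun y hy => (hsource ▸ hy).2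
  have han : ∀ f : X → ℂ, (∀ y ∈ U, HolAt f y) →
      AnalyticOnNhd ℂ (fun z => f (φ.symm z)) φ.target := by
    intro f hf z hz
    have := (hf _ (hmem _ (φ.map_target hz))).analyticAt hφ (φ.map_target hz)
    rwa [φ.right_inv hz] at this
  let α : X → ℂ := fun y => C.vol y ![n₁ y, t y]
  let β : X → ℂ := fun y => C.vol y ![n₂ y, t y]
  let γ : X → ℂ := fun y => C.vol y ![e y, n₁ y]
  refine ⟨φ, fun z => α (φ.symm z), fun z => β (φ.symm z), fun z => γ (φ.symm z), e, t,
    ⟨hφ, ?_, ?_, ?_, ?_⟩, ?_, ?_⟩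
  · exact han α fun y hy =>
      C.vol_hol _ _ y (hU y hy).2.2.2.2.1 (hU y hy).2.2.1
  · exact han β fun y hy =>
      C.vol_hol _ _ y (hU y hy).2.2.2.2.2.1 (hU y hy).2.2.1
  · exact han γ fun y hy =>
      C.vol_hol _ _ y (hU y hy).2.1.1 (hU y hy).2.2.2.2.1
  · intro y hy
    obtain ⟨-, ⟨h1, h2, h3⟩, h4, h5, -, -, h6, h7⟩ := hU y (hmem y hy)
    have hy1 : C.vol y ![e y, t y] = 1 := h5.self_of_nhds
    have hne : C.vol y ![e y, t y] ≠ 0 := by rw [hy1]; exact one_ne_zero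
    refine ⟨h1, h4, linearIndependent_of_area_ne_zero hne, h3, fun v => ?_⟩
    rw [congrArg α (φ.left_inv hy), congrArg β (φ.left_inv hy), congrArg γ (φ.left_inv hy)]
    have e1 := eq_area_combination (finrank_fiber E y) hne (n₁ y)
    have e2 := eq_area_combination (finrank_fiber E y) hne (n₂ y)
    rw [hy1, div_one, div_one] at e1 e2
    -- Differentiating the identity area = 1 makes the diagonal entries opposite.
    have htrace : C.vol y ![e y, n₂ y] = -C.vol y ![n₁ y, t y] := by
      obtain ⟨w, hw⟩ := exists_mvfderiv_chart_eq_one hψ (hsource ▸ hy : y ∈ ψ.source ∩ U).1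
      have := C.nabla_vol e t y h1 h4 w
      rw [h6, h7, hw, one_smul, one_smul, mvfderiv_congr h5, mvfderiv_const] at this
      simp at this
      linear_combination -this
    rw [htrace] at e2
    simp only [α, β, γ]
    rw [h6, h7, ← e1, sub_eq_add_neg, ← neg_smul, ← e2]
    exact ⟨rfl, rfl⟩
  · exact hsource ▸ ⟨hx, hxU⟩
  · exact fun y hy => (hU y (hmem y hy)).1

theorem exists_isParallelAt_eq (L : LineSubbundle E) (hlam : lam ≠ 0) (x : X) (w : E x) :
    ∃ s : Π x, E x, C.IsParallelAt s x ∧ s x = w := by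
  obtain ⟨φ, a, b, c, e₁, e₂, h, hx, -⟩ := C.exists_isAdaptedFrame L (x := x) (P := fun _ => True)
    (.of_forall fun _ => trivial)
  have ha := h.analytic_a _ (φ.map_source hx)
  have hb := h.analytic_b _ (φ.map_source hx)
  have hc := h.analytic_c _ (φ.map_source hx)
  -- The system is divided by λ, and the initial values are the coefficients of `w` in the adapted
  -- frame.
  obtain ⟨u, v, hu, hv, hu0, hv0, huv⟩ := exists_solution_pair
    (a := fun z => -(lam⁻¹ * a z)) (b := fun z => -(lam⁻¹ * b z)) (c := fun z => -(lam⁻¹ * c z))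
    (d := fun z => lam⁻¹ * a z) (z₀ := φ x) (by fun_prop) (by fun_prop) (by fun_prop)
    (by fun_prop) (C.vol x ![w, e₂ x] / C.vol x ![e₁ x, e₂ x])
    (C.vol x ![e₁ x, w] / C.vol x ![e₁ x, e₂ x])
  refine ⟨fun y => u (φ y) • e₁ y + v (φ y) • e₂ y, ?_, ?_⟩
  · have h1 : ∀ᶠ z in 𝓝 (φ x), AnalyticAt ℂ u z ∧ AnalyticAt ℂ v z ∧
      deriv u z = -(lam⁻¹ * a z) * u z + -(lam⁻¹ * b z) * v z ∧
      deriv v z = -(lam⁻¹ * c z) * u z + lam⁻¹ * a z * v z :=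
      hu.eventually_analyticAt.and (hv.eventually_analyticAt.and huv)
    filter_upwards [(φ.continuousAt hx).eventually h1, φ.open_source.mem_nhds hx]
      with y ⟨hu, hv, hu', hv'⟩ hy
    have hu1 := HolAt.comp_chart h.chart_mem hy hu
    have hv1 := HolAt.comp_chart h.chart_mem hy hv
    refine ⟨.combination hu1 hv1 (h.hol₁ hy) (h.hol₂ hy), ?_⟩
    rw [h.nabla_eq_zero_iff hy hu1 hv1]
    have hs : ∀ f : ℂ → ℂ, deriv (fun z => f (φ (φ.symm z))) (φ y) = deriv f (φ y) := by
      intro f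
      refine EventuallyEq.deriv_eq ?_
      filter_upwards [φ.open_target.mem_nhds (φ.map_source hy)] with z hz
      rw [φ.right_inv hz]
    rw [hs u, hs v, hu', hv']
    constructor
    · field_simp; ring
    · field_simp; ring
  · simp only [hu0, hv0]
    exact (h.eq_combination hx w).symm

/-- Every point has a parallel frame of area one. -/
theorem exists_isParallelFrameAt (L : LineSubbundle E) (hlam : lam ≠ 0) (x : X) :
    ∃ s : Fin 2 → Π x, E x, C.IsParallelFrameAt s x ∧ C.vol x ![s 0 x, s 1 x] = 1 := by
  obtain ⟨e, he⟩ := L.exists_generator x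
  obtain ⟨t, ht, hA⟩ := C.exists_area_eq_one he.self_of_nhds.1 he.self_of_nhds.2.1
  obtain ⟨s₀, hs₀, h0⟩ := C.exists_isParallelAt_eq L hlam x (e x)
  obtain ⟨s₁, hs₁, h1⟩ := C.exists_isParallelAt_eq L hlam x (t x)
  have h : C.vol x ![s₀ x, s₁ x] = 1 := by rw [h0, h1]; exact hA.self_of_nhds
  refine ⟨![s₀, s₁], isParallelFrameAt_of_isParallelAt hs₀ hs₁ ?_, h⟩
  simp [h]

end Existence

/-! ### The second fundamental form of L and irreducibility. -/

section Irreducible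

variable {C} {L : LineSubbundle E} {φ : OpenPartialHomeomorph X ℂ} {a b c : ℂ → ℂ}
  {e₁ e₂ : Π x, E x}

variable (C L) in
/-- The derivative at `x` of every section of `L` lies in `L`. -/
def IsTangentAt (x : X) : Prop :=
  ∀ s : Π x, E x, HolSectionAt s x → (∀ᶠ y in 𝓝 x, s y ∈ L.fiber y) →
    ∀ v : TangentSpace 𝓘(ℂ) x, C.nabla s x v ∈ L.fiber x

/-- Modulo L the connection is linear over functions on sections of L, and c is its single
coefficient. The left-hand side does not mention a frame, so the zeros of c are intrinsic to L. -/
theorem IsAdaptedFrame.isTangentAt_iff (h : C.IsAdaptedFrame L φ a b c e₁ e₂) {x : X}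
    (hx : x ∈ φ.source) : C.IsTangentAt L x ↔ c (φ x) = 0 := by
  have hmem : ∀ y ∈ φ.source, ∀ w : E y, w ∈ L.fiber y ↔ C.vol y ![e₁ y, w] = 0 := by
    intro y hy w
    rw [h.fiber_eq hy, Submodule.mem_span_singleton]
    constructor
    · rintro ⟨r, rfl⟩
      rw [area_smul_right, area_self, mul_zero]
    · intro h0
      have := h.eq_combination hy w
      rw [h0, zero_div, zero_smul, add_zero] at this
      exact ⟨_, this.symm⟩
  have hA := h.area_ne_zero hx
  constructor
  · intro hT
    obtain ⟨v, hv⟩ := exists_mvfderiv_chart_eq_one h.chart_mem hx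
    have h1 := hT e₁ (h.hol₁ hx) (by
      filter_upwards [φ.open_source.mem_nhds hx] with y hy
      rw [hmem y hy, area_self]) v
    rw [hmem x hx, ((h.frame x hx).2.2.2.2 v).1, hv, one_smul, area_add_right, area_smul_right,
      area_smul_right, area_self, mul_zero, zero_add] at h1
    exact (mul_eq_zero.1 h1).resolve_right hA
  · intro hc s hs hsL v
    have h1 := h.hol_coeff₁ hx hs
    have h2 : ∀ᶠ y in 𝓝 x, s y = (C.vol y ![s y, e₂ y] / C.vol y ![e₁ y, e₂ y]) • e₁ y := by
      filter_upwards [hsL, φ.open_source.mem_nhds hx] with y hy hyφ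
      have := h.eq_combination hyφ (s y)
      rwa [(hmem y hyφ _).1 hy, zero_div, zero_smul, add_zero] at this
    rw [C.nabla_congr s _ x hs h2, C.nabla_leibniz _ _ x h1 (h.hol₁ hx), hmem x hx,
      ((h.frame x hx).2.2.2.2 v).1, hc, zero_smul, add_zero, area_add_right, area_smul_right,
      area_smul_right, area_smul_right, area_smul_right, area_self]
    simp

variable [ConnectedSpace X]

/-- The set of points near which L is tangent is open by definition, and closed by the identity
theorem for c in an adapted frame. By connectedness, if it were nonempty it would be everything, and
L would be invariant. -/
theorem IsIrreducible.not_eventually_isTangentAt (hC : C.IsIrreducible) (L : LineSubbundle E)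
    (x : X) : ¬ ∀ᶠ y in 𝓝 x, C.IsTangentAt L y := by
  intro hx
  let Z : Set X := {x | ∀ᶠ y in 𝓝 x, C.IsTangentAt L y}
  have hopen : IsOpen Z := isOpen_iff_mem_nhds.2 fun y hy => eventually_eventually_nhds.2 hy
  have hclosed : IsClosed Z := by
    refine isClosed_of_closure_subset fun y hy => ?_
    obtain ⟨φ, a, b, c, e₁, e₂, h, hyφ, -⟩ := C.exists_isAdaptedFrame L (x := y)
      (P := fun _ => True) (.of_forall fun _ => trivial)
    obtain ⟨U, hUo, hyU, hU, hid⟩ := exists_open_identity_theorem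
      (φ.open_source.mem_nhds hyφ : ∀ᶠ y' in 𝓝 y, y' ∈ φ.source)
    obtain ⟨y₀, hy₀U, hy₀⟩ := mem_closure_iff_nhds.1 hy U (hUo.mem_nhds hyU)
    have h0 := hid (fun y => c (φ y)) (fun y hy => h.hol_c (hU y hy)) y₀ hy₀U (by
      filter_upwards [hy₀, hUo.mem_nhds hy₀U] with y' h1 h2
      exact (h.isTangentAt_iff (hU y' h2)).1 h1)
    show ∀ᶠ y' in 𝓝 y, C.IsTangentAt L y'
    filter_upwards [hUo.mem_nhds hyU] with y' hy'
    exact (h.isTangentAt_iff (hU y' hy')).2 (h0 y' hy')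
  have huniv := IsClopen.eq_univ ⟨hclosed, hopen⟩ ⟨x, hx⟩
  refine hC L fun s y hs hsL v => ?_
  have : y ∈ Z := huniv ▸ Set.mem_univ y
  exact this.self_of_nhds s hs hsL v

theorem IsAdaptedFrame.frequently_ne_zero (h : C.IsAdaptedFrame L φ a b c e₁ e₂)
    (hC : C.IsIrreducible) {x : X} (hx : x ∈ φ.source) : ∃ᶠ y in 𝓝 x, c (φ y) ≠ 0 := by
  intro h0
  refine hC.not_eventually_isTangentAt L x ?_
  filter_upwards [h0, φ.open_source.mem_nhds hx] with y hy hyφ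
  exact (h.isTangentAt_iff hyφ).2 (not_not.1 hy)

/-- The potential of an adapted frame is analytic exactly away from the zeros of `c`. -/
theorem IsAdaptedFrame.analyticAt_potential_iff (h : C.IsAdaptedFrame L φ a b c e₁ e₂)
    (hlam : lam ≠ 0) (hC : C.IsIrreducible) {x : X} (hx : x ∈ φ.source) :
    AnalyticAt ℂ (potential lam a b c) (φ x) ↔ c (φ x) ≠ 0 := by
  have ha := h.analytic_a _ (φ.map_source hx)
  have hb := h.analytic_b _ (φ.map_source hx)
  have hc := h.analytic_c _ (φ.map_source hx)
  refine ⟨fun hq => ne_zero_of_analyticAt_potential hlam ha hb hc (fun h0 => ?_) hq,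
    fun h0 => (ha.potential hb hc h0).2⟩
  exact h.frequently_ne_zero hC hx
    (((φ.continuousAt hx).eventually h0).mono fun y hy => not_not.2 hy)

end Irreducible

end SLTwoLambdaConnection

/-! ### Between the parallel system and the Schrödinger equation. -/

section Schroedinger

variable {lam : ℂ} {a b c r : ℂ → ℂ} {z₀ : ℂ}

theorem IsSolutionAt.congr {q f g : ℂ → ℂ} (hf : IsSolutionAt lam q f z₀)
    (h : g =ᶠ[𝓝 z₀] f) : IsSolutionAt lam q g z₀ := by
  refine ⟨hf.1.congr h.symm, ?_⟩
  filter_upwards [hf.2, h.eventuallyEq_nhds] with z hz hz'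
  rw [hz'.deriv.deriv_eq, hz'.eq_of_nhds, hz]

theorem IsSolutionAt.const_mul {q f : ℂ → ℂ} (hf : IsSolutionAt lam q f z₀) (k : ℂ) :
    IsSolutionAt lam q (fun z => k * f z) z₀ := by
  refine ⟨analyticAt_const.mul hf.1, ?_⟩
  filter_upwards [hf.2] with z hz
  have h1 : deriv (fun z => k * f z) = fun z => k * deriv f z :=
    funext fun z => deriv_const_mul_field k
  rw [h1, deriv_const_mul_field]
  linear_combination k * hz

/-- Since c = r², half of c'/c is r'/r. Thus g is the coefficient that a acquires when u₂ is divided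
by r. -/
theorem gFun_eq_of_sq_eq (hr : AnalyticAt ℂ r z₀) (hr0 : r z₀ ≠ 0)
    (hrc : ∀ᶠ z in 𝓝 z₀, r z ^ 2 = c z) :
    ∀ᶠ z in 𝓝 z₀, gFun lam a c z = a z - lam * deriv r z / r z := by
  filter_upwards [hr.eventually_analyticAt, hr.continuousAt.eventually_ne hr0,
    hrc.eventually_nhds] with z h1 h2 h3
  have h4 : deriv c z = 2 * r z * deriv r z := by
    rw [← EventuallyEq.deriv_eq h3]
    simpa using (h1.differentiableAt.hasDerivAt.fun_pow 2).deriv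
  rw [gFun, h4, ← h3.self_of_nhds]
  field_simp

theorem analyticAt_gFun (ha : AnalyticAt ℂ a z₀) (hr : AnalyticAt ℂ r z₀) (hr0 : r z₀ ≠ 0)
    (hrc : ∀ᶠ z in 𝓝 z₀, r z ^ 2 = c z) : AnalyticAt ℂ (gFun lam a c) z₀ :=
  (ha.sub ((analyticAt_const.mul hr.deriv).div hr hr0)).congr
    (by filter_upwards [gFun_eq_of_sq_eq (a := a) (lam := lam) hr hr0 hrc] with z hz using hz.symm)

/-- The second coefficient of a parallel section, divided by the square root of `c`, solves the
Schrödinger equation. -/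
theorem isSolutionAt_of_system {u₁ u₂ : ℂ → ℂ} (ha : AnalyticAt ℂ a z₀)
    (hr : AnalyticAt ℂ r z₀) (hr0 : r z₀ ≠ 0)
    (hrc : ∀ᶠ z in 𝓝 z₀, r z ^ 2 = c z) (hu₁ : AnalyticAt ℂ u₁ z₀) (hu₂ : AnalyticAt ℂ u₂ z₀)
    (h₁ : ∀ᶠ z in 𝓝 z₀, lam * deriv u₁ z + a z * u₁ z + b z * u₂ z = 0)
    (h₂ : ∀ᶠ z in 𝓝 z₀, lam * deriv u₂ z + c z * u₁ z - a z * u₂ z = 0) :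
    IsSolutionAt lam (potential lam a b c) (fun z => u₂ z / r z) z₀ ∧
      ∀ᶠ z in 𝓝 z₀, lam * deriv (fun z => u₂ z / r z) z =
        gFun lam a c z * (u₂ z / r z) - r z * u₁ z := by
  have hg := analyticAt_gFun (lam := lam) ha hr hr0 hrc
  have hg' := gFun_eq_of_sq_eq (lam := lam) (a := a) hr hr0 hrc
  have hf := hu₂.fun_div hr hr0
  have hf' : ∀ᶠ z in 𝓝 z₀, lam * deriv (fun z => u₂ z / r z) z =
      gFun lam a c z * (u₂ z / r z) - r z * u₁ z := by
    filter_upwards [hr.eventually_analyticAt, hr.continuousAt.eventually_ne hr0, hrc,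
      hu₂.eventually_analyticAt, h₂, hg'] with z hr hr0 hrc hu₂ h₂ hg'
    rw [(hu₂.differentiableAt.hasDerivAt.fun_div hr.differentiableAt.hasDerivAt hr0).deriv, hg']
    rw [← hrc] at h₂
    field_simp
    linear_combination r z * h₂
  refine ⟨⟨hf, ?_⟩, hf'⟩
  filter_upwards [hr.eventually_analyticAt, hr.continuousAt.eventually_ne hr0, hrc,
      hu₁.eventually_analyticAt, h₁, hg', hf'.eventually_nhds, hg.eventually_analyticAt,
      hf.eventually_analyticAt] with z hr hr0 hrc hu₁ h₁ hg' hf' hg hf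
  set f : ℂ → ℂ := fun z => u₂ z / r z
  have hfz : u₂ z = r z * f z := by simp only [f]; field_simp
  have hd : lam * deriv (deriv f) z = deriv (gFun lam a c) z * f z + gFun lam a c z * deriv f z -
      (deriv r z * u₁ z + r z * deriv u₁ z) := by
    have := EventuallyEq.deriv_eq (f := fun z => gFun lam a c z * f z - r z * u₁ z)
      (f₁ := fun z => lam * deriv f z) hf'
    rw [deriv_const_mul_field] at this
    rw [this]
    exact ((hg.differentiableAt.hasDerivAt.fun_mul hf.differentiableAt.hasDerivAt).fun_sub
      (hr.differentiableAt.hasDerivAt.fun_mul hu₁.differentiableAt.hasDerivAt)).deriv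
  have hf1 := hf'.self_of_nhds
  have hgr : gFun lam a c z * r z = a z * r z - lam * deriv r z := by
    rw [hg']; field_simp
  change lam * deriv f z = gFun lam a c z * f z - r z * u₁ z at hf1
  rw [hfz] at h₁
  rw [potential, ← hrc]
  -- Differentiate λf' = g f − r u₁, then eliminate u₁' by the first equation of the system; the
  -- remaining u₁ terms cancel through g r = a r − λr'.
  linear_combination lam * hd + gFun lam a c z * hf1 - r z * h₁ - u₁ z * hgr

/-- Every solution of the Schrödinger equation comes from a parallel section. -/
theorem system_of_isSolutionAt {f : ℂ → ℂ} (ha : AnalyticAt ℂ a z₀)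
    (hr : AnalyticAt ℂ r z₀) (hr0 : r z₀ ≠ 0) (hrc : ∀ᶠ z in 𝓝 z₀, r z ^ 2 = c z)
    (hf : IsSolutionAt lam (potential lam a b c) f z₀) :
    AnalyticAt ℂ (fun z => (gFun lam a c z * f z - lam * deriv f z) / r z) z₀ ∧
    AnalyticAt ℂ (fun z => r z * f z) z₀ ∧
    ∀ᶠ z in 𝓝 z₀,
      lam * deriv (fun z => (gFun lam a c z * f z - lam * deriv f z) / r z) z +
        a z * ((gFun lam a c z * f z - lam * deriv f z) / r z) + b z * (r z * f z) = 0 ∧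
      lam * deriv (fun z => r z * f z) z +
        c z * ((gFun lam a c z * f z - lam * deriv f z) / r z) - a z * (r z * f z) = 0 := by
  have hg := analyticAt_gFun (lam := lam) ha hr hr0 hrc
  have hg' := gFun_eq_of_sq_eq (lam := lam) (a := a) hr hr0 hrc
  have hv : AnalyticAt ℂ (fun z => gFun lam a c z * f z - lam * deriv f z) z₀ :=
    (hg.mul hf.1).sub (analyticAt_const.mul hf.1.deriv)
  refine ⟨hv.div hr hr0, hr.mul hf.1, ?_⟩
  filter_upwards [hr.eventually_analyticAt, hr.continuousAt.eventually_ne hr0, hrc,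
    hg', hg.eventually_analyticAt, hf.1.eventually_analyticAt, hf.2, hv.eventually_analyticAt]
    with z hr hr0 hrc hg' hg hfa hf2 hv
  have hgr : gFun lam a c z * r z = a z * r z - lam * deriv r z := by
    rw [hg']; field_simp
  constructor
  · have hvd : deriv (fun z => gFun lam a c z * f z - lam * deriv f z) z =
        (deriv (gFun lam a c) z * f z + gFun lam a c z * deriv f z) - lam * deriv (deriv f) z :=
      ((hg.differentiableAt.hasDerivAt.fun_mul hfa.differentiableAt.hasDerivAt).fun_sub
        (hfa.deriv.differentiableAt.hasDerivAt.const_mul lam)).deriv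
    rw [(hv.differentiableAt.hasDerivAt.fun_div hr.differentiableAt.hasDerivAt hr0).deriv, hvd]
    rw [potential, ← hrc] at hf2
    field_simp
    linear_combination (-r z) * hf2 - (gFun lam a c z * f z - lam * deriv f z) * hgr
  · rw [(hr.differentiableAt.hasDerivAt.fun_mul hfa.differentiableAt.hasDerivAt).deriv, ← hrc]
    field_simp
    linear_combination f z * hgr

end Schroedinger

/-! ### Holomorphic maps to the projective line. -/

section ProjectiveLine

variable {X : Type*} [TopologicalSpace X] [ChartedSpace ℂ X]

theorem eq_iff_of_homogeneousCoord {p q : PLine} {u v : Fin 2 → ℂ} (hp : HomogeneousCoord p u)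
    (hq : HomogeneousCoord q v) : p = q ↔ u 0 * v 1 - u 1 * v 0 = 0 := by
  obtain ⟨hu, rfl⟩ := hp
  obtain ⟨hv, rfl⟩ := hq
  rw [Projectivization.mk_eq_mk_iff']
  constructor
  · rintro ⟨r, rfl⟩
    simp only [Pi.smul_apply, smul_eq_mul]; ring
  · intro h
    by_cases h0 : v 0 = 0
    · have h1 : v 1 ≠ 0 := fun h1 => hv (by ext i; fin_cases i <;> simp [h0, h1])
      refine ⟨u 1 / v 1, ?_⟩
      have : u 0 = 0 := by simpa [h0, h1] using h
      ext i; fin_cases i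
      · simp [h0, this]
      · simp [h1]
    · refine ⟨u 0 / v 0, ?_⟩
      ext i; fin_cases i
      · simp [h0]
      · simp; field_simp; linear_combination h

theorem exists_homogeneousCoord (p : PLine) : ∃ u, HomogeneousCoord p u :=
  ⟨p.rep, p.rep_nonzero, p.mk_rep.symm⟩

theorem HomogeneousCoord.ne_zero {p : PLine} {u : Fin 2 → ℂ} (h : HomogeneousCoord p u) : u ≠ 0 :=
  h.1

theorem HomogeneousCoord.of_cross_eq_zero {p : PLine} {u v : Fin 2 → ℂ}
    (h : HomogeneousCoord p u) (hv : v ≠ 0) (h0 : u 0 * v 1 - u 1 * v 0 = 0) :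
    HomogeneousCoord p v :=
  ⟨hv, (eq_iff_of_homogeneousCoord h ⟨hv, rfl⟩).2 h0⟩

theorem HomogeneousCoord.smul {p : PLine} {u : Fin 2 → ℂ} (h : HomogeneousCoord p u)
    (g : SL(2, ℂ)) : HomogeneousCoord (g • p) (g.1.mulVec u) := by
  obtain ⟨hu, rfl⟩ := h
  exact ⟨(smul_ne_zero_iff_ne g).2 hu, Projectivization.smul_mk g hu⟩

theorem PHolAt.congr {w w' : X → PLine} {x : X} (hw : PHolAt w x) (h : w' =ᶠ[𝓝 x] w) :
    PHolAt w' x := by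
  obtain ⟨u, hu, hwu⟩ := hw
  exact ⟨u, hu, by filter_upwards [hwu, h] with y hy hy'; rwa [hy']⟩

theorem HolAt.mulVec {u : X → Fin 2 → ℂ} {x : X} (hu : HolAt u x)
    (m : Matrix (Fin 2) (Fin 2) ℂ) : HolAt (fun y => m.mulVec (u y)) x :=
  .pi fun i => by
    simp only [Matrix.mulVec, dotProduct, Fin.sum_univ_two]
    exact ((HolAt.const _ x).mul (hu.apply 0)).add ((HolAt.const _ x).mul (hu.apply 1))

theorem PHolAt.smul {w : X → PLine} {x : X} (hw : PHolAt w x) (g : SL(2, ℂ)) :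
    PHolAt (fun y => g • w y) x := by
  obtain ⟨u, hu, hwu⟩ := hw
  exact ⟨_, hu.mulVec g.1, hwu.mono fun y hy => hy.smul g⟩

variable [IsManifold 𝓘(ℂ) ω X]

/-- Equality in ℙ¹ is the vanishing of the cross product of homogeneous coordinates, a holomorphic
function. The neighbourhood does not depend on `g`, so `g` may be found at a nearby point chosen
afterwards. -/
theorem exists_open_identity_theorem_smul {w w' : X → PLine} {x : X} (hw : PHolAt w x)
    (hw' : PHolAt w' x) : ∃ U : Set X, IsOpen U ∧ x ∈ U ∧ ∀ g : SL(2, ℂ), ∀ y₀ ∈ U,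
      (∀ᶠ y in 𝓝 y₀, w y = g • w' y) → ∀ y ∈ U, w y = g • w' y := by
  obtain ⟨u, hu, hwu⟩ := hw
  obtain ⟨v, hv, hwv⟩ := hw'
  obtain ⟨U, hUo, hxU, hU, hid⟩ := exists_open_identity_theorem
    (hu.eventually.and (hv.eventually.and (hwu.and hwv)))
  refine ⟨U, hUo, hxU, fun g y₀ hy₀ h y hy => ?_⟩
  have key : ∀ y ∈ U, (w y = g • w' y ↔
      u y 0 * g.1.mulVec (v y) 1 - u y 1 * g.1.mulVec (v y) 0 = 0) := fun y hy =>
    eq_iff_of_homogeneousCoord (hU y hy).2.2.1 ((hU y hy).2.2.2.smul g)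
  rw [key y hy]
  refine hid (fun y => u y 0 * g.1.mulVec (v y) 1 - u y 1 * g.1.mulVec (v y) 0)
    (fun y hy => ?_) y₀ hy₀ ?_ y hy
  · have h1 := (hU y hy).1
    have h2 := (hU y hy).2.1.mulVec g.1
    simpa only [sub_eq_add_neg] using
      ((h1.apply 0).mul (h2.apply 1)).add ((h1.apply 1).mul (h2.apply 0)).neg
  · filter_upwards [h, hUo.mem_nhds hy₀] with y' h' hy'
    exact (key y' hy').1 h'

end ProjectiveLine

/-! ### The position of L in a parallel frame. -/

namespace SLTwoLambdaConnection

variable {X : Type*} [TopologicalSpace X] [ChartedSpace ℂ X] [IsManifold 𝓘(ℂ) ω X]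
  {E : X → Type*} [∀ x, AddCommGroup (E x)] [∀ x, Module ℂ (E x)]
  [∀ x, TopologicalSpace (E x)] [TopologicalSpace (TotalSpace (Fin 2 → ℂ) E)]
  [FiberBundle (Fin 2 → ℂ) E] [VectorBundle ℂ (Fin 2 → ℂ) E]
  [ContMDiffVectorBundle ω (Fin 2 → ℂ) E 𝓘(ℂ)] {lam : ℂ} {C : SLTwoLambdaConnection E lam}
  {L : LineSubbundle E}

section ProjectivisedMap

open scoped Classical in
/-- The point of the projective line that a line `ℓ` in a plane with basis `(a, b)` defines. -/
def linePosition {W : Type*} [AddCommGroup W] [Module ℂ W] (ℓ : Submodule ℂ W) (a b : W) : PLine :=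
  -- The default [1 : 0] does not occur for an independent frame, by `exists_fiber_eq_span`.
  if h : ∃ u : Fin 2 → ℂ, u ≠ 0 ∧ ℓ = ℂ ∙ (u 0 • a + u 1 • b) then
    Projectivization.mk ℂ h.choose h.choose_spec.1 else Projectivization.mk ℂ ![1, 0] (by simp)

/-- The position of the line given by `L` with respect to the frame `(s 0, s 1)`. -/
def _root_.LineSubbundle.position (L : LineSubbundle E) (s : Fin 2 → Π x, E x) (y : X) : PLine :=
  linePosition (L.fiber y) (s 0 y) (s 1 y)

theorem cross_eq_zero_of_span_eq {W : Type*} [AddCommGroup W] [Module ℂ W] {a b : W}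
    (h : LinearIndependent ℂ ![a, b]) {u v : Fin 2 → ℂ}
    (huv : ℂ ∙ (u 0 • a + u 1 • b) = ℂ ∙ (v 0 • a + v 1 • b)) : u 0 * v 1 - u 1 * v 0 = 0 := by
  have hmem : u 0 • a + u 1 • b ∈ ℂ ∙ (v 0 • a + v 1 • b) :=
    huv ▸ Submodule.mem_span_singleton_self _
  obtain ⟨r, hr⟩ := Submodule.mem_span_singleton.1 hmem
  have := LinearIndependent.pair_iff.1 h (r * v 0 - u 0) (r * v 1 - u 1) (by
    rw [show (r * v 0 - u 0) • a + (r * v 1 - u 1) • b =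
      r • (v 0 • a + v 1 • b) - (u 0 • a + u 1 • b) by module, hr, sub_self])
  have h0 := sub_eq_zero.1 this.1
  have h1 := sub_eq_zero.1 this.2
  rw [← h0, ← h1]; ring

theorem homogeneousCoord_position {s : Fin 2 → Π x, E x} {y : X}
    (hs : LinearIndependent ℂ ![s 0 y, s 1 y]) {u : Fin 2 → ℂ} (hu : u ≠ 0)
    (hL : L.fiber y = ℂ ∙ (u 0 • s 0 y + u 1 • s 1 y)) :
    HomogeneousCoord (L.position s y) u := by
  have h : ∃ u : Fin 2 → ℂ, u ≠ 0 ∧ L.fiber y = ℂ ∙ (u 0 • s 0 y + u 1 • s 1 y) := ⟨u, hu, hL⟩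
  rw [LineSubbundle.position, linePosition, dif_pos h]
  exact HomogeneousCoord.of_cross_eq_zero ⟨h.choose_spec.1, rfl⟩ hu
    (cross_eq_zero_of_span_eq hs (h.choose_spec.2.symm.trans hL))

/-- Cramer's rule with the common denominator dropped. These coordinates vary holomorphically when
the frame and the generator do. -/
theorem homogeneousCoord_position_of_area {s : Fin 2 → Π x, E x} {y : X}
    (hs : LinearIndependent ℂ ![s 0 y, s 1 y]) {e : E y} (he : e ≠ 0)
    (hL : L.fiber y = ℂ ∙ e) :
    HomogeneousCoord (L.position s y) ![C.vol y ![e, s 1 y], C.vol y ![s 0 y, e]] := by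
  have hA := area_ne_zero (finrank_fiber E y) (C.vol_ne_zero y) hs
  have h1 := eq_area_combination (finrank_fiber E y) hA e
  have h2 : C.vol y ![s 0 y, s 1 y] • e =
      C.vol y ![e, s 1 y] • s 0 y + C.vol y ![s 0 y, e] • s 1 y := by
    conv_lhs => rw [h1]
    rw [smul_add, smul_smul, smul_smul, mul_div_cancel₀ _ hA, mul_div_cancel₀ _ hA]
  refine homogeneousCoord_position hs (fun h0 => ?_) ?_
  · have h3 : C.vol y ![e, s 1 y] = 0 := congrFun h0 0
    have h4 : C.vol y ![s 0 y, e] = 0 := congrFun h0 1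
    rw [h3, h4] at h1
    simp at h1
    exact he h1
  · rw [hL]
    simp only [Matrix.cons_val_zero, Matrix.cons_val_one]
    rw [← h2]
    exact (Submodule.span_singleton_smul_eq (IsUnit.mk0 _ hA) e).symm

theorem IsParallelFrameAt.linearIndependent {s : Fin 2 → Π x, E x} {y : X}
    (hs : C.IsParallelFrameAt s y) : LinearIndependent ℂ ![s 0 y, s 1 y] :=
  linearIndependent_of_area_ne_zero hs.area_ne_zero

theorem IsParallelFrameAt.pHolAt {s : Fin 2 → Π x, E x} {x : X}
    (hs : C.IsParallelFrameAt s x) : PHolAt (L.position s) x := by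
  obtain ⟨e, he⟩ := L.exists_generator x
  refine ⟨fun y => ![C.vol y ![e y, s 1 y], C.vol y ![s 0 y, e y]], .pi fun i => ?_, ?_⟩
  · fin_cases i
    · exact C.vol_hol _ _ x he.self_of_nhds.1 (hs.isParallelAt 1).holSectionAt
    · exact C.vol_hol _ _ x (hs.isParallelAt 0).holSectionAt he.self_of_nhds.1
  · filter_upwards [he, hs.eventually] with y hy hsy
    exact homogeneousCoord_position_of_area hsy.linearIndependent hy.2.1 hy.2.2

theorem exists_fiber_eq_span {s : Fin 2 → Π x, E x} {y : X}
    (hs : LinearIndependent ℂ ![s 0 y, s 1 y]) (C : SLTwoLambdaConnection E lam)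
    (L : LineSubbundle E) : ∃ u : Fin 2 → ℂ, u ≠ 0 ∧
      L.fiber y = ℂ ∙ (u 0 • s 0 y + u 1 • s 1 y) := by
  obtain ⟨e, he⟩ := L.exists_generator y
  obtain ⟨-, he0, heL⟩ := he.self_of_nhds
  have h := eq_area_combination (finrank_fiber E y)
    (area_ne_zero (finrank_fiber E y) (C.vol_ne_zero y) hs) (e y)
  refine ⟨![_, _], fun h0 => he0 ?_, heL.trans (congrArg (fun w => ℂ ∙ w) h)⟩
  rw [h]
  have h3 := congrFun h0 0
  have h4 := congrFun h0 1
  simp only [Matrix.cons_val_zero, Matrix.cons_val_one, Pi.zero_apply] at h3 h4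
  rw [h3, h4]; simp

/-- The effect of a change of frame on the position of the line. -/
theorem position_eq_smul {s s' : Fin 2 → Π x, E x} {y : X}
    (hs : C.IsParallelFrameAt s y) (hs' : C.IsParallelFrameAt s' y)
    {m : Matrix (Fin 2) (Fin 2) ℂ} {k : ℂ} (g : SL(2, ℂ)) (hm : m = k • g.1)
    (h : ∀ i, s' i y = ∑ j, m j i • s j y) : L.position s y = g • L.position s' y := by
  obtain ⟨u, hu, huL⟩ := exists_fiber_eq_span hs'.linearIndependent C L
  have h1 := (homogeneousCoord_position hs'.linearIndependent hu huL).smul g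
  have hk : k ≠ 0 := by
    rintro rfl
    refine hs'.linearIndependent.ne_zero 0 ?_
    have := h 0
    rw [hm] at this
    simpa using this
  have h2 : HomogeneousCoord (L.position s y) (g.1.mulVec u) := by
    refine homogeneousCoord_position hs.linearIndependent h1.ne_zero ?_
    rw [huL, ← Submodule.span_singleton_smul_eq (IsUnit.mk0 k hk)
      (g.1.mulVec u 0 • s 0 y + g.1.mulVec u 1 • s 1 y)]
    congr 2
    rw [h 0, h 1, hm]
    simp only [Fin.sum_univ_two, Matrix.smul_apply, Matrix.mulVec, dotProduct, smul_eq_mul]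
    module
  exact (eq_iff_of_homogeneousCoord h2 h1).2 (by ring)

/-- Only the class of a matrix up to scalars matters on ℙ¹; dividing by a square root of the
determinant normalises it. -/
theorem exists_sl_smul {m : Matrix (Fin 2) (Fin 2) ℂ} (hm : m.det ≠ 0) :
    ∃ (k : ℂ) (g : SL(2, ℂ)), m = k • g.1 := by
  obtain ⟨k, hk⟩ := IsAlgClosed.exists_pow_nat_eq m.det (n := 2) (by norm_num)
  have hk0 : k ≠ 0 := by rintro rfl; exact hm (by simpa using hk.symm)
  refine ⟨k, ⟨k⁻¹ • m, ?_⟩, ?_⟩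
  · rw [Matrix.det_smul, Fintype.card_fin, ← hk, ← mul_pow, inv_mul_cancel₀ hk0, one_pow]
  · rw [smul_smul, mul_inv_cancel₀ hk0, one_smul]

/-- Two parallel frames differ by a locally constant matrix. -/
theorem IsParallelFrameAt.exists_matrix (hlam : lam ≠ 0) {s s' : Fin 2 → Π x, E x} {x : X}
    (hs : C.IsParallelFrameAt s x) (hs' : C.IsParallelFrameAt s' x) :
    ∃ m : Matrix (Fin 2) (Fin 2) ℂ,
      C.vol x ![s' 0 x, s' 1 x] = m.det * C.vol x ![s 0 x, s 1 x] ∧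
      ∀ᶠ y in 𝓝 x, ∀ i, s' i y = ∑ j, m j i • s j y := by
  set V := C.vol x ![s 0 x, s 1 x]
  -- The entries are the Cramer coefficients at `x`. They serve at nearby points because areas of
  -- parallel sections are locally constant.
  let m : Matrix (Fin 2) (Fin 2) ℂ := Matrix.of fun j i =>
    ![C.vol x ![s' i x, s 1 x] / V, C.vol x ![s 0 x, s' i x] / V] j
  have hrel : ∀ᶠ y in 𝓝 x, ∀ i, s' i y = ∑ j, m j i • s j y := by
    rw [eventually_all]
    intro i
    filter_upwards [hs.eventually,
      (hs.isParallelAt 0).eventually_area_eq hlam (hs.isParallelAt 1),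
      (hs'.isParallelAt i).eventually_area_eq hlam (hs.isParallelAt 1),
      (hs.isParallelAt 0).eventually_area_eq hlam (hs'.isParallelAt i)] with y h1 h2 h3 h4
    have := eq_area_combination (finrank_fiber E y) h1.area_ne_zero (s' i y)
    rw [h2, h3, h4] at this
    rw [Fin.sum_univ_two]
    exact this
  refine ⟨m, ?_, hrel⟩
  have h0 := hrel.self_of_nhds
  rw [h0 0, h0 1]
  simp only [Fin.sum_univ_two, area_add_left, area_add_right, area_smul_left, area_smul_right,
    area_self, Matrix.det_fin_two]
  rw [area_swap _ (s 1 x)]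
  ring

theorem IsParallelFrameAt.exists_smul (hlam : lam ≠ 0) {s s' : Fin 2 → Π x, E x} {x : X}
    (hs : C.IsParallelFrameAt s x) (hs' : C.IsParallelFrameAt s' x) :
    ∃ g : SL(2, ℂ), ∀ᶠ y in 𝓝 x, L.position s' y = g • L.position s y := by
  obtain ⟨m, hm, h⟩ := hs'.exists_matrix hlam hs
  have hdet : m.det ≠ 0 := fun h0 => hs.area_ne_zero (by rw [hm, h0, zero_mul])
  obtain ⟨k, g, hg⟩ := exists_sl_smul hdet
  refine ⟨g, ?_⟩
  filter_upwards [h, hs.eventually, hs'.eventually] with y h hs hs'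
  exact position_eq_smul hs' hs g hg h

/-- If the position of `L` with respect to a parallel frame is constant, then `L` is invariant. -/
theorem IsParallelFrameAt.not_eventually_const [ConnectedSpace X] (hC : C.IsIrreducible)
    {s : Fin 2 → Π x, E x} {x : X} (hs : C.IsParallelFrameAt s x) :
    ¬ ∀ᶠ y in 𝓝 x, L.position s y = L.position s x := by
  intro hconst
  refine hC.not_eventually_isTangentAt L x ?_
  obtain ⟨u, hu, huL⟩ := exists_fiber_eq_span hs.linearIndependent C L
  have hux := homogeneousCoord_position hs.linearIndependent hu huL
  have hpar := (hs.isParallelAt 0).combination (hs.isParallelAt 1) (u 0) (u 1)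
  -- A constant position means that one parallel section `p`, with constant coefficients u,
  -- generates L near `x`.
  have hfib : ∀ᶠ y in 𝓝 x, L.fiber y = ℂ ∙ (u 0 • s 0 y + u 1 • s 1 y) := by
    filter_upwards [hconst, hs.eventually] with y hy hsy
    obtain ⟨v, hv, hvL⟩ := exists_fiber_eq_span hsy.linearIndependent C L
    have hvy := homogeneousCoord_position hsy.linearIndependent hv hvL
    rw [hy] at hvy
    have h0 := (eq_iff_of_homogeneousCoord hux hvy).1 rfl
    have h1 := (Projectivization.mk_eq_mk_iff' ℂ v u hv hu).1
      (((⟨hv, rfl⟩ : HomogeneousCoord (Projectivization.mk ℂ v hv) v).2).symm.trans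
        (hvy.2.symm.trans hux.2))
    obtain ⟨r, hr⟩ := h1
    have hr0 : r ≠ 0 := by rintro rfl; exact hv (by rw [← hr, zero_smul])
    rw [hvL, ← Submodule.span_singleton_smul_eq (IsUnit.mk0 r hr0) (u 0 • s 0 y + u 1 • s 1 y),
      ← hr]
    simp only [Pi.smul_apply, smul_eq_mul, smul_add, smul_smul]
  filter_upwards [hfib.eventually_nhds, hpar.eventually, hs.eventually] with y hy hpary hsy
  intro t ht htL v
  obtain ⟨e, he⟩ := L.exists_generator y
  set p : Π y, E y := fun y => u 0 • s 0 y + u 1 • s 1 y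
  have hp0 : p y ≠ 0 := by
    intro h0
    have h1 := hy.self_of_nhds
    change L.fiber y = ℂ ∙ p y at h1
    rw [h0, Submodule.span_zero_singleton, he.self_of_nhds.2.2,
      Submodule.span_singleton_eq_bot] at h1
    exact he.self_of_nhds.2.1 h1
  obtain ⟨n, hn, hA⟩ := C.exists_area_eq_one hpary.holSectionAt hp0
  have hcoef := C.vol_hol t n y ht hn
  -- Every section of L is a function times `p`, and since `p` is parallel its derivative is again a
  -- multiple of `p`.
  have hteq : ∀ᶠ y' in 𝓝 y, t y' = C.vol y' ![t y', n y'] • p y' := by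
    filter_upwards [htL, hy, hA] with y' h1 h2 h3
    rw [h2] at h1
    obtain ⟨r, hr⟩ := Submodule.mem_span_singleton.1 h1
    change r • p y' = t y' at hr
    rw [← hr, area_smul_left, h3, mul_one]
  rw [C.nabla_congr t _ y ht hteq, C.nabla_leibniz _ _ y hcoef hpary.holSectionAt,
    hpary.self_of_nhds.2, hy.self_of_nhds, LinearMap.zero_apply, smul_zero, add_zero]
  exact Submodule.smul_mem _ _ (Submodule.mem_span_singleton_self _)

end ProjectivisedMap

/-! ### Parallel sections and solutions on the surface. -/

section Solutions

variable {φ : OpenPartialHomeomorph X ℂ} {a b c r : ℂ → ℂ} {e₁ e₂ : Π x, E x}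

/-- The coefficients are expressed as areas so that they can be compared across different adapted
frames. -/
theorem IsAdaptedFrame.exists_isParallelAt (h : C.IsAdaptedFrame L φ a b c e₁ e₂) {x : X}
    (hx : x ∈ φ.source) (hr : AnalyticAt ℂ r (φ x)) (hr0 : r (φ x) ≠ 0)
    (hrc : ∀ᶠ z in 𝓝 (φ x), r z ^ 2 = c z) {f : ℂ → ℂ}
    (hf : IsSolutionAt lam (potential lam a b c) f (φ x)) :
    ∃ t : Π x, E x, C.IsParallelAt t x ∧ ∀ᶠ y in 𝓝 x,
      C.vol y ![t y, e₂ y] = (gFun lam a c (φ y) * f (φ y) - lam * deriv f (φ y)) / r (φ y) *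
        C.vol y ![e₁ y, e₂ y] ∧
      C.vol y ![e₁ y, t y] = r (φ y) * f (φ y) * C.vol y ![e₁ y, e₂ y] := by
  obtain ⟨h1, h2, h3⟩ := system_of_isSolutionAt (h.analytic_a _ (φ.map_source hx)) hr hr0 hrc hf
  set u₁ : ℂ → ℂ := fun z => (gFun lam a c z * f z - lam * deriv f z) / r z
  set u₂ : ℂ → ℂ := fun z => r z * f z
  refine ⟨fun y => u₁ (φ y) • e₁ y + u₂ (φ y) • e₂ y, ?_, .of_forall fun y => ?_⟩
  · filter_upwards [(φ.continuousAt hx).eventually h1.eventually_analyticAt,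
      (φ.continuousAt hx).eventually h2.eventually_analyticAt,
      (φ.continuousAt hx).eventually h3, φ.open_source.mem_nhds hx] with y hu hv huv hy
    have hu1 := HolAt.comp_chart h.chart_mem hy hu
    have hv1 := HolAt.comp_chart h.chart_mem hy hv
    refine ⟨.combination hu1 hv1 (h.hol₁ hy) (h.hol₂ hy), ?_⟩
    rw [h.nabla_eq_zero_iff hy hu1 hv1]
    have hs : ∀ f : ℂ → ℂ, deriv (fun z => f (φ (φ.symm z))) (φ y) = deriv f (φ y) := by
      intro f
      refine EventuallyEq.deriv_eq ?_
      filter_upwards [φ.open_target.mem_nhds (φ.map_source hy)] with z hz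
      rw [φ.right_inv hz]
    rw [hs u₁, hs u₂]
    exact huv
  · simp only [area_add_left, area_smul_left, area_add_right, area_smul_right, area_self]
    constructor <;> ring

/-- The second coefficient of `t` over `r` satisfies the equation. The area of `t` with `e₂`
recovers the first coefficient, which carries f' and hence the Wronskian. -/
theorem IsAdaptedFrame.isSolutionAt (h : C.IsAdaptedFrame L φ a b c e₁ e₂) {x : X}
    (hx : x ∈ φ.source) (hr : AnalyticAt ℂ r (φ x)) (hr0 : r (φ x) ≠ 0)
    (hrc : ∀ᶠ z in 𝓝 (φ x), r z ^ 2 = c z) {t : Π x, E x} (ht : C.IsParallelAt t x) {f : ℂ → ℂ}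
    (hf : ∀ᶠ y in 𝓝 x, C.vol y ![e₁ y, t y] = r (φ y) * f (φ y) * C.vol y ![e₁ y, e₂ y]) :
    IsSolutionAt lam (potential lam a b c) f (φ x) ∧
      C.vol x ![t x, e₂ x] = (gFun lam a c (φ x) * f (φ x) - lam * deriv f (φ x)) / r (φ x) *
        C.vol x ![e₁ x, e₂ x] := by
  set k₁ : X → ℂ := fun y => C.vol y ![t y, e₂ y] / C.vol y ![e₁ y, e₂ y]
  set k₂ : X → ℂ := fun y => C.vol y ![e₁ y, t y] / C.vol y ![e₁ y, e₂ y]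
  have hk₁ : HolAt k₁ x := h.hol_coeff₁ hx ht.holSectionAt
  have hk₂ : HolAt k₂ x := h.hol_coeff₂ hx ht.holSectionAt
  have hsys : ∀ᶠ y in 𝓝 x, lam * deriv (fun z => k₁ (φ.symm z)) (φ y) + a (φ y) * k₁ y +
      b (φ y) * k₂ y = 0 ∧ lam * deriv (fun z => k₂ (φ.symm z)) (φ y) + c (φ y) * k₁ y -
      a (φ y) * k₂ y = 0 := by
    filter_upwards [ht.eventually, φ.open_source.mem_nhds hx] with y hty hy
    have h1 := h.hol_coeff₁ hy hty.holSectionAt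
    have h2 := h.hol_coeff₂ hy hty.holSectionAt
    rw [← h.nabla_eq_zero_iff hy h1 h2, ← hty.self_of_nhds.2]
    refine (C.nabla_congr _ _ y hty.holSectionAt ?_).symm
    filter_upwards [φ.open_source.mem_nhds hy] with y' hy'
    exact h.eq_combination hy' (t y')
  have hsys' := eventually_symm_of_eventually hx hsys
  have htarget := φ.open_target.mem_nhds (φ.map_source hx)
  obtain ⟨hsol, hd⟩ := isSolutionAt_of_system (lam := lam) (b := b)
    (h.analytic_a _ (φ.map_source hx)) hr hr0 hrc
    (hk₁.analyticAt h.chart_mem hx) (hk₂.analyticAt h.chart_mem hx)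
    (by filter_upwards [hsys', htarget] with z hz hz'
        rw [φ.right_inv hz'] at hz
        exact hz.1)
    (by filter_upwards [hsys', htarget] with z hz hz'
        rw [φ.right_inv hz'] at hz
        exact hz.2)
  have hfeq : f =ᶠ[𝓝 (φ x)] fun z => k₂ (φ.symm z) / r z := by
    filter_upwards [eventually_symm_of_eventually hx hf, hr.continuousAt.eventually_ne hr0,
      htarget] with z h1 h2 h3
    have h4 := h.area_ne_zero (φ.map_target h3)
    rw [φ.right_inv h3] at h1
    simp only [k₂]
    rw [h1]
    field_simp
  refine ⟨hsol.congr hfeq, ?_⟩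
  have h5 := hd.self_of_nhds
  rw [← hfeq.deriv_eq, ← hfeq.eq_of_nhds] at h5
  have h6 : C.vol x ![t x, e₂ x] = k₁ (φ.symm (φ x)) * C.vol x ![e₁ x, e₂ x] := by
    rw [congrArg k₁ (φ.left_inv hx)]
    simp only [k₁]
    rw [div_mul_cancel₀ _ (h.area_ne_zero hx)]
  rw [h6, h5]
  field_simp
  ring

end Solutions

end SLTwoLambdaConnection

/-! ### Developing maps as positions of L. -/

namespace SLTwoLambdaConnection

variable {X : Type*} [TopologicalSpace X] [ChartedSpace ℂ X] [IsManifold 𝓘(ℂ) ω X]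
  {E : X → Type*} [∀ x, AddCommGroup (E x)] [∀ x, Module ℂ (E x)]
  [∀ x, TopologicalSpace (E x)] [TopologicalSpace (TotalSpace (Fin 2 → ℂ) E)]
  [FiberBundle (Fin 2 → ℂ) E] [VectorBundle ℂ (Fin 2 → ℂ) E]
  [ContMDiffVectorBundle ω (Fin 2 → ℂ) E 𝓘(ℂ)] {lam : ℂ} {C : SLTwoLambdaConnection E lam}
  {L : LineSubbundle E}

section DevelopingMaps

variable {φ : OpenPartialHomeomorph X ℂ} {a b c r : ℂ → ℂ} {e₁ e₂ : Π x, E x}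

/-- The ratio of two independent solutions is the position of `L` in a parallel frame. -/
theorem IsAdaptedFrame.exists_position_eq (h : C.IsAdaptedFrame L φ a b c e₁ e₂)
    (hlam : lam ≠ 0) {x : X} (hx : x ∈ φ.source) (hc : c (φ x) ≠ 0) {f₁ f₂ : ℂ → ℂ}
    (h₁ : IsSolutionAt lam (potential lam a b c) f₁ (φ x))
    (h₂ : IsSolutionAt lam (potential lam a b c) f₂ (φ x))
    (hW : f₁ (φ x) * deriv f₂ (φ x) - f₂ (φ x) * deriv f₁ (φ x) ≠ 0) :
    ∃ s, C.IsParallelFrameAt s x ∧ ∀ᶠ y in 𝓝 x, ∀ p : PLine,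
      HomogeneousCoord p ![f₁ (φ y), f₂ (φ y)] → p = L.position s y := by
  obtain ⟨r, hr, hr0, hrc⟩ := (h.analytic_c _ (φ.map_source hx)).exists_sqrt hc
  obtain ⟨t₁, ht₁, h1⟩ := h.exists_isParallelAt hx hr hr0 hrc h₁
  obtain ⟨t₂, ht₂, h2⟩ := h.exists_isParallelAt hx hr hr0 hrc h₂
  have ht₂' : C.IsParallelAt (fun y => -t₂ y) x :=
    (ht₂.combination ht₂ (-1) 0).congr (.of_forall fun y => by simp)
  have hA := h.area_ne_zero hx
  -- In a frame (s₀, s₁) the line has coordinates given by the areas of (e₁, s₁) and (s₀, e₁). The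
  -- swap and the sign make these proportional to f₁ and f₂. Up to the nonzero factor λ · area(e₁,
  -- e₂), independence is the Wronskian condition.
  have hs : C.IsParallelFrameAt ![fun y => -t₂ y, t₁] x := by
    refine isParallelFrameAt_of_isParallelAt ht₂' ht₁ ?_
    simp only [Matrix.cons_val_zero, Matrix.cons_val_one]
    have e1 := h.eq_combination hx (t₁ x)
    have e2 := h.eq_combination hx (t₂ x)
    rw [h1.self_of_nhds.1, h1.self_of_nhds.2, mul_div_cancel_right₀ _ hA,
      mul_div_cancel_right₀ _ hA] at e1
    rw [h2.self_of_nhds.1, h2.self_of_nhds.2, mul_div_cancel_right₀ _ hA,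
      mul_div_cancel_right₀ _ hA] at e2
    rw [← neg_one_smul ℂ (t₂ x), e1, e2]
    simp only [area_add_left, area_add_right, area_smul_left, area_smul_right, area_self]
    rw [area_swap _ (e₂ x)]
    intro h0
    refine mul_ne_zero (mul_ne_zero hlam hA) hW ?_
    refine Eq.trans ?_ h0
    field_simp
    ring
  refine ⟨_, hs, ?_⟩
  filter_upwards [h1, h2, hs.eventually, φ.open_source.mem_nhds hx,
    (φ.continuousAt hx).eventually (hr.continuousAt.eventually_ne hr0)] with y h1 h2 hs hy hr0 p hp
  have he : e₁ y ≠ 0 := (h.frame y hy).2.2.1.ne_zero 0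
  have h3 := homogeneousCoord_position_of_area (C := C) (L := L) hs.linearIndependent he
    (h.fiber_eq hy)
  rw [eq_iff_of_homogeneousCoord hp h3]
  simp only [Matrix.cons_val_zero, Matrix.cons_val_one]
  rw [← neg_one_smul ℂ (t₂ y), area_smul_left, area_swap _ (t₂ y), h1.2, h2.2]
  ring

/-- The position of `L` in a parallel frame is a ratio of two independent solutions. -/
theorem IsAdaptedFrame.exists_solutions (h : C.IsAdaptedFrame L φ a b c e₁ e₂)
    {x : X} (hx : x ∈ φ.source) (hc : c (φ x) ≠ 0) {s : Fin 2 → Π x, E x}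
    (hs : C.IsParallelFrameAt s x) : ∃ f₁ f₂ : ℂ → ℂ,
      IsSolutionAt lam (potential lam a b c) f₁ (φ x) ∧
      IsSolutionAt lam (potential lam a b c) f₂ (φ x) ∧
      f₁ (φ x) * deriv f₂ (φ x) - f₂ (φ x) * deriv f₁ (φ x) ≠ 0 ∧
      ∀ᶠ y in 𝓝 x, HomogeneousCoord (L.position s y) ![f₁ (φ y), f₂ (φ y)] := by
  obtain ⟨r, hr, hr0, hrc⟩ := (h.analytic_c _ (φ.map_source hx)).exists_sqrt hc
  set k : Fin 2 → X → ℂ := fun i y =>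
    C.vol y ![e₁ y, s i y] / C.vol y ![e₁ y, e₂ y] / r (φ y)
  have hk : ∀ i, ∀ᶠ y in 𝓝 x, C.vol y ![e₁ y, s i y] =
      r (φ y) * k i (φ.symm (φ y)) * C.vol y ![e₁ y, e₂ y] := by
    intro i
    filter_upwards [φ.open_source.mem_nhds hx,
      (φ.continuousAt hx).eventually (hr.continuousAt.eventually_ne hr0)] with y hy hr0
    have := h.area_ne_zero hy
    rw [φ.left_inv hy]
    simp only [k]
    field_simp
  clear_value k
  obtain ⟨hs0, hd0⟩ := h.isSolutionAt hx hr hr0 hrc (hs.isParallelAt 0)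
    (f := fun z => k 0 (φ.symm z)) (hk 0)
  obtain ⟨hs1, hd1⟩ := h.isSolutionAt hx hr hr0 hrc (hs.isParallelAt 1)
    (f := fun z => k 1 (φ.symm z)) (hk 1)
  -- The pair of solutions comes from s₁ and −s₀, the order and sign in which these areas give the
  -- coordinates of the line.
  have hs0' := hs0.const_mul (-1)
  refine ⟨_, _, hs1, hs0', ?_, ?_⟩
  · have hA := h.area_ne_zero hx
    have hsA := hs.area_ne_zero
    have e0 := h.eq_combination hx (s 0 x)
    have e1 := h.eq_combination hx (s 1 x)
    rw [hd0, (hk 0).self_of_nhds, mul_div_cancel_right₀ _ hA, mul_div_cancel_right₀ _ hA] at e0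
    rw [hd1, (hk 1).self_of_nhds, mul_div_cancel_right₀ _ hA, mul_div_cancel_right₀ _ hA] at e1
    rw [e0, e1] at hsA
    simp only [area_add_left, area_add_right, area_smul_left, area_smul_right, area_self] at hsA
    rw [area_swap _ (e₂ x)] at hsA
    intro h0
    rw [deriv_const_mul_field] at h0
    refine hsA (Eq.trans ?_ ((congrArg (lam * C.vol x ![e₁ x, e₂ x] * ·) h0).trans (mul_zero _)))
    field_simp
    ring
  · filter_upwards [hk 0, hk 1, hs.eventually, φ.open_source.mem_nhds hx,
      (φ.continuousAt hx).eventually (hr.continuousAt.eventually_ne hr0)] with y h0 h1 hs hy hr0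
    have he : e₁ y ≠ 0 := (h.frame y hy).2.2.1.ne_zero 0
    have h3 := homogeneousCoord_position_of_area (C := C) (L := L) hs.linearIndependent he
      (h.fiber_eq hy)
    have hA := h.area_ne_zero hy
    rw [area_swap _ (s 0 y), h0, h1] at h3
    refine h3.of_cross_eq_zero (fun hz => h3.ne_zero ?_) ?_
    · have h4 := congrFun hz 0
      have h5 := congrFun hz 1
      simp only [Matrix.cons_val_zero, Matrix.cons_val_one, Pi.zero_apply, neg_one_mul,
        neg_eq_zero] at h4 h5
      rw [h4, h5]
      ext i; fin_cases i <;> simp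
    · simp only [Matrix.cons_val_zero, Matrix.cons_val_one]
      ring

variable [ConnectedSpace X]

/-- At a nearby point where c ≠ 0 the map is a ratio of solutions, hence the position of L in some
parallel frame and a Möbius image of its position in `s`. The identity theorem carries this relation
back to `x`, which may be a zero of c. -/
theorem exists_smul_of_mem_developingMaps (hlam : lam ≠ 0) (hC : C.IsIrreducible)
    {p : Set X × (X → PLine)} (hp : p ∈ developingMaps lam (C.inducedOper L)) {x : X}
    (hx : x ∈ p.1) {s : Fin 2 → Π x, E x} (hs : C.IsParallelFrameAt s x) :
    ∃ g : SL(2, ℂ), ∀ᶠ y in 𝓝 x, p.2 y = g • L.position s y := by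
  obtain ⟨hpo, hphol, d, hd, hpd, hsol⟩ := hp
  obtain ⟨a, b, c, e₁, e₂, h, hq⟩ := mem_inducedOper.1 hd
  obtain ⟨U, hUo, hxU, hU⟩ := exists_open_identity_theorem_smul (hphol x hx) (hs.pHolAt (L := L))
  obtain ⟨y, hyc, hyp, hys, hyU⟩ := ((h.frequently_ne_zero hC (hpd hx)).and_eventually
    ((hpo.eventually_mem hx).and (hs.eventually.and (hUo.eventually_mem hxU)))).exists
  have hyφ := hpd hyp
  have han : AnalyticAt ℂ d.2 (d.1 y) := by
    rw [hq]; exact (h.analyticAt_potential_iff hlam hC hyφ).2 hyc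
  obtain ⟨f₁, f₂, h1, h2, hW, hpf⟩ := hsol y hyp han
  rw [hq] at h1 h2
  obtain ⟨s', hs', hpos⟩ := h.exists_position_eq hlam hyφ hyc h1 h2 hW
  obtain ⟨g, hg⟩ := hys.exists_smul (L := L) hlam hs'
  refine ⟨g, ?_⟩
  have h0 := hU g y hyU (by
    filter_upwards [hpf, hpos, hg] with y' h1 h2 h3
    rw [h2 _ h1, h3])
  filter_upwards [hUo.mem_nhds hxU] with y' hy' using h0 y' hy'

/-- Solutions must be produced wherever the potential is analytic. Because of the double poles,
those are precisely the points with c ≠ 0, where positions are ratios of solutions. -/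
theorem mem_developingMaps (hlam : lam ≠ 0) (hC : C.IsIrreducible)
    (h : C.IsAdaptedFrame L φ a b c e₁ e₂) {s : Fin 2 → Π x, E x} {V : Set X} (hV : IsOpen V)
    (hVφ : V ⊆ φ.source) (hs : ∀ x ∈ V, C.IsParallelFrameAt s x) :
    (V, L.position s) ∈ developingMaps lam (C.inducedOper L) := by
  refine ⟨hV, fun x hx => (hs x hx).pHolAt, (φ, potential lam a b c),
    mem_inducedOper.2 ⟨a, b, c, e₁, e₂, h, rfl⟩, hVφ, fun x hx hq => ?_⟩
  exact h.exists_solutions (hVφ hx) ((h.analyticAt_potential_iff hlam hC (hVφ hx)).1 hq)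
    (hs x hx)

theorem exists_mem_developingMaps (hlam : lam ≠ 0) (hC : C.IsIrreducible) {x : X}
    {s : Fin 2 → Π x, E x} (hs : C.IsParallelFrameAt s x) :
    ∃ V : Set X, x ∈ V ∧ (V, L.position s) ∈ developingMaps lam (C.inducedOper L) ∧
      (V, L.position s) ∈ C.projectivisation L := by
  obtain ⟨φ, a, b, c, e₁, e₂, h, hx, hsφ⟩ := C.exists_isAdaptedFrame L hs.eventually
  refine ⟨φ.source, hx, mem_developingMaps hlam hC h φ.open_source le_rfl hsφ, φ.open_source, s,
    fun y hy => ⟨hsφ y hy, ?_⟩⟩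
  obtain ⟨u, hu, huL⟩ := exists_fiber_eq_span (hsφ y hy).linearIndependent C L
  exact ⟨u, homogeneousCoord_position (hsφ y hy).linearIndependent hu huL, huL⟩

theorem exists_smul_of_mem_projectivisation (hlam : lam ≠ 0)
    {p : Set X × (X → PLine)} (hp : p ∈ C.projectivisation L) {x : X}
    (hx : x ∈ p.1) {s : Fin 2 → Π x, E x} (hs : C.IsParallelFrameAt s x) :
    ∃ g : SL(2, ℂ), ∀ᶠ y in 𝓝 x, p.2 y = g • L.position s y := by
  obtain ⟨hpo, s', hs'⟩ := hp
  obtain ⟨g, hg⟩ := hs.exists_smul (L := L) hlam (hs' x hx).1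
  refine ⟨g, ?_⟩
  filter_upwards [hg, hpo.mem_nhds hx] with y hy hyp
  obtain ⟨h1, u, hu, huL⟩ := hs' y hyp
  rw [← hy, eq_iff_of_homogeneousCoord hu
    (homogeneousCoord_position h1.linearIndependent hu.ne_zero huL)]
  ring

/-- A collection of maps that are locally Möbius transforms of the position of `L` in parallel
frames is a branched projective structure. -/
theorem isBranchedProjectiveStructure (hlam : lam ≠ 0) (hC : C.IsIrreducible)
    {S : Set (Set X × (X → PLine))} (hcover : ∀ x, ∃ p ∈ S, x ∈ p.1)
    (hopen : ∀ p ∈ S, IsOpen p.1)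
    (hS : ∀ p ∈ S, ∀ x ∈ p.1, ∀ s, C.IsParallelFrameAt s x →
      ∃ g : SL(2, ℂ), ∀ᶠ y in 𝓝 x, p.2 y = g • L.position s y) :
    IsBranchedProjectiveStructure S where
  cover := hcover
  isOpen := hopen
  holomorphic p hp x hx := by
    obtain ⟨s, hs, -⟩ := C.exists_isParallelFrameAt L hlam x
    obtain ⟨g, hg⟩ := hS p hp x hx s hs
    exact (hs.pHolAt.smul g).congr hg
  nonconstant p hp x hx hconst := by
    obtain ⟨s, hs, -⟩ := C.exists_isParallelFrameAt L hlam x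
    obtain ⟨g, hg⟩ := hS p hp x hx s hs
    refine hs.not_eventually_const (L := L) hC ?_
    have hx' := hg.self_of_nhds
    filter_upwards [hconst, hg] with y h1 h2
    rw [h2, hx'] at h1
    exact MulAction.injective g h1
  moebius p hp p' hp' x hx := by
    obtain ⟨s, hs, -⟩ := C.exists_isParallelFrameAt L hlam x
    obtain ⟨g, hg⟩ := hS p hp x hx.1 s hs
    obtain ⟨g', hg'⟩ := hS p' hp' x hx.2 s hs
    refine ⟨g' * g⁻¹, ?_⟩
    filter_upwards [hg, hg'] with y h1 h2
    rw [h1, h2, mul_smul, inv_smul_smul]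

theorem bpsEquivalent (hlam : lam ≠ 0) (hC : C.IsIrreducible) (L : LineSubbundle E) :
    BPSEquivalent (developingMaps lam (C.inducedOper L)) (C.projectivisation L) := by
  have hcover : ∀ x, ∃ p, p ∈ developingMaps lam (C.inducedOper L) ∧
      p ∈ C.projectivisation L ∧ x ∈ p.1 := by
    intro x
    obtain ⟨s, hs, -⟩ := C.exists_isParallelFrameAt L hlam x
    obtain ⟨V, hxV, h1, h2⟩ := exists_mem_developingMaps (L := L) hlam hC hs
    exact ⟨_, h1, h2, hxV⟩
  have hD : ∀ p ∈ developingMaps lam (C.inducedOper L), ∀ x ∈ p.1, ∀ s,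
      C.IsParallelFrameAt s x → ∃ g : SL(2, ℂ), ∀ᶠ y in 𝓝 x, p.2 y = g • L.position s y :=
    fun p hp x hx s hs => exists_smul_of_mem_developingMaps hlam hC hp hx hs
  have hP : ∀ p ∈ C.projectivisation L, ∀ x ∈ p.1, ∀ s,
      C.IsParallelFrameAt s x → ∃ g : SL(2, ℂ), ∀ᶠ y in 𝓝 x, p.2 y = g • L.position s y :=
    fun p hp x hx s hs => exists_smul_of_mem_projectivisation hlam hp hx hs
  refine ⟨isBranchedProjectiveStructure hlam hC (fun x => ?_) (fun p hp => hp.1) hD,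
    isBranchedProjectiveStructure hlam hC (fun x => ?_) (fun p hp => hp.1) hP,
    isBranchedProjectiveStructure hlam hC (fun x => ?_)
      (fun p hp => hp.elim (fun h => h.1) (fun h => h.1))
      (fun p hp => hp.elim (hD p) (hP p))⟩ <;> obtain ⟨p, h1, h2, h3⟩ := hcover x
  exacts [⟨p, h1, h3⟩, ⟨p, h2, h3⟩, ⟨p, .inl h1, h3⟩]

end DevelopingMaps

/-! ### Change of coordinate and of adapted frame. -/

section Compatibility

/-- The derivative of a coordinate change never vanishes: dz' takes the value 1 on some tangent
vector. It therefore has a local holomorphic square root. -/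
theorem exists_sqrt_coordinate_change {φ φ' : OpenPartialHomeomorph X ℂ}
    (hφ : φ ∈ IsManifold.maximalAtlas 𝓘(ℂ) ω X) (hφ' : φ' ∈ IsManifold.maximalAtlas 𝓘(ℂ) ω X)
    {x : X} (hx : x ∈ φ.source) (hx' : x ∈ φ'.source) :
    ∃ N : X → ℂ, HolAt N x ∧ N x ≠ 0 ∧
      ∀ᶠ y in 𝓝 x, N y ^ 2 = deriv (fun z => φ' (φ.symm z)) (φ y) := by
  have h1 := (HolAt.chart hφ' hx').analyticAt hφ hx
  have h0 : deriv (fun z => φ' (φ.symm z)) (φ x) ≠ 0 := by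
    intro h0
    obtain ⟨v, hv⟩ := exists_mvfderiv_chart_eq_one hφ' hx'
    rw [mvfderiv_eq_deriv_mul hφ hx (HolAt.chart hφ' hx'), h0, zero_mul] at hv
    exact zero_ne_one hv
  obtain ⟨r, hr, hr0, hrc⟩ := h1.deriv.exists_sqrt h0
  exact ⟨fun y => r (φ y), .comp_chart hφ hx hr, hr0, (φ.continuousAt hx).eventually hrc⟩

/-- Both equations describe the same parallel section. The one attached to f, read in the second
coordinate and frame, yields a constant times N f. -/
theorem isSolutionAt_coordinate_change (hlam : lam ≠ 0)
    {φ φ' : OpenPartialHomeomorph X ℂ} {a b c a' b' c' : ℂ → ℂ} {e₁ e₂ e₁' e₂' : Π x, E x}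
    (h : C.IsAdaptedFrame L φ a b c e₁ e₂) (h' : C.IsAdaptedFrame L φ' a' b' c' e₁' e₂')
    {x : X} (hx : x ∈ φ.source) (hx' : x ∈ φ'.source) (hc : c (φ x) ≠ 0)
    {N : X → ℂ} (hN : HolAt N x) (hN0 : N x ≠ 0)
    (hNsq : ∀ᶠ y in 𝓝 x, N y ^ 2 = deriv (fun z => φ' (φ.symm z)) (φ y)) {f : X → ℂ}
    (hf : IsSolutionAt lam (potential lam a b c) (fun z => f (φ.symm z)) (φ x)) :
    IsSolutionAt lam (potential lam a' b' c') (fun z => N (φ'.symm z) * f (φ'.symm z)) (φ' x) := by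
  obtain ⟨r, hr, hr0, hrc⟩ := (h.analytic_c _ (φ.map_source hx)).exists_sqrt hc
  obtain ⟨t, ht, htf⟩ := h.exists_isParallelAt hx hr hr0 hrc hf
  set V := C.vol x ![e₁ x, e₂ x]
  set V' := C.vol x ![e₁' x, e₂' x]
  have hV : V ≠ 0 := h.area_ne_zero hx
  have hV' : V' ≠ 0 := h'.area_ne_zero hx'
  -- The frames may have different constant areas V and V'. The constant k compensates for their
  -- ratio, and linearity removes it at the end.
  obtain ⟨k, hk⟩ := IsAlgClosed.exists_pow_nat_eq (V / V') (n := 2) (by norm_num)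
  have hk0 : k ≠ 0 := by rintro rfl; exact div_ne_zero hV hV' (by simpa using hk.symm)
  set m : X → ℂ := fun y => C.vol y ![e₁' y, e₂ y] / C.vol y ![e₁ y, e₂ y]
  have hm : HolAt m x := h.hol_coeff₁ hx (h'.hol₁ hx')
  have hme : ∀ y ∈ φ.source ∩ φ'.source, m y ≠ 0 ∧ e₁' y = m y • e₁ y := by
    intro y hy
    have h1 : e₁' y ∈ L.fiber y := by
      rw [h'.fiber_eq hy.2]; exact Submodule.mem_span_singleton_self _
    rw [h.fiber_eq hy.1] at h1
    obtain ⟨q, hq⟩ := Submodule.mem_span_singleton.1 h1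
    have hmq : m y = q := by
      simp only [m]
      rw [← hq, area_smul_left, mul_div_cancel_right₀ _ (h.area_ne_zero hy.1)]
    refine ⟨fun h0 => (h'.frame y hy.2).2.2.1.ne_zero 0 ?_, by rw [hmq, hq]⟩
    show e₁' y = 0
    rw [← hq, ← hmq, h0, zero_smul]
  have hsource : ∀ᶠ y in 𝓝 x, y ∈ φ.source ∩ φ'.source :=
    (φ.open_source.inter φ'.open_source).mem_nhds ⟨hx, hx'⟩
  -- Since E/L is dual to L through the area form, rescaling e₁ by m scales the second fundamental
  -- form by m². The coordinate change divides it by N², and V, V' account for the choices of e₂.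
  have hcc : ∀ᶠ y in 𝓝 x, c' (φ' y) * (N y ^ 2 * V') = m y ^ 2 * c (φ y) * V := by
    filter_upwards [hsource, h.eventually_area_eq hlam hx, h'.eventually_area_eq hlam hx', hNsq,
      hm.eventually] with y hy h1 h2 h3 h4
    obtain ⟨v, hv⟩ := exists_mvfderiv_chart_eq_one h.chart_mem hy.1
    have hv' : mvfderiv 𝓘(ℂ) φ' y v = N y ^ 2 := by
      rw [mvfderiv_eq_deriv_mul h.chart_mem hy.1 (HolAt.chart h'.chart_mem hy.2), hv, h3, mul_one]
    have e1 := ((h'.frame y hy.2).2.2.2.2 v).1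
    have e2 : C.nabla e₁' y v = (lam * mvfderiv 𝓘(ℂ) m y v) • e₁ y +
        m y • (mvfderiv 𝓘(ℂ) φ y v • (a (φ y) • e₁ y + c (φ y) • e₂ y)) := by
      rw [C.nabla_congr e₁' (fun y => m y • e₁ y) y (h'.hol₁ hy.2) (by
        filter_upwards [φ.open_source.mem_nhds hy.1, φ'.open_source.mem_nhds hy.2] with z h1 h2
        exact (hme z ⟨h1, h2⟩).2), C.nabla_leibniz m e₁ y h4 (h.hol₁ hy.1),
        ((h.frame y hy.1).2.2.2.2 v).1]
    have e3 := congrArg (fun w => C.vol y ![e₁' y, w]) (e1.symm.trans e2)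
    simp only [hv, hv', area_add_right, area_smul_right, area_self, one_smul, h2] at e3
    have e4 : ∀ w, C.vol y ![e₁' y, w] = m y * C.vol y ![e₁ y, w] := fun w => by
      rw [(hme y hy).2, area_smul_left]
    rw [e4, e4, area_self, h1] at e3
    linear_combination e3
  -- This is a square root of c' adapted to r: with it, area(e₁', t) = m r f V equals r' · (k N f) ·
  -- V'.
  set r' : X → ℂ := fun y => m y * r (φ y) * k / N y
  have hrφ : HolAt (fun y => r (φ y)) x := .comp_chart h.chart_mem hx hr
  have hr' : HolAt r' x := ((hm.mul hrφ).mul (.const k x)).div hN hN0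
  have hr'0 : r' x ≠ 0 :=
    div_ne_zero (mul_ne_zero (mul_ne_zero (hme x ⟨hx, hx'⟩).1 hr0) hk0) hN0
  have hr'c : ∀ᶠ y in 𝓝 x, r' y ^ 2 = c' (φ' y) := by
    filter_upwards [hcc, (φ.continuousAt hx).eventually hrc, hN.continuousAt.eventually_ne hN0]
      with y h1 h2 h3
    simp only [r']
    rw [div_pow, mul_pow, mul_pow, h2, hk]
    field_simp
    linear_combination -h1
  have hsol := (h'.isSolutionAt hx' (r := fun z => r' (φ'.symm z))
    (hr'.analyticAt h'.chart_mem hx') (by rwa [φ'.left_inv hx'])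
    (by filter_upwards [eventually_symm_of_eventually hx' hr'c,
          φ'.open_target.mem_nhds (φ'.map_source hx')] with z h1 h2
        rw [h1, φ'.right_inv h2])
    ht (f := fun z => k * (N (φ'.symm z) * f (φ'.symm z))) (by
      filter_upwards [htf, hsource, h.eventually_area_eq hlam hx, h'.eventually_area_eq hlam hx',
        hN.continuousAt.eventually_ne hN0] with y h1 h2 h3 h4 h5
      rw [(hme y h2).2, area_smul_left, h1.2, φ'.left_inv h2.2, φ.left_inv h2.1, h3,
        ← (hme y h2).2, h4]
      simp only [r']
      change m y * (r (φ y) * f y * V) = _ * V'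
      have hkV : k ^ 2 * V' = V := by rw [hk, div_mul_cancel₀ _ hV']
      rw [← hkV]
      field_simp)).1
  refine (hsol.const_mul k⁻¹).congr (.of_forall fun z => ?_)
  field_simp

theorem isOper [ConnectedSpace X] (hlam : lam ≠ 0) (hC : C.IsIrreducible) (L : LineSubbundle E) :
    IsOper lam (C.inducedOper L) where
  chart_mem d hd := hd.1
  cover x := by
    obtain ⟨φ, a, b, c, e₁, e₂, h, hx, -⟩ := C.exists_isAdaptedFrame L (x := x)
      (P := fun _ => True) (.of_forall fun _ => trivial)
    exact ⟨(φ, potential lam a b c), mem_inducedOper.2 ⟨a, b, c, e₁, e₂, h, rfl⟩, hx⟩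
  meromorphic d hd := by
    obtain ⟨a, b, c, e₁, e₂, h, hq⟩ := mem_inducedOper.1 hd
    rw [hq]
    exact fun z hz => MeromorphicAt.potential (h.analytic_a z hz) (h.analytic_b z hz)
      (h.analytic_c z hz)
  compatible d hd d' hd' x hx := by
    obtain ⟨a, b, c, e₁, e₂, h, hq⟩ := mem_inducedOper.1 hd
    obtain ⟨a', b', c', e₁', e₂', h', hq'⟩ := mem_inducedOper.1 hd'
    obtain ⟨N, hN, hN0, hNsq⟩ := exists_sqrt_coordinate_change h.chart_mem h'.chart_mem hx.1 hx.2
    refine ⟨N, hN, ?_⟩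
    filter_upwards [hN.eventually, hN.continuousAt.eventually_ne hN0, hNsq.eventually_nhds,
      d.1.open_source.mem_nhds hx.1, d'.1.open_source.mem_nhds hx.2] with y h1 h2 h3 h4 h5
    refine ⟨h3.self_of_nhds, fun hqy _ f hf => ?_⟩
    rw [hq] at hqy hf
    rw [hq']
    exact isSolutionAt_coordinate_change hlam h h' h4 h5
      ((h.analyticAt_potential_iff hlam hC h4).1 hqy) h1 h2 h3 hf
  apparent x := by
    obtain ⟨s, hs, -⟩ := C.exists_isParallelFrameAt L hlam x
    obtain ⟨V, hxV, h1, -⟩ := exists_mem_developingMaps (L := L) hlam hC hs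
    exact ⟨_, h1, hxV⟩

end Compatibility

end SLTwoLambdaConnection

/-! ### Uniqueness of continuation and stabilisers of germs. -/

section Continuation

variable {X : Type*} [TopologicalSpace X] [ChartedSpace ℂ X] [IsManifold 𝓘(ℂ) ω X]

/-- Uniqueness of analytic continuation, up to a Möbius transformation. -/
theorem IsContinuationAlong.eventually_eq_smul {x y : X} {γ : Path x y}
    {W W' : unitInterval → X → PLine} (hW : IsContinuationAlong γ W)
    (hW' : IsContinuationAlong γ W') (g : SL(2, ℂ))
    (h : ∀ᶠ z in 𝓝 x, W' 0 z = g • W 0 z) (t : unitInterval) :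
    ∀ᶠ z in 𝓝 (γ t), W' t z = g • W t z := by
  let T : Set unitInterval := {t | ∀ᶠ z in 𝓝 (γ t), W' t z = g • W t z}
  have hopen : IsOpen T := by
    refine isOpen_iff_mem_nhds.2 fun t ht => ?_
    filter_upwards [(hW t).2, (hW' t).2, γ.continuous.continuousAt.eventually
      (eventually_eventually_nhds.2 ht)] with t' h1 h2 h3
    show ∀ᶠ z in 𝓝 (γ t'), W' t' z = g • W t' z
    filter_upwards [h1, h2, h3] with z h1 h2 h3
    rw [h1, h2, h3]
  -- Near a limit parameter both continuations are represented by one pair of germs, to which the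
  -- identity theorem applies.
  have hclosed : IsClosed T := by
    refine isClosed_of_closure_subset fun t ht => ?_
    obtain ⟨U, hUo, htU, hU⟩ := exists_open_identity_theorem_smul (hW' t).1 (hW t).1
    obtain ⟨t', ⟨h1, h2, h3⟩, h4⟩ := mem_closure_iff_nhds.1 ht _ ((hW t).2.and ((hW' t).2.and
      (γ.continuous.continuousAt.eventually (hUo.eventually_mem htU))))
    have h4 : ∀ᶠ z in 𝓝 (γ t'), W' t' z = g • W t' z := h4
    have := hU g _ h3 (by
      filter_upwards [h1, h2, h4] with z h1 h2 h4
      rw [← h1, ← h2, h4])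
    exact (hUo.eventually_mem htU).mono this
  have huniv := IsClopen.eq_univ ⟨hclosed, hopen⟩ ⟨0, show ∀ᶠ z in 𝓝 (γ 0), _ by rwa [γ.source]⟩
  exact (huniv ▸ Set.mem_univ t : t ∈ T)

/-- A nonconstant holomorphic map to the projective line is not invariant under any Möbius
transformation but the identity. -/
theorem psl_eq_one_of_eventually_smul_eq {w : X → PLine} {x : X} (hw : PHolAt w x)
    (hconst : ¬ ∀ᶠ y in 𝓝 x, w y = w x)
    {A : Matrix.ProjectiveSpecialLinearGroup (Fin 2) ℂ} (hA : ∀ᶠ y in 𝓝 x, A • w y = w y) :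
    A = 1 := by
  obtain ⟨m, rfl⟩ := QuotientGroup.mk_surjective A
  obtain ⟨u, hu, hwu⟩ := hw
  -- Fixed points of `m` are zeros of a binary quadratic form. It vanishes along a nonconstant curve
  -- through v, so factoring out the root v, twice, will show that it is zero.
  have hquad : ∀ᶠ y in 𝓝 x, m 1 0 * u y 0 ^ 2 + (m 1 1 - m 0 0) * (u y 0 * u y 1) -
      m 0 1 * u y 1 ^ 2 = 0 := by
    filter_upwards [hA, hwu] with y h1 h2
    have h1 : m • w y = w y := h1
    have h3 := (eq_iff_of_homogeneousCoord (h2.smul m) h2).1 h1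
    simp only [Matrix.mulVec, dotProduct, Fin.sum_univ_two] at h3
    linear_combination -h3
  set α := m 1 0
  set β := m 1 1 - m 0 0
  set δ := -m 0 1
  set v := u x
  have hv : v ≠ 0 := hwu.self_of_nhds.ne_zero
  have hnotconst : ¬ ∀ᶠ y in 𝓝 x, u y 1 * v 0 - u y 0 * v 1 = 0 := fun h0 => hconst (by
    filter_upwards [hwu, h0] with y h1 h2
    rw [eq_iff_of_homogeneousCoord h1 hwu.self_of_nhds]
    linear_combination -h2)
  have hfreq : ∃ᶠ y in 𝓝 x, u y 1 * v 0 - u y 0 * v 1 ≠ 0 :=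
    fun h => hnotconst (h.mono fun y hy => not_not.1 hy)
  have hQv : α * v 0 ^ 2 + β * (v 0 * v 1) + δ * v 1 ^ 2 = 0 := by
    have := hquad.self_of_nhds
    simp only [δ]; linear_combination this
  have hcont : ∀ i, ContinuousAt (fun y => u y i) x := fun i => (hu.apply i).continuousAt
  have key : α = 0 ∧ β = 0 ∧ δ = 0 := by
    rcases eq_or_ne (v 0) 0 with h0 | h0
    · have h1 : v 1 ≠ 0 := fun h1 => hv (by ext i; fin_cases i <;> simp [h0, h1])
      have hδ : δ = 0 := by simpa [h0, h1] using hQv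
      have hlin : ∀ᶠ y in 𝓝 x, u y 1 * v 0 - u y 0 * v 1 ≠ 0 → α * u y 0 + β * u y 1 = 0 := by
        filter_upwards [hquad] with y hy hne
        rw [h0, mul_zero, zero_sub] at hne
        have hne : u y 0 ≠ 0 := fun h => hne (by rw [h]; ring)
        refine (mul_eq_zero.1 ?_).resolve_left hne
        linear_combination hy - u y 1 ^ 2 * hδ
      have hβ : β = 0 := by
        by_contra hβ
        have : ContinuousAt (fun y => α * u y 0 + β * u y 1) x :=
          (continuousAt_const.mul (hcont 0)).add (continuousAt_const.mul (hcont 1))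
        have h0' : α * v 0 + β * v 1 ≠ 0 := by
          rw [h0]; simpa using ⟨hβ, h1⟩
        have hne := this.eventually_ne h0'
        obtain ⟨y, h2, h3, h4⟩ := (hfreq.and_eventually (hlin.and hne)).exists
        exact h4 (h3 h2)
      refine ⟨?_, hβ, hδ⟩
      obtain ⟨y, h2, h3⟩ := (hfreq.and_eventually hlin).exists
      have h4 := h3 h2
      rw [hβ, zero_mul, add_zero] at h4
      refine (mul_eq_zero.1 h4).resolve_right fun h5 => h2 (by rw [h0, h5]; ring)
    -- Scaling the form by v₀² and subtracting u₀² times its value at v makes the cross product of u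
    -- and v a factor, leaving a linear cofactor.
    · have hlin : ∀ᶠ y in 𝓝 x, u y 1 * v 0 - u y 0 * v 1 ≠ 0 →
          β * u y 0 * v 0 + δ * (u y 1 * v 0 + u y 0 * v 1) = 0 := by
        filter_upwards [hquad] with y hy hne
        refine (mul_eq_zero.1 ?_).resolve_left hne
        linear_combination v 0 ^ 2 * hy - u y 0 ^ 2 * hQv
      -- The cofactor vanishes at points accumulating at `x`, hence at v by continuity: v is a
      -- double root.
      have h2 : β * v 0 + 2 * δ * v 1 = 0 := by
        by_contra h2
        have : ContinuousAt (fun y => β * u y 0 * v 0 + δ * (u y 1 * v 0 + u y 0 * v 1)) x :=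
          ((continuousAt_const.mul (hcont 0)).mul continuousAt_const).add
            (continuousAt_const.mul (((hcont 1).mul continuousAt_const).add
              ((hcont 0).mul continuousAt_const)))
        have h0' : β * v 0 * v 0 + δ * (v 1 * v 0 + v 0 * v 1) ≠ 0 := fun h3 =>
          mul_ne_zero h0 h2 (by linear_combination h3)
        have hne := this.eventually_ne h0'
        obtain ⟨y, h3, h4, h5⟩ := (hfreq.and_eventually (hlin.and hne)).exists
        exact h5 (h4 h3)
      have hδ : δ = 0 := by
        obtain ⟨y, h3, h4⟩ := (hfreq.and_eventually hlin).exists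
        have h5 := h4 h3
        refine (mul_eq_zero.1 ?_).resolve_right h3
        linear_combination h5 - u y 0 * h2
      have hβ : β = 0 := by
        rw [hδ] at h2
        simpa [h0] using h2
      refine ⟨?_, hβ, hδ⟩
      rw [hβ, hδ] at hQv
      simpa [h0] using hQv
  refine FaithfulSMul.eq_of_smul_eq_smul (α := PLine) fun p => ?_
  rw [one_smul]
  show m • p = p
  obtain ⟨u', hu'⟩ := exists_homogeneousCoord p
  rw [eq_iff_of_homogeneousCoord (hu'.smul m) hu']
  obtain ⟨h1, h2, h3⟩ := key
  simp only [Matrix.mulVec, dotProduct, Fin.sum_univ_two]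
  linear_combination -(u' 0) ^ 2 * h1 - u' 0 * u' 1 * h2 - (u' 1) ^ 2 * h3

end Continuation

/-! ### Monodromy of the connection and of the oper. -/

namespace SLTwoLambdaConnection

variable {X : Type*} [TopologicalSpace X] [ChartedSpace ℂ X] [IsManifold 𝓘(ℂ) ω X]
  {E : X → Type*} [∀ x, AddCommGroup (E x)] [∀ x, Module ℂ (E x)]
  [∀ x, TopologicalSpace (E x)] [TopologicalSpace (TotalSpace (Fin 2 → ℂ) E)]
  [FiberBundle (Fin 2 → ℂ) E] [VectorBundle ℂ (Fin 2 → ℂ) E]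
  [ContMDiffVectorBundle ω (Fin 2 → ℂ) E 𝓘(ℂ)] {lam : ℂ} {C : SLTwoLambdaConnection E lam}
  {L : LineSubbundle E}

section ProjectiveMonodromy

theorem position_congr {s s' : Fin 2 → Π x, E x} {y : X} (h : ∀ i, s i y = s' i y) :
    L.position s y = L.position s' y := by
  rw [LineSubbundle.position, LineSubbundle.position, h 0, h 1]

/-- The position of `L` in the parallel transport of a frame is the analytic continuation of its
position in the frame. -/
theorem IsMonodromy.exists_continuation {x₀ : X} {ρ : FundamentalGroup X x₀ →* SL(2, ℂ)}
    (hρ : C.IsMonodromy x₀ ρ) : ∃ s, C.IsParallelFrameAt s x₀ ∧ ∀ γ : Path x₀ x₀,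
      ∃ W : unitInterval → X → PLine, IsContinuationAlong γ W ∧ W 0 = L.position s ∧
        ∀ᶠ y in 𝓝 x₀, W 1 y =
          (ρ (FundamentalGroup.fromPath (Path.Homotopic.Quotient.mk γ)))⁻¹ • L.position s y := by
  obtain ⟨s, hs⟩ := hρ
  have hpar : C.IsParallelFrameAt s x₀ := by
    obtain ⟨F, hF, h0, -⟩ := hs (Path.refl x₀)
    have := (hF 0).1
    rwa [h0] at this
  refine ⟨s, hpar, fun γ => ?_⟩
  obtain ⟨F, hF, h0, h1⟩ := hs γ
  refine ⟨fun t => L.position (F t), fun t => ⟨(hF t).1.pHolAt, ?_⟩, by simp only [h0], ?_⟩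
  · filter_upwards [(hF t).2] with t' ht'
    filter_upwards [eventually_all.2 ht'] with y hy using position_congr hy
  · have hF1 := (hF 1).1
    rw [γ.target] at hF1
    filter_upwards [eventually_all.2 h1, hpar.eventually, hF1.eventually] with y h1 h2 h3
    -- Coordinates transform inversely to frames: passing from s to s ρ(γ) applies ρ(γ)⁻¹ to the
    -- position.
    rw [position_eq_smul h2 h3 _ (one_smul ℂ _).symm h1, inv_smul_smul]

variable [ConnectedSpace X]

theorem IsMonodromy.isMonodromyOfBPS (hlam : lam ≠ 0) (hC : C.IsIrreducible) {x₀ : X}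
    {ρ : FundamentalGroup X x₀ →* SL(2, ℂ)} (hρ : C.IsMonodromy x₀ ρ) (L : LineSubbundle E) :
    IsMonodromyOfBPS (developingMaps lam (C.inducedOper L)) x₀ (projPSL.comp ρ) := by
  obtain ⟨s, hs, h⟩ := hρ.exists_continuation (L := L)
  obtain ⟨V, hxV, hV, -⟩ := exists_mem_developingMaps (L := L) hlam hC hs
  refine ⟨_, hV, hxV, fun γ => ?_⟩
  obtain ⟨W, hW, h0, h1⟩ := h γ
  refine ⟨W, hW, h0, h1.mono fun y hy => ?_⟩
  rw [hy, MonoidHom.comp_apply, ← map_inv projPSL]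
  rfl

/-- The initial germ of any developing map is g times the position of L in `s`. By uniqueness this
persists along every loop, and comparing end germs gives σ⁻¹ g = g ρ⁻¹ on a nonconstant germ, hence
in PSL₂. -/
theorem IsMonodromy.exists_conj (hlam : lam ≠ 0) (hC : C.IsIrreducible) {x₀ : X}
    {ρ : FundamentalGroup X x₀ →* SL(2, ℂ)} (hρ : C.IsMonodromy x₀ ρ)
    {σ : FundamentalGroup X x₀ →* Matrix.ProjectiveSpecialLinearGroup (Fin 2) ℂ}
    (hσ : IsMonodromyOfBPS (developingMaps lam (C.inducedOper L)) x₀ σ) :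
    ∃ g : Matrix.ProjectiveSpecialLinearGroup (Fin 2) ℂ, ∀ γ, σ γ = g * projPSL (ρ γ) * g⁻¹ := by
  obtain ⟨s, hs, h⟩ := hρ.exists_continuation (L := L)
  obtain ⟨p, hp, hxp, hσ⟩ := hσ
  obtain ⟨g, hg⟩ := exists_smul_of_mem_developingMaps hlam hC hp hxp hs
  refine ⟨projPSL g, fun γ => ?_⟩
  obtain ⟨γ, rfl⟩ : ∃ γ' : Path x₀ x₀,
      FundamentalGroup.fromPath (Path.Homotopic.Quotient.mk γ') = γ := Quotient.exists_rep γ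
  obtain ⟨W, hW, h0, h1⟩ := h γ
  obtain ⟨W', hW', h0', h1'⟩ := hσ γ
  have hu := hW.eventually_eq_smul hW' g (by rwa [h0, h0']) 1
  rw [γ.target] at hu
  set τ := FundamentalGroup.fromPath (Path.Homotopic.Quotient.mk γ)
  have hA : ∀ᶠ y in 𝓝 x₀, (projPSL (ρ τ) * (projPSL g)⁻¹ * (σ τ)⁻¹ * projPSL g) •
      L.position s y = L.position s y := by
    filter_upwards [hg, h1, h1', hu] with y h2 h3 h4 h5
    have e1 : (σ τ)⁻¹ • projPSL g • L.position s y = projPSL g • (projPSL (ρ τ))⁻¹ •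
        L.position s y := by
      have e2 : projPSL g • L.position s y = p.2 y := h2.symm
      rw [e2, ← h4, h5, h3, ← map_inv projPSL]
      rfl
    rw [mul_smul, mul_smul, e1, mul_smul, inv_smul_smul, smul_inv_smul]
  have := psl_eq_one_of_eventually_smul_eq hs.pHolAt (hs.not_eventually_const hC) hA
  rw [mul_eq_one_iff_eq_inv] at this
  have h6 : (σ τ)⁻¹ = projPSL g * (projPSL (ρ τ))⁻¹ * (projPSL g)⁻¹ := by
    rw [← this]; group
  rw [← inv_inv (σ τ), h6]
  group

end ProjectiveMonodromy

end SLTwoLambdaConnection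

/-! ### Monodromy of a locally constant cocycle. -/

section Cocycle

/-- The monodromy of a principal bundle with discrete structure group `G`, described by a locally
constant cocycle `g`. -/
theorem exists_monodromy_of_cocycle {X G : Type*} [TopologicalSpace X] [Group G] (U : X → Set X)
    (hU : ∀ i, IsOpen (U i)) (hxU : ∀ x, x ∈ U x) (g : X → X → X → G)
    (hself : ∀ i, ∀ x ∈ U i, g i i x = 1)
    (hloc : ∀ i j, ∀ x ∈ U i ∩ U j, ∀ᶠ y in 𝓝 x, g i j y = g i j x)
    (hcomp : ∀ i j k, ∀ x ∈ U i ∩ U j ∩ U k, g j k x * g i j x = g i k x) (x₀ : X) :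
    ∃ ρ : FundamentalGroup X x₀ →* G, ∀ γ : Path x₀ x₀, ∃ a : unitInterval → G, a 0 = 1 ∧
      a 1 = ρ (FundamentalGroup.fromPath (Path.Homotopic.Quotient.mk γ)) ∧
      ∀ t, ∀ᶠ t' in 𝓝 t, γ t' ∈ U (γ t) ∧ g (γ t') (γ t) (γ t') * a t' = a t := by
  -- With the discrete topology on G, the bundle glued from the cocycle is a covering of X, and its
  -- path lifting supplies the monodromy.
  let _ : TopologicalSpace G := ⊥
  have : DiscreteTopology G := ⟨rfl⟩
  let Z : FiberBundleCore X X G :=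
    { baseSet := U
      isOpen_baseSet := hU
      indexAt := id
      mem_baseSet_at := hxU
      coordChange := fun i j x A => g i j x * A
      coordChange_self := fun i x hx A => by rw [hself i x hx, one_mul]
      continuousOn_coordChange := fun i j p hp => by
        refine ContinuousAt.continuousWithinAt ?_
        have h1 : ∀ᶠ q : X × G in 𝓝 p, g i j q.1 = g i j p.1 :=
          continuous_fst.continuousAt.eventually (hloc i j p.1 hp.1)
        have h2 : ∀ᶠ q : X × G in 𝓝 p, q.2 = p.2 :=
          continuous_snd.continuousAt.eventually (f := Prod.snd) (p := (· = p.2))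
            (by rw [nhds_discrete]; rfl)
        refine continuousAt_const.congr (f := fun _ => g i j p.1 * p.2) ?_
        filter_upwards [h1, h2] with q h1 h2
        rw [h1, h2]
      coordChange_comp := fun i j k x hx A => by rw [← mul_assoc, hcomp i j k x hx] }
  have cov : IsCoveringMap (TotalSpace.proj : TotalSpace G Z.Fiber → X) :=
    FiberBundle.isCoveringMap
  let pt : X → G → TotalSpace G Z.Fiber := fun x A => ⟨x, A⟩
  let val : TotalSpace G Z.Fiber → G := fun e => e.2
  have hval : ∀ x A, val (pt x A) = A := fun _ _ => rfl
  have hsnd : ∀ (y : X) (e : TotalSpace G Z.Fiber),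
      (trivializationAt G Z.Fiber y e).2 = g e.1 y e.1 * val e := fun _ _ => rfl
  -- Transition functions multiply on the left, so right multiplication is globally defined. It
  -- commutes with lifting paths, which makes the endpoint map a homomorphism.
  let R : G → TotalSpace G Z.Fiber → TotalSpace G Z.Fiber := fun B e => pt e.1 (val e * B)
  have hR : ∀ B, Continuous (R B) := by
    intro B
    refine continuous_iff_continuousAt.2 fun e => ?_
    refine (FiberBundle.continuousAt_totalSpace G _).2
      ⟨(FiberBundle.continuous_proj G Z.Fiber).continuousAt, ?_⟩
    have h1 := ((FiberBundle.continuousAt_totalSpace G _).1 (continuousAt_id (x := e))).2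
    have h2 := (continuous_of_discreteTopology (f := fun A : G => A * B)).continuousAt.comp h1
    refine h2.congr (.of_forall fun e' => ?_)
    exact mul_assoc (g e'.1 e.1 e'.1) (val e') B
  let e₀ : (TotalSpace.proj : TotalSpace G Z.Fiber → X) ⁻¹' {x₀} := ⟨pt x₀ 1, rfl⟩
  have hfib : ∀ e : (TotalSpace.proj : TotalSpace G Z.Fiber → X) ⁻¹' {x₀},
      e.1 = pt x₀ (val e.1) := by
    rintro ⟨⟨x, A⟩, hx⟩
    obtain rfl : x = x₀ := hx
    rfl
  have hequiv : ∀ (q : Path.Homotopic.Quotient x₀ x₀) (B : G)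
      (e : (TotalSpace.proj : TotalSpace G Z.Fiber → X) ⁻¹' {x₀}),
      cov.monodromy q ⟨R B e.1, e.2⟩ = ⟨R B (cov.monodromy q e).1, (cov.monodromy q e).2⟩ := by
    rintro q B e
    refine cov.monodromy_eq_of_map_eq ((cov.liftPathQuotient q e).map ⟨R B, hR B⟩) ?_
    rw [← Path.Homotopic.Quotient.map_comp]
    exact cov.map_liftPathQuotient q e
  let ρ : FundamentalGroup X x₀ →* G := MonoidHom.mk' (fun q => val (cov.monodromy q e₀).1) (by
    intro p q
    -- The lift of q from the base point ends at its right translate by ρ(q). Lifting p from there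
    -- ends at ρ(p)ρ(q), in keeping with `p * q` meaning q first.
    have h1 : cov.monodromy q e₀ = ⟨R (val (cov.monodromy q e₀).1) e₀.1, rfl⟩ :=
      Subtype.ext ((hfib _).trans (congrArg (pt x₀) (one_mul _).symm))
    have h2 : cov.monodromy (p * q) e₀ = cov.monodromy p (cov.monodromy q e₀) :=
      cov.monodromy_trans_apply q p e₀
    rw [h2]
    generalize val (cov.monodromy q e₀).1 = B at h1 ⊢
    rw [h1]
    exact congrArg (fun e => val e.1) (hequiv p B e₀))
  refine ⟨ρ, fun γ => ?_⟩
  let Γ := cov.liftPath γ e₀.1 γ.source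
  have hΓ : ∀ t, (Γ t).1 = γ t := congr_fun (cov.liftPath_lifts γ e₀.1 γ.source)
  -- The value `a t` is the coordinate of the lift in the chart centred at γ t. Continuity into a
  -- discrete group makes its coordinate in one fixed chart locally constant, which is the required
  -- relation.
  refine ⟨fun t => val (Γ t), congrArg val (cov.liftPath_zero γ e₀.1 γ.source), rfl, fun t => ?_⟩
  have h1 := ((FiberBundle.continuousAt_totalSpace G _).1 (Γ.continuous.continuousAt (x := t))).2
  have h2 := h1.eventually (p := (· = g (Γ t).1 (Γ t).1 (Γ t).1 * val (Γ t)))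
    (by rw [nhds_discrete]; rfl)
  filter_upwards [h2, γ.continuous.continuousAt.eventually ((hU (γ t)).mem_nhds (hxU _))]
    with t' h2 h3
  refine ⟨h3, ?_⟩
  rw [← hΓ t, ← hΓ t']
  refine h2.trans ?_
  rw [hself _ _ (hxU _), one_mul]

end Cocycle

/-! ### Existence of the monodromy representation. -/

namespace SLTwoLambdaConnection

variable {X : Type*} [TopologicalSpace X] [ChartedSpace ℂ X] [IsManifold 𝓘(ℂ) ω X]
  {E : X → Type*} [∀ x, AddCommGroup (E x)] [∀ x, Module ℂ (E x)]
  [∀ x, TopologicalSpace (E x)] [TopologicalSpace (TotalSpace (Fin 2 → ℂ) E)]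
  [FiberBundle (Fin 2 → ℂ) E] [VectorBundle ℂ (Fin 2 → ℂ) E]
  [ContMDiffVectorBundle ω (Fin 2 → ℂ) E 𝓘(ℂ)] {lam : ℂ} {C : SLTwoLambdaConnection E lam}

section LinearMonodromy

theorem matrix_eq_of_combination {s : Fin 2 → Π x, E x} {y : X}
    (hs : LinearIndependent ℂ fun i => s i y) {m m' : Matrix (Fin 2) (Fin 2) ℂ}
    (h : ∀ i, ∑ j, m j i • s j y = ∑ j, m' j i • s j y) : m = m' := by
  ext j i
  have h0 : ∑ j, (m j i - m' j i) • s j y = 0 := by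
    simp only [sub_smul, Finset.sum_sub_distrib, h, sub_self]
  exact sub_eq_zero.1 (Fintype.linearIndependent_iff.1 hs _ h0 j)

theorem sum_smul_sum_smul {s : Fin 2 → Π x, E x} {y : X} (m m' : Matrix (Fin 2) (Fin 2) ℂ)
    (i : Fin 2) : ∑ j, m' j i • ∑ l, m l j • s l y = ∑ l, (m * m') l i • s l y := by
  simp only [Finset.smul_sum, Matrix.mul_apply, Finset.sum_smul, smul_smul]
  rw [Finset.sum_comm]
  simp only [mul_comm]

theorem IsParallelFrameAt.sum_smul {s : Fin 2 → Π x, E x} {x : X} (hs : C.IsParallelFrameAt s x)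
    (m : SL(2, ℂ)) : C.IsParallelFrameAt (fun i y => ∑ j, m.1 j i • s j y) x := by
  have hpar : ∀ i, C.IsParallelAt (fun y => ∑ j, m.1 j i • s j y) x := fun i => by
    simp only [Fin.sum_univ_two]
    exact (hs.isParallelAt 0).combination (hs.isParallelAt 1) _ _
  filter_upwards [hs, hpar 0, hpar 1] with y h h0 h1
  refine ⟨Fintype.linearIndependent_iff.2 fun c hc => ?_, fun i => ?_⟩
  · have h2 : (m.1).mulVec c = 0 := by
      funext l
      refine Fintype.linearIndependent_iff.1 h.1 _ ?_ l
      rw [← hc]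
      simp only [Fin.sum_univ_two, Matrix.mulVec, dotProduct]
      module
    have h3 := congrArg (Matrix.mulVec (m⁻¹).1) h2
    rw [Matrix.mulVec_mulVec, ← Matrix.SpecialLinearGroup.coe_mul, inv_mul_cancel,
      Matrix.SpecialLinearGroup.coe_one, Matrix.one_mulVec, Matrix.mulVec_zero] at h3
    exact congr_fun h3
  · fin_cases i
    exacts [h0, h1]

variable (C) in
/-- A `lam`-connection with `lam ≠ 0` has a monodromy representation. -/
theorem exists_isMonodromy (L : LineSubbundle E) (hlam : lam ≠ 0) (x₀ : X) :
    ∃ ρ : FundamentalGroup X x₀ →* SL(2, ℂ), C.IsMonodromy x₀ ρ := by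
  -- Normalising all local parallel frames to area one puts the transition matrices in SL₂.
  have hex : ∀ x, ∃ s : Fin 2 → Π x, E x, ∃ U : Set X, IsOpen U ∧ x ∈ U ∧
      ∀ y ∈ U, C.IsParallelFrameAt s y ∧ C.vol y ![s 0 y, s 1 y] = 1 := by
    intro x
    obtain ⟨s, hs, h1⟩ := C.exists_isParallelFrameAt L hlam x
    have harea := (hs.isParallelAt 0).eventually_area_eq hlam (hs.isParallelAt 1)
    rw [h1] at harea
    obtain ⟨U, hU, hUo, hxU⟩ := eventually_nhds_iff.1 (hs.eventually.and harea)
    exact ⟨s, U, hUo, hxU, hU⟩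
  choose S U hUo hxU hS using hex
  have hg : ∀ i j x, ∃ m : SL(2, ℂ), x ∈ U i ∩ U j →
      ∀ᶠ y in 𝓝 x, ∀ k, S i k y = ∑ l, m.1 l k • S j l y := by
    intro i j x
    by_cases hx : x ∈ U i ∩ U j
    · obtain ⟨m, hm, h⟩ := (hS j x hx.2).1.exists_matrix hlam (hS i x hx.1).1
      rw [(hS j x hx.2).2, (hS i x hx.1).2, mul_one] at hm
      exact ⟨⟨m, hm.symm⟩, fun _ => h⟩
    -- The value off the overlaps is arbitrary.
    · exact ⟨1, fun h => absurd h hx⟩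
  choose g hg using hg
  -- A transition matrix is determined by its effect at a single point; the cocycle identities and
  -- local constancy all follow from this.
  have huniq : ∀ {i j x} (m : SL(2, ℂ)), x ∈ U i ∩ U j →
      (∀ k, S i k x = ∑ l, m.1 l k • S j l x) → g i j x = m := fun m hx hm =>
    Subtype.ext (matrix_eq_of_combination (hS _ _ hx.2).1.self_of_nhds.1 fun k =>
      ((hg _ _ _ hx).self_of_nhds k).symm.trans (hm k))
  obtain ⟨ρ, hρ⟩ := exists_monodromy_of_cocycle U hUo hxU g
    (fun i x hx => huniq 1 ⟨hx, hx⟩ fun k => by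
      simp [Matrix.one_apply, ite_smul])
    (fun i j x hx => by
      filter_upwards [hg i j x hx, ((hUo i).inter (hUo j)).mem_nhds hx] with y h1 h2
        using huniq _ h2 h1)
    (fun i j k x hx => by
      refine (huniq _ ⟨hx.1.1, hx.2⟩ fun l => ?_).symm
      rw [(hg i j x hx.1).self_of_nhds l, Matrix.SpecialLinearGroup.coe_mul, ← sum_smul_sum_smul]
      exact Finset.sum_congr rfl fun l' _ => by
        rw [(hg j k x ⟨hx.1.2, hx.2⟩).self_of_nhds l']) x₀
  refine ⟨ρ, S x₀, fun γ => ?_⟩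
  obtain ⟨a, h0, h1, ha⟩ := hρ γ
  -- The transported frame at time t is the local frame at γ t times a(t). The relation between
  -- a(t') and a(t) is precisely what makes nearby frames agree as germs.
  refine ⟨fun t i y => ∑ j, (a t).1 j i • S (γ t) j y, fun t => ⟨?_, ?_⟩, ?_, fun i => ?_⟩
  · exact (hS _ _ (hxU _)).1.sum_smul (a t)
  · filter_upwards [ha t] with t' ht' i
    filter_upwards [hg (γ t') (γ t) (γ t') ⟨hxU _, ht'.1⟩] with y hy
    rw [← ht'.2, Matrix.SpecialLinearGroup.coe_mul, ← sum_smul_sum_smul]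
    exact Finset.sum_congr rfl fun j _ => by rw [hy]
  · funext i y
    simp [h0, Matrix.one_apply, ite_smul]
  · refine .of_forall fun y => ?_
    beta_reduce
    rw [h1, γ.target]

end LinearMonodromy

end SLTwoLambdaConnection

end

theorem proposition4p1 {X : Type*} [TopologicalSpace X] [T2Space X] [ConnectedSpace X]
    [ChartedSpace ℂ X] [IsManifold 𝓘(ℂ) ω X]
    {E : X → Type*} [∀ x, AddCommGroup (E x)] [∀ x, Module ℂ (E x)]
    [∀ x, TopologicalSpace (E x)] [TopologicalSpace (TotalSpace (Fin 2 → ℂ) E)]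
    [FiberBundle (Fin 2 → ℂ) E] [VectorBundle ℂ (Fin 2 → ℂ) E]
    [ContMDiffVectorBundle ω (Fin 2 → ℂ) E 𝓘(ℂ)]
    (lam : ℂ) (hlam : lam ≠ 0)
    (C : SLTwoLambdaConnection E lam) (hC : C.IsIrreducible) (L : LineSubbundle E) :
    IsOper lam (C.inducedOper L) ∧
    BPSEquivalent (developingMaps lam (C.inducedOper L)) (C.projectivisation L) ∧
    (lam = 1 → ∀ x₀ : X,
      (∃ ρ : FundamentalGroup X x₀ →* SL(2, ℂ), C.IsMonodromy x₀ ρ) ∧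
      ∀ ρ : FundamentalGroup X x₀ →* SL(2, ℂ), C.IsMonodromy x₀ ρ →
        IsMonodromyOfBPS (developingMaps lam (C.inducedOper L)) x₀ (projPSL.comp ρ) ∧
        ∀ σ : FundamentalGroup X x₀ →* Matrix.ProjectiveSpecialLinearGroup (Fin 2) ℂ,
          IsMonodromyOfBPS (developingMaps lam (C.inducedOper L)) x₀ σ →
            ∃ g : Matrix.ProjectiveSpecialLinearGroup (Fin 2) ℂ,
              ∀ γ, σ γ = g * projPSL (ρ γ) * g⁻¹) :=
  ⟨C.isOper hlam hC L, C.bpsEquivalent hlam hC L, fun _ x₀ =>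
    ⟨C.exists_isMonodromy L hlam x₀, fun _ hρ => ⟨hρ.isMonodromyOfBPS hlam hC L,
      fun _ hσ => hρ.exists_conj hlam hC hσ⟩⟩⟩
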